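/- **Setting.** Let $\alpha\in(0,1)$, let $Y\in\mathbb R^d$ and $Z\in\mathbb R^q$ be independent random variables, and let $\varphi:\mathbb R^d\times\mathbb R^q\to\mathbb R$ be measurable with $\mathbb E|\varphi(Y,Z)|^{2+\delta}<\infty$ for some $\delta>0$. Let $X_0=\mathbb E[\varphi(Y,Z)\mid Y]$ and, for $h=1/K\in\mathcal H=\{1/K: K\ge 1 \text{ integer}\}$, let $X_h=\frac1K\sum_{k=1}^K\varphi(Y,Z^{(k)})$, where $Z^{(1)},\dots,Z^{(K)}$ are independent copies of $Z$, independent of $Y$. Put $V_h(\xi)=\xi+\frac1{1-\alpha}\mathbb E[(X_h-\xi)^+]$, and let $$\xi^0_\star=\inf\{\xi:\mathbb P(X_0\le\xi)\ge\alpha\},\qquad \chi^0_\star=\frac1{1-\alpha}\int_\alpha^1\inf\{\xi:\mathbb P(X_0\le\xi)\ge a\}\,da$$ be the value-at-risk and the expected shortfall of $X_0$ at level $\alpha$. Assume: 1. $F_{X_h}(\xi)-F_{X_0}(\xi)=v(\xi)h+w(\xi,h)h$ for all $h\in\mathcal H$, $\xi\in\mathbb R$, where, for every minimizer $\xi_0$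 of $V_0$, $v$ and $w(\cdot,h)$ are integrable on $(\xi_0,\infty)$, and $w(\xi_0,h)\to0$, $\int_{\xi_0}^\infty w(\xi,h)\,d\xi\to0$ as $\mathcal H\ni h\downarrow0$. 2. For $h\in\mathcal H\cup\{0\}$, $X_h$ has a continuous density $f_{X_h}$, and $f_{X_h}\to f_{X_0}$ locally uniformly as $\mathcal H\ni h\downarrow0$. 3. For every $R>0$, $\inf\{f_{X_h}(\xi):h\in\mathcal H\cup\{0\},\,|\xi-\xi^0_\star|<R\}>0$. 4. The densities $f_{X_h}$, $h\in\mathcal H\cup\{0\}$, are uniformly bounded and uniformly Lipschitz. **Scheme (NSA).** For $h\in\mathcal H$ let $X_h^{(1)},X_h^{(2)},\dots$ be i.i.d. copies of $X_h$ and let $\xi^h_0$ be a real random variable independent of them, with $$\sup_{h\in\mathcal H}\mathbb E\Big[|\xi^h_0|^2\exp\Big(\tfrac4{1-\alpha}\max\big(1,\tfrac\alpha{1-\alpha}\big)\sup_{h'\in\mathcal H}\|f_{X_{h'}}\|_\infty\,|\xi_0^h|\Big)\Big]<\infty .$$ Set $\chi^h_0=0$ and, with $\gamma_n=\gamma_1n^{-\beta}$,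 $\gamma_1>0$, $\beta\in(\frac12,1]$, $$\xi^h_{n+1}=\xi^h_n-\gamma_{n+1}\Big(1-\tfrac1{1-\alpha}\mathbf 1_{X_h^{(n+1)}\ge\xi^h_n}\Big),\qquad \chi^h_{n+1}=\chi^h_n-\tfrac1{n+1}\Big(\chi^h_n-\xi^h_n-\tfrac1{1-\alpha}\big(X_h^{(n+1)}-\xi^h_n\big)^+\Big).$$ If $\beta=1$, assume moreover $\lambda\gamma_1>1$, where, with $\xi^h_\star=\arg\min V_h$ and $[\cdot]_{\rm Lip}$ the Lipschitz constant, $$\lambda=\inf_{h\in\mathcal H\cup\{0\}}\ \min\Big(\tfrac38V_h''(\xi^h_\star),\ \|V_h''\|_\infty\frac{V_h''(\xi^h_\star)^4}{4[V_h'']_{\rm Lip}^2}\Big).$$ The cost of a run is the total cost of its primitive steps: drawing the initial value, a copy of $Y$ or a copy of $Z$, evaluating $\varphi$, and elementary operations on real numbers, each kind of step having a fixed non-negative cost. A sample of $X_{1/K}$ is generated from one draw of $Y$, $K$ draws of $Z$ and $K$ evaluations of $\varphi$. **Theorem.** For $\varepsilon\in(0,1)$ set $h=1/\lceil\varepsilon^{-1/\beta}\rceil\in\mathcal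 H$ and $n=\lceil h^{-2}\rceil$. Then $n=\lceil\varepsilon^{-1/\beta}\rceil^2$, and $h\sim\varepsilon^{1/\beta}$, $n\sim\varepsilon^{-2/\beta}$ as $\varepsilon\downarrow0$. Moreover: * NSA has convergence rate in distribution of order $\varepsilon$. Precisely, as $\varepsilon\downarrow0$, $$\begin{pmatrix}\varepsilon^{-1}(\xi^h_n-\xi^0_\star)\\ \varepsilon^{-1/\beta}(\chi^h_n-\chi^0_\star)\end{pmatrix}\xrightarrow{\ \mathcal L\ }\mathcal N\left(\begin{pmatrix}-\frac{v(\xi^0_\star)}{f_{X_0}(\xi^0_\star)}\mathbf 1_{\beta=1}\\-\int_{\xi^0_\star}^\infty\frac{v(\xi)}{1-\alpha}d\xi\end{pmatrix},\Sigma_\beta\right),$$ $$\Sigma_\beta=\begin{pmatrix}\frac{\alpha\gamma_1}{2f_{X_0}(\xi^0_\star)-\gamma_1^{-1}(1-\alpha)\mathbf 1_{\beta=1}}&\alpha\frac{\chi^0_\star-\xi^0_\star}{f_{X_0}(\xi^0_\star)}\mathbf 1_{\beta=1}\\ \alpha\frac{\chi^0_\star-\xi^0_\star}{f_{X_0}(\xi^0_\star)}\mathbf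 1_{\beta=1}&\frac{\mathrm{Var}((X_0-\xi^0_\star)^+)}{(1-\alpha)^2}\end{pmatrix}.$$ * There is a constant $0<C<\infty$, independent of $\varepsilon$, such that for every $\varepsilon\in(0,1)$ the algorithm that computes $h$, $n$ and then $(\xi^h_n,\chi^h_n)$ has cost at most $C\varepsilon^{-3/\beta}$. * The optimal cost is reached at $\beta=1$, under $\lambda\gamma_1>1$: the cost for $\beta=1$ is at most $C\varepsilon^{-3}$ and, for every $\varepsilon\in(0,1)$, it is at most the cost for any $\beta'\in(\frac12,1]$. -/

import Mathlib

open MeasureTheory ProbabilityTheory Filter Topology Set Asymptotics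
open scoped NNReal ENNReal

noncomputable section

namespace NestedSA

/-! ### Value-at-risk, expected shortfall and the objective function -/

/-- The value-at-risk (lower quantile) at level `a` of a law `ν` on `ℝ`:
`inf {ξ : ν (-∞, ξ] ≥ a}`. -/
def valueAtRisk (a : ℝ) (ν : Measure ℝ) : ℝ :=
  sInf {ξ : ℝ | a ≤ ν.real (Iic ξ)}

/-- The expected shortfall at level `α` of a law `ν` on `ℝ`:
`(1 - α)⁻¹ ∫_α^1 VaR_a(ν) da`. -/
def expectedShortfall (α : ℝ) (ν : Measure ℝ) : ℝ :=
  (1 - α)⁻¹ * ∫ a in α..1, valueAtRisk a ν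

/-- The objective `V(ξ) = ξ + (1 - α)⁻¹ E[(X - ξ)⁺]`, for `X` of law `ν`. -/
def objective (α : ℝ) (ν : Measure ℝ) (ξ : ℝ) : ℝ :=
  ξ + (1 - α)⁻¹ * ∫ x, max (x - ξ) 0 ∂ν

/-- The (least) minimizer of a function on `ℝ`; it is the minimizer when there is only one. -/
def leastArgmin (V : ℝ → ℝ) : ℝ :=
  sInf {ξ : ℝ | IsMinOn V univ ξ}

/-! ### The nested model -/

/-- The set `{1/K : K a positive integer}` of bias parameters. -/
def biasSet : Set ℝ :=
  {h : ℝ | ∃ K : ℕ, 0 < K ∧ h = 1 / (K : ℝ)}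

/-- The empirical mean `K⁻¹ ∑ₖ φ(y, zₖ)`. -/
def innerMean {d q : ℕ} (φ : (Fin d → ℝ) × (Fin q → ℝ) → ℝ) (K : ℕ)
    (y : Fin d → ℝ) (z : Fin K → Fin q → ℝ) : ℝ :=
  1 / (K : ℝ) * ∑ k, φ (y, z k)

/-- The law of the loss `X_h`. For `h = 0` it is the law of `X₀ = E[φ(Y, Z) | Y]`. For `h = 1/K`
it is the law of `X_h = K⁻¹ ∑_{k ≤ K} φ(Y, Z⁽ᵏ⁾)`, where `Z⁽¹⁾, …, Z⁽ᴷ⁾` are independent copies of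
`Z`, independent of `Y`. (Only `h ∈ biasSet ∪ {0}` is ever relevant.) -/
def lossLaw {Ω : Type*} [MeasurableSpace Ω] (P : Measure Ω) {d q : ℕ}
    (Y : Ω → Fin d → ℝ) (Z : Ω → Fin q → ℝ) (φ : (Fin d → ℝ) × (Fin q → ℝ) → ℝ)
    (h : ℝ) : Measure ℝ :=
  if h = 0 then
    P.map (P[fun ω => φ (Y ω, Z ω) | MeasurableSpace.comap Y inferInstance])
  else
    ((P.map Y).prod (Measure.pi fun _ : Fin ⌊h⁻¹⌋₊ => P.map Z)).map
      fun p => innerMean φ ⌊h⁻¹⌋₊ p.1 p.2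

/-! ### Standing assumptions -/

/-- Assumptions on the family of laws `ν h` of `X_h`, `h ∈ biasSet ∪ {0}`, with densities `f h`.
The functions `v` and `w · h` are the coefficients of the first order expansion of the cdf of `X_h`
in `h`. -/
structure LossAssumptions (α : ℝ) (ν : ℝ → Measure ℝ) (f : ℝ → ℝ → ℝ)
    (v : ℝ → ℝ) (w : ℝ → ℝ → ℝ) : Prop where
  /-- First order expansion of the cdf. -/
  expansion : ∀ h ∈ biasSet, ∀ ξ : ℝ,
    (ν h).real (Iic ξ) - (ν 0).real (Iic ξ) = v ξ * h + w ξ h * h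
  /-- `∫_{ξ₀}^∞ v` is a finite integral. -/
  integrable_v : ∀ ξ₀ : ℝ, IsMinOn (objective α (ν 0)) univ ξ₀ → IntegrableOn v (Ioi ξ₀)
  /-- The integrals `∫_{ξ₀}^∞ w(ξ, h) dξ` make sense. -/
  integrable_w : ∀ ξ₀ : ℝ, IsMinOn (objective α (ν 0)) univ ξ₀ → ∀ h ∈ biasSet,
    IntegrableOn (fun ξ => w ξ h) (Ioi ξ₀)
  tendsto_w : ∀ ξ₀ : ℝ, IsMinOn (objective α (ν 0)) univ ξ₀ →
    Tendsto (fun h => w ξ₀ h) (𝓝[biasSet] 0) (𝓝 0)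
  tendsto_integral_w : ∀ ξ₀ : ℝ, IsMinOn (objective α (ν 0)) univ ξ₀ →
    Tendsto (fun h => ∫ ξ in Ioi ξ₀, w ξ h) (𝓝[biasSet] 0) (𝓝 0)
  /-- `f h` is a continuous pdf of `X_h`. -/
  continuous_pdf : ∀ h ∈ insert 0 biasSet, Continuous (f h)
  nonneg_pdf : ∀ h ∈ insert 0 biasSet, ∀ x, 0 ≤ f h x
  law_eq : ∀ h ∈ insert 0 biasSet,
    ν h = (volume : Measure ℝ).withDensity fun x => ENNReal.ofReal (f h x)
  /-- The pdf converge locally uniformly. -/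
  tendsto_pdf : TendstoLocallyUniformly f (f 0) (𝓝[biasSet] 0)
  /-- On every ball about the value-at-risk of `X₀`, the infimum of the pdf over the ball and over
  all `h` is positive. -/
  pdf_pos : ∀ R > 0, ∃ c > 0, ∀ h ∈ insert 0 biasSet,
    ∀ ξ ∈ Metric.ball (valueAtRisk α (ν 0)) R, c ≤ f h ξ
  /-- The pdf are uniformly bounded and uniformly Lipschitz. -/
  pdf_bounded_lipschitz : ∃ M : ℝ≥0, ∀ h ∈ insert 0 biasSet,
    (∀ x, |f h x| ≤ M) ∧ LipschitzWith M (f h)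

/-- `sup {‖f h‖_∞ : h ∈ biasSet}`. -/
def supDensity (f : ℝ → ℝ → ℝ) : ℝ :=
  ⨆ p : biasSet × ℝ, |f p.1 p.2|

/-- The assumption on the initializations `ξ₀ h`: with `c_α = max 1 (α / (1 - α))`,
`sup_h E[|ξ₀ h|² exp (4 / (1 - α) * c_α * sup_h' ‖f h'‖_∞ * |ξ₀ h|)] < ∞`. -/
def InitAssumption {Ω : Type*} [MeasurableSpace Ω] (P : Measure Ω) (α : ℝ)
    (f : ℝ → ℝ → ℝ) (ξ₀ : ℝ → Ω → ℝ) : Prop :=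
  (⨆ h ∈ biasSet, ∫⁻ ω, ENNReal.ofReal (|ξ₀ h ω| ^ 2 *
    Real.exp (4 / (1 - α) * max 1 (α / (1 - α)) * supDensity f * |ξ₀ h ω|)) ∂P) < ∞

/-- The supremum norm of a bounded function. -/
def supNorm (g : ℝ → ℝ) : ℝ := ⨆ x, |g x|

/-- The (best) Lipschitz constant of a Lipschitz function. -/
def lipConst (g : ℝ → ℝ) : ℝ := ⨆ p : ℝ × ℝ, |g p.1 - g p.2| / |p.1 - p.2|

/-- The constant
`λ = inf_h min (3/8 V_h''(ξ_h)) (‖V_h''‖_∞ V_h''(ξ_h)⁴ / (4 [V_h'']_Lip²))`, the infimum being over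
`h ∈ biasSet ∪ {0}`, where `V_h` is the objective of `X_h` and `ξ_h` its minimizer. -/
def lambdaConst (α : ℝ) (ν : ℝ → Measure ℝ) : ℝ :=
  ⨅ h : (insert 0 biasSet : Set ℝ),
    let V := objective α (ν h)
    let V'' := deriv (deriv V)
    let ξ := leastArgmin V
    min (3 / 8 * V'' ξ) (supNorm V'' * (V'' ξ ^ 4 / (4 * lipConst V'' ^ 2)))

/-! ### The nested stochastic approximation scheme -/

/-- `H₁(ξ, x) = 1 - (1 - α)⁻¹ 1_{x ≥ ξ}`. -/
def H₁ (α ξ x : ℝ) : ℝ := 1 - 1 / (1 - α) * (if ξ ≤ x then 1 else 0)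

/-- `H₂(ξ, χ, x) = χ - (ξ + (1 - α)⁻¹ (x - ξ)⁺)`. -/
def H₂ (α ξ χ x : ℝ) : ℝ := χ - (ξ + 1 / (1 - α) * max (x - ξ) 0)

/-- The learning rate `γₙ = γ₁ n^{-β}`. -/
def rate (γ₁ β : ℝ) (n : ℕ) : ℝ := γ₁ * (n : ℝ) ^ (-β)

/-- The iterates `(ξₙ, χₙ)` of the scheme, started from `(ξ₀, 0)` and driven by the innovations
`X⁽ⁿ⁺¹⁾ = x n`. -/
def nsa (α γ₁ β ξ₀ : ℝ) (x : ℕ → ℝ) : ℕ → ℝ × ℝ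
  | 0 => (ξ₀, 0)
  | n + 1 =>
    let s := nsa α γ₁ β ξ₀ x n
    (s.1 - rate γ₁ β (n + 1) * H₁ α s.1 (x n),
      s.2 - 1 / ((n + 1 : ℕ) : ℝ) * H₂ α s.1 s.2 (x n))

/-- The integer `⌈ε^{-1/β}⌉`. -/
def innerSize (β ε : ℝ) : ℕ := ⌈ε ^ (-(1 / β))⌉₊

/-- The bias parameter `h = 1 / ⌈ε^{-1/β}⌉`. -/
def biasParam (β ε : ℝ) : ℝ := 1 / (innerSize β ε : ℝ)

/-- The number of iterations `n = ⌈h⁻²⌉`. -/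
def numIter (h : ℝ) : ℕ := ⌈h ^ (-2 : ℤ)⌉₊

/-! ### Cost -/

/-- A value together with the cost of the computation that produced it. -/
structure Timed (A : Type) where
  val : A
  time : ℝ≥0

instance : Monad Timed where
  pure a := ⟨a, 0⟩
  bind m g := ⟨(g m.val).val, m.time + (g m.val).time⟩

/-- Return `a` at cost `c`. -/
def charge {A : Type} (c : ℝ≥0) (a : A) : Timed A := ⟨a, c⟩

/-- The costs of the primitive steps: one draw of the initial value, of `Y`, of `Z`, one evaluation
of `φ`, and one elementary operation on real numbers (arithmetic operation, power, rounding,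
comparison). -/
structure UnitCosts where
  drawInit : ℝ≥0
  drawY : ℝ≥0
  drawZ : ℝ≥0
  evalφ : ℝ≥0
  op : ℝ≥0

/-- Accumulate `∑_{k < K} φ(y, z k)`, drawing the `z k` one after the other. -/
def runSum {d q : ℕ} (c : UnitCosts) (φ : (Fin d → ℝ) × (Fin q → ℝ) → ℝ)
    (y : Fin d → ℝ) (z : ℕ → Fin q → ℝ) : ℕ → Timed ℝ
  | 0 => pure 0
  | k + 1 => do
    let s ← runSum c φ y z k
    let zk ← charge c.drawZ (z k)
    let p ← charge c.evalφ (φ (y, zk))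
    charge c.op (s + p)

/-- Simulate one sample of `X_h`, `h = 1/K`. -/
def runLoss {d q : ℕ} (c : UnitCosts) (φ : (Fin d → ℝ) × (Fin q → ℝ) → ℝ)
    (K : ℕ) (y : Fin d → ℝ) (z : ℕ → Fin q → ℝ) : Timed ℝ := do
  let y' ← charge c.drawY y
  let s ← runSum c φ y' z K
  charge (2 * c.op) (1 / (K : ℝ) * s)

/-- Run `n` iterations of the scheme; iteration `i + 1` draws `y i` and `z i 0, z i 1, …`. The
factors of `c.op` count the elementary operations in the formula next to them. -/
def runIter {d q : ℕ} (c : UnitCosts) (φ : (Fin d → ℝ) × (Fin q → ℝ) → ℝ)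
    (α γ₁ β : ℝ) (K : ℕ) (ξ₀ : ℝ) (y : ℕ → Fin d → ℝ) (z : ℕ → ℕ → Fin q → ℝ) :
    ℕ → Timed (ℝ × ℝ)
  | 0 => charge c.drawInit (ξ₀, 0)
  | n + 1 => do
    let s ← runIter c φ α γ₁ β K ξ₀ y z n
    let x ← runLoss c φ K (y n) (z n)
    let m ← charge c.op (n + 1)
    let γ ← charge (3 * c.op) (rate γ₁ β m)
    let g₁ ← charge (5 * c.op) (H₁ α s.1 x)
    let g₂ ← charge (7 * c.op) (H₂ α s.1 s.2 x)
    let ξ ← charge (2 * c.op) (s.1 - γ * g₁)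
    let χ ← charge (3 * c.op) (s.2 - 1 / (m : ℝ) * g₂)
    pure (ξ, χ)

/-- The complete algorithm for the accuracy `ε`: compute `K = ⌈ε^{-1/β}⌉`, `h = 1/K` and
`n = ⌈h⁻²⌉`, then run `n` iterations with bias parameter `h`. The initial value and the random
draws are read from `ξ₀`, `y`, `z`. -/
def runNSA {d q : ℕ} (c : UnitCosts) (φ : (Fin d → ℝ) × (Fin q → ℝ) → ℝ)
    (α γ₁ β ε : ℝ) (ξ₀ : ℝ) (y : ℕ → Fin d → ℝ) (z : ℕ → ℕ → Fin q → ℝ) :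
    Timed (ℝ × ℝ) := do
  let K ← charge (4 * c.op) (innerSize β ε)
  let h ← charge c.op (1 / (K : ℝ))
  let n ← charge (2 * c.op) (numIter h)
  runIter c φ α γ₁ β K ξ₀ y z n

/-! ### The limit law -/

/-- The covariance matrix `Σ_β` of the limit law, for the law `ν₀` of `X₀` and its density `f₀`. -/
def limitCov (α γ₁ β : ℝ) (ν₀ : Measure ℝ) (f₀ : ℝ → ℝ) : Matrix (Fin 2) (Fin 2) ℝ :=
  let ξ := valueAtRisk α ν₀
  let χ := expectedShortfall α ν₀
  let one : ℝ := if β = 1 then 1 else 0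
  !![α * γ₁ / (2 * f₀ ξ - γ₁⁻¹ * (1 - α) * one), α * ((χ - ξ) / f₀ ξ) * one;
     α * ((χ - ξ) / f₀ ξ) * one, Var[fun x => max (x - ξ) 0; ν₀] / (1 - α) ^ 2]

/-- The mean of the limit law. -/
def limitMean (α β : ℝ) (ν₀ : Measure ℝ) (f₀ v : ℝ → ℝ) : EuclideanSpace ℝ (Fin 2) :=
  let ξ := valueAtRisk α ν₀
  let one : ℝ := if β = 1 then 1 else 0
  !₂[-(v ξ / f₀ ξ) * one, -∫ x in Ioi ξ, v x / (1 - α)]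

end NestedSA

end

open NestedSA

namespace NestedSA

/-! ### Step sizes and deterministic recursions -/

/-! Put `K = ⌈ε^{-1/β}⌉`. Then h = 1/K and n = K² exactly, so the problem concerns a sequence
indexed by `K`, normalised by `K^β` and `K`; `ε` comes back at the end through deterministic factors
tending to 1 (`scale_euclidean_two`). Let θ_K be the quantile of X_{1/K}, V_K its objective, θ the
quantile of X_0 and f its density. The error is a bias (θ_K against θ, V_K(θ_K) against V_0(θ)) plus
a statistical error around θ_K and V_K(θ_K).

Bias. Dividing the expansion of the cdf at θ by the density gives K(θ_K - θ) → -v(θ)/f(θ)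
(`tendsto_mul_valueAtRisk_sub`); the normalisation multiplies this by K^(β-1), so it survives only
for β = 1. The expected shortfall is the minimum of the objective (`expectedShortfall_eq`). As θ_K
minimises V_K, moving the minimiser has a second order effect, and only the integrated expansion of
the cdf remains (`tendsto_mul_objective_sub`).

Statistical error. The mean of `H₁` is V_K', whose slope at θ_K tends to a = f(θ)/(1-α). The error
ξ_n - θ_K is replaced by `linPart`, the solution of the recursion with constant slope a, which is a
weighted sum of i.i.d. bounded variables; χ_n, an average of gains along the iterates, is replaced
by the average of gains at θ_K. The law changes with n, so both replacements must be uniform over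
laws. The squared distance to the quantile is a Lyapunov function: divergence of the sum of the γ_k
forces a visit near the quantile, and summability of γ_k² keeps the iterates there
(`exists_forall_integral_one_sub_good_le`). On this event the mean square error is O(γ_n)
(`exists_forall_integral_good_mul_sq_le`). The remainder of the linearization splits into a drift
part, small in L¹, and a martingale part, small in L² (`exists_split`). For the gains, the drift is
quadratic because V_K is flat at θ_K, and the γ_k sum to o(√n) because β > 1/2.

Limit law. A linear combination of the two leading terms is a sum of K² independent centred
variables, whose characteristic function is compared with a Gaussian one up to a Lyapunov sum of
order p ∈ (2, 3] (`norm_integral_cexp_sum_sub_le`). Chung's lemma (`StepSize.tendsto_div_rpow`)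
gives the sums of weights: the sum of squares is equivalent to γ_n/(2a - κ) and the plain sum tends
to 1/a, where κ is 1/γ₁ if β = 1 and 0 otherwise. The cross term carries K^(β-1), hence vanishes
unless β = 1. The condition λγ₁ > 1 enters through λ ≤ 3a/8, which yields κ < 2a.

Cost. Counting the steps gives an explicit polynomial of degree 3 in `K` with nonnegative
coefficients, and K ≤ 2ε^{-1/β}. It is monotone in `K`, and `K` is least at β = 1. -/

/-- Step sizes `γ n`, `n ≥ 1`, of a stochastic approximation scheme; `κ` measures the speed at which
consecutive ratios tend to `1`. -/
structure StepSize (γ : ℕ → ℝ) (κ : ℝ) : Prop where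
  pos : ∀ n, 0 < γ (n + 1)
  tendsto_zero : Tendsto γ atTop (𝓝 0)
  tendsto_sum : Tendsto (fun n => ∑ k ∈ Finset.range n, γ (k + 1)) atTop atTop
  summable_sq : Summable fun n => γ (n + 1) ^ 2
  ratio : Tendsto (fun n => (γ n / γ (n + 1) - 1) / γ (n + 1)) atTop (𝓝 κ)

/-- Iterating with 1 - x ≤ exp(-x) bounds `w n` by a constant times exp(-s ∑ γ), and the sum
diverges. -/
lemma tendsto_zero_of_le_mul {γ w : ℕ → ℝ} {s : ℝ} (hs : 0 < s)
    (hsum : Tendsto (fun n => ∑ k ∈ Finset.range n, γ (k + 1)) atTop atTop)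
    (hw : ∀ n, 0 ≤ w n) (hrec : ∀ᶠ n in atTop, w (n + 1) ≤ (1 - s * γ (n + 1)) * w n) :
    Tendsto w atTop (𝓝 0) := by
  obtain ⟨N, hN⟩ := eventually_atTop.1 hrec
  set S : ℕ → ℝ := fun n => ∑ k ∈ Finset.range n, γ (k + 1) with hS
  have key : ∀ n, N ≤ n → w n ≤ w N * Real.exp (-s * (S n - S N)) := by
    intro n hn
    induction n, hn using Nat.le_induction with
    | base => simp
    | succ n hn ih =>
      have h1 : 1 - s * γ (n + 1) ≤ Real.exp (-s * γ (n + 1)) := by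
        have := Real.add_one_le_exp (-s * γ (n + 1)); linarith
      calc w (n + 1) ≤ (1 - s * γ (n + 1)) * w n := hN n hn
        _ ≤ Real.exp (-s * γ (n + 1)) * w n := mul_le_mul_of_nonneg_right h1 (hw n)
        _ ≤ Real.exp (-s * γ (n + 1)) * (w N * Real.exp (-s * (S n - S N))) := by gcongr
        _ = w N * Real.exp (-s * (S (n + 1) - S N)) := by
          rw [mul_left_comm, ← Real.exp_add]
          congr 2
          simp only [hS, Finset.sum_range_succ]
          ring
  have hlim : Tendsto (fun n => w N * Real.exp (-s * (S n - S N))) atTop (𝓝 0) := by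
    have h2 : Tendsto (fun n => -s * (S n - S N)) atTop atBot :=
      (tendsto_atTop_add_const_right _ (-S N) hsum).const_mul_atTop_of_neg (by linarith)
    simpa using (Real.tendsto_exp_atBot.comp h2).const_mul (w N)
  exact tendsto_of_tendsto_of_tendsto_of_le_of_le' tendsto_const_nhds hlim
    (Eventually.of_forall hw) (eventually_atTop.2 ⟨N, key⟩)

/-- B/t is the asymptotic fixed point: recentred there, the forcing is `b n - θ n * (B / t)`, which
tends to 0. -/
lemma tendsto_of_contraction {γ θ b ρ : ℕ → ℝ} {t B : ℝ} (hpos : ∀ n, 0 < γ (n + 1))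
    (h0 : Tendsto γ atTop (𝓝 0))
    (hsum : Tendsto (fun n => ∑ k ∈ Finset.range n, γ (k + 1)) atTop atTop)
    (hθ : Tendsto θ atTop (𝓝 t)) (ht : 0 < t) (hb : Tendsto b atTop (𝓝 B))
    (hrec : ∀ᶠ n in atTop, ρ (n + 1) = (1 - θ n * γ (n + 1)) * ρ n + γ (n + 1) * b n) :
    Tendsto ρ atTop (𝓝 (B / t)) := by
  have hδ : Tendsto (fun n => b n - θ n * (B / t)) atTop (𝓝 0) := by
    have := hb.sub (hθ.mul_const (B / t))
    rwa [mul_div_cancel₀ _ ht.ne', sub_self] at this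
  have h0' : Tendsto (fun n => θ n * γ (n + 1)) atTop (𝓝 0) := by
    simpa using hθ.mul ((tendsto_add_atTop_iff_nat 1).2 h0)
  rw [Metric.tendsto_atTop']
  intro ε hε
  -- Only the excess of the distance over ε/2 is contracted: at rate t/2 it absorbs any forcing
  -- below (t/2)(ε/2).
  have hw : Tendsto (fun n => max (|ρ n - B / t| - ε / 2) 0) atTop (𝓝 0) := by
    refine tendsto_zero_of_le_mul (s := t / 2) (γ := γ) (by linarith) hsum
      (fun n => le_max_right _ _) ?_
    filter_upwards [hrec, hθ.eventually_const_lt (show t / 2 < t by linarith),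
      h0'.eventually_lt_const (show (0 : ℝ) < 1 by norm_num),
      (tendsto_order.1 (hδ.abs)).2 (t / 2 * (ε / 2)) (by rw [abs_zero]; positivity)]
      with n h1 h2 h3 h4
    have hg := hpos n
    have h5 : ρ (n + 1) - B / t =
        (1 - θ n * γ (n + 1)) * (ρ n - B / t) + γ (n + 1) * (b n - θ n * (B / t)) := by
      rw [h1]; ring
    have h6 : |ρ (n + 1) - B / t| ≤
        (1 - t / 2 * γ (n + 1)) * |ρ n - B / t| + γ (n + 1) * (t / 2 * (ε / 2)) := by
      rw [h5]
      refine (abs_add_le _ _).trans (add_le_add ?_ ?_)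
      · rw [abs_mul, abs_of_pos (by linarith)]
        gcongr
      · rw [abs_mul, abs_of_pos hg]
        gcongr
    have h7 : 0 ≤ 1 - t / 2 * γ (n + 1) := by
      have : t / 2 * γ (n + 1) ≤ θ n * γ (n + 1) := by gcongr
      linarith
    refine max_le ?_ (mul_nonneg h7 (le_max_right _ _))
    calc |ρ (n + 1) - B / t| - ε / 2 ≤ (1 - t / 2 * γ (n + 1)) * (|ρ n - B / t| - ε / 2) := by
          nlinarith
      _ ≤ _ := mul_le_mul_of_nonneg_left (le_max_left _ _) h7
  obtain ⟨N, hN⟩ := eventually_atTop.1 ((tendsto_order.1 hw).2 (ε / 2) (by linarith))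
  refine ⟨N, fun n hn => ?_⟩
  have := (le_max_left _ _).trans_lt (hN n hn.le)
  rw [Real.dist_eq]
  linarith

/-- The derivative of y ↦ y^j at 1 is j. Using `dslope` avoids a division by `x n - 1`, which may
vanish. -/
lemma tendsto_rpow_sub_one_div {ι : Type*} {l : Filter ι} {x g : ι → ℝ} {c : ℝ} (j : ℝ)
    (hx : Tendsto x l (𝓝 1)) (h : Tendsto (fun n => (x n - 1) / g n) l (𝓝 c)) :
    Tendsto (fun n => (x n ^ j - 1) / g n) l (𝓝 (j * c)) := by
  have hd : HasDerivAt (fun y : ℝ => y ^ j) j 1 := by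
    simpa using Real.hasDerivAt_rpow_const (x := 1) (p := j) (Or.inl one_ne_zero)
  have hc : Tendsto (fun n => dslope (fun y : ℝ => y ^ j) 1 (x n)) l (𝓝 j) := by
    have := (continuousAt_dslope_same.2 hd.differentiableAt).tendsto.comp hx
    rwa [dslope_same, hd.deriv] at this
  refine (hc.mul h).congr fun n => ?_
  have := sub_smul_dslope (fun y : ℝ => y ^ j) 1 (x n)
  simp only [smul_eq_mul, Real.one_rpow] at this
  rw [← this]; ring

namespace StepSize

variable {γ : ℕ → ℝ} {κ : ℝ}

lemma tendsto_succ (hγ : StepSize γ κ) : Tendsto (fun n => γ (n + 1)) atTop (𝓝 0) :=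
  (tendsto_add_atTop_iff_nat 1).2 hγ.tendsto_zero

lemma tendsto_ratio (hγ : StepSize γ κ) : Tendsto (fun n => γ n / γ (n + 1)) atTop (𝓝 1) := by
  have := (hγ.ratio.mul hγ.tendsto_succ).add_const 1
  simp only [mul_zero, zero_add] at this
  refine this.congr fun n => ?_
  field_simp [(hγ.pos n).ne']
  ring

/-- First order expansion of the contraction factor once the recursion is divided by `γ ^ q`: the
multiplier contributes j·a and the change of normalisation takes away q·κ. -/
lemma tendsto_coef (hγ : StepSize γ κ) (a j q : ℝ) :
    Tendsto (fun n => (1 - |1 - a * γ (n + 1)| ^ j * (γ n / γ (n + 1)) ^ q) / γ (n + 1)) atTop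
      (𝓝 (j * a - q * κ)) := by
  have h1 : Tendsto (fun n => |1 - a * γ (n + 1)|) atTop (𝓝 1) := by
    simpa using ((hγ.tendsto_succ.const_mul a).const_sub 1).abs
  have h2 : Tendsto (fun n => (|1 - a * γ (n + 1)| - 1) / γ (n + 1)) atTop (𝓝 (-a)) := by
    refine tendsto_const_nhds.congr' ?_
    have h3 : Tendsto (fun n => 1 - a * γ (n + 1)) atTop (𝓝 1) := by
      simpa using (hγ.tendsto_succ.const_mul a).const_sub 1
    filter_upwards [h3.eventually_const_lt (show (0 : ℝ) < 1 by norm_num)] with n hn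
    rw [abs_of_pos hn]
    field_simp [(hγ.pos n).ne']
    ring
  have h3 := tendsto_rpow_sub_one_div j h1 h2
  have h4 := tendsto_rpow_sub_one_div q hγ.tendsto_ratio hγ.ratio
  have h5 : Tendsto (fun n => (γ n / γ (n + 1)) ^ q) atTop (𝓝 1) := by
    simpa using hγ.tendsto_ratio.rpow_const (p := q) (Or.inl one_ne_zero)
  have h6 := ((h3.mul h5).add h4).neg
  rw [show -(j * -a * 1 + q * κ) = j * a - q * κ by ring] at h6
  refine h6.congr fun n => ?_
  field_simp [(hγ.pos n).ne']
  ring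

/-- Chung's lemma for the normalized solution of a linear recursion. -/
lemma tendsto_div_rpow (hγ : StepSize γ κ) {u b : ℕ → ℝ} {a j q B : ℝ} (hpos : 0 < j * a - q * κ)
    (hb : Tendsto b atTop (𝓝 B))
    (hrec : ∀ᶠ n in atTop,
      u (n + 1) = |1 - a * γ (n + 1)| ^ j * u n + γ (n + 1) * (γ (n + 1) ^ q * b n)) :
    Tendsto (fun n => u n / γ n ^ q) atTop (𝓝 (B / (j * a - q * κ))) := by
  refine tendsto_of_contraction hγ.pos hγ.tendsto_zero hγ.tendsto_sum (hγ.tendsto_coef a j q) hpos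
    hb ?_
  filter_upwards [hrec, eventually_ge_atTop 1] with n hn hn1
  obtain ⟨m, rfl⟩ : ∃ m, n = m + 1 := ⟨n - 1, by omega⟩
  have g0 := hγ.pos m
  have g1 := hγ.pos (m + 1)
  rw [hn, Real.div_rpow g0.le g1.le]
  have p0 : γ (m + 1) ^ q ≠ 0 := (Real.rpow_pos_of_pos g0 q).ne'
  have p1 : γ (m + 1 + 1) ^ q ≠ 0 := (Real.rpow_pos_of_pos g1 q).ne'
  have p2 := g1.ne'
  field_simp
  ring

/-- A bound for all the solutions of a recursive inequality, started at time `N` below `U`. -/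
lemma exists_bound (hγ : StepSize γ κ) {b : ℕ → ℝ} {a j q B : ℝ} (hpos : 0 < j * a - q * κ)
    (hb : Tendsto b atTop (𝓝 B)) (N : ℕ) (U : ℝ) :
    ∃ x : ℕ → ℝ, Tendsto (fun n => x n / γ n ^ q) atTop (𝓝 (B / (j * a - q * κ))) ∧
      ∀ u : ℕ → ℝ, u N ≤ U → (∀ n, N ≤ n →
        u (n + 1) ≤ |1 - a * γ (n + 1)| ^ j * u n + γ (n + 1) * (γ (n + 1) ^ q * b n)) →
      ∀ n, N ≤ n → u n ≤ x n := by
  -- The extremal solution: frozen at `U` up to time `N`, then satisfying the recursion with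
  -- equality. It depends on none of the sequences `u`, so the bound is uniform.
  let x : ℕ → ℝ := fun n => Nat.rec U (fun n y => if n < N then U else
    |1 - a * γ (n + 1)| ^ j * y + γ (n + 1) * (γ (n + 1) ^ q * b n)) n
  have hx1 : ∀ n, N ≤ n →
      x (n + 1) = |1 - a * γ (n + 1)| ^ j * x n + γ (n + 1) * (γ (n + 1) ^ q * b n) := by
    intro n hn
    change (if n < N then U else _) = _
    rw [if_neg (by omega)]
  have hx0 : x N = U := by
    cases N with
    | zero => rfl
    | succ n =>
      change (if n < n + 1 then U else _) = _
      rw [if_pos (by omega)]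
  refine ⟨x, hγ.tendsto_div_rpow hpos hb (eventually_atTop.2 ⟨N, hx1⟩), fun u hu hrec n hn => ?_⟩
  induction n, hn using Nat.le_induction with
  | base => rw [hx0]; exact hu
  | succ n hn ih =>
    rw [hx1 n hn]
    refine (hrec n hn).trans ?_
    gcongr

end StepSize

/-! ### Weights of the linear recursion -/

/-- The weights of the innovations in the solution of
`L (n+1) = (1 - a γ (n+1)) L n + γ (n+1) e n`. -/
def weight (γ : ℕ → ℝ) (a : ℝ) : ℕ → ℕ → ℝ
  | 0, _ => 0
  | n + 1, k => if k = n then γ (n + 1) else (1 - a * γ (n + 1)) * weight γ a n k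

/-- The summand is arbitrary so that powers of the weights, their plain sum and `linPart` are all
covered. -/
lemma sum_weight_succ (γ : ℕ → ℝ) (a : ℝ) (n : ℕ) (F : ℕ → ℝ → ℝ) :
    ∑ k ∈ Finset.range (n + 1), F k (weight γ a (n + 1) k) =
      ∑ k ∈ Finset.range n, F k ((1 - a * γ (n + 1)) * weight γ a n k) + F n (γ (n + 1)) := by
  rw [Finset.sum_range_succ]
  congr 1
  · refine Finset.sum_congr rfl fun k hk => ?_
    have : k ≠ n := (Finset.mem_range.1 hk).ne
    simp [weight, this]
  · simp [weight]

namespace StepSize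

variable {γ : ℕ → ℝ} {κ : ℝ}

/-- The sum of the `|weight|^j` solves Chung's recursion with new term γ^j = γ · γ^q · γ^(j-1-q).
The pair j = 2, q = 1 gives the variance; j = p > 2, q = p/2 has B = 0 and gives the Lyapunov
condition. -/
lemma tendsto_sum_weight_rpow (hγ : StepSize γ κ) {a j q B : ℝ} (hpos : 0 < j * a - q * κ)
    (hB : Tendsto (fun n => γ (n + 1) ^ (j - 1 - q)) atTop (𝓝 B)) :
    Tendsto (fun n => (∑ k ∈ Finset.range n, |weight γ a n k| ^ j) / γ n ^ q) atTop
      (𝓝 (B / (j * a - q * κ))) := by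
  refine hγ.tendsto_div_rpow hpos hB (Eventually.of_forall fun n => ?_)
  have g := hγ.pos n
  rw [sum_weight_succ γ a n (fun _ c => |c| ^ j), Finset.mul_sum]
  congr 1
  · refine Finset.sum_congr rfl fun k _ => ?_
    rw [abs_mul, Real.mul_rpow (abs_nonneg _) (abs_nonneg _)]
  · rw [abs_of_pos g, ← Real.rpow_add g, show q + (j - 1 - q) = j - 1 by ring,
      Real.rpow_sub_one g.ne', mul_div_cancel₀ _ g.ne']

lemma tendsto_sum_weight_sq (hγ : StepSize γ κ) {a : ℝ} (hpos : 0 < 2 * a - κ) :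
    Tendsto (fun n => (∑ k ∈ Finset.range n, weight γ a n k ^ 2) / γ n) atTop
      (𝓝 (1 / (2 * a - κ))) := by
  have := hγ.tendsto_sum_weight_rpow (a := a) (j := 2) (q := 1) (B := 1) (by linarith)
    (by norm_num)
  simpa using this

/-- Chung's lemma with j = 1, q = 0; the plain sum enters the covariance between the two components.
The multiplier equals its absolute value only eventually, which suffices. -/
lemma tendsto_sum_weight (hγ : StepSize γ κ) {a : ℝ} (hpos : 0 < a) :
    Tendsto (fun n => ∑ k ∈ Finset.range n, weight γ a n k) atTop (𝓝 (1 / a)) := by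
  have := hγ.tendsto_div_rpow (u := fun n => ∑ k ∈ Finset.range n, weight γ a n k)
    (b := fun _ => 1) (a := a) (j := 1) (q := 0) (B := 1) (by linarith) tendsto_const_nhds ?_
  · simpa using this
  · have h3 : Tendsto (fun n => 1 - a * γ (n + 1)) atTop (𝓝 1) := by
      simpa using (hγ.tendsto_succ.const_mul a).const_sub 1
    filter_upwards [h3.eventually_const_lt (show (0 : ℝ) < 1 by norm_num)] with n hn
    rw [sum_weight_succ γ a n (fun _ c => c), abs_of_pos hn, Finset.mul_sum]
    simp

end StepSize

/-- The normalised sum is itself a contraction with step sizes 1/n: √(n/(n+1)) = 1 - (1/2 +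
o(1))/(n+1), and the forcing is √(n+1)·γ_n. -/
lemma tendsto_sum_div_sqrt {γ : ℕ → ℝ} (h : Tendsto (fun n : ℕ => √(n + 1 : ℝ) * γ n) atTop (𝓝 0)) :
    Tendsto (fun n : ℕ => (∑ k ∈ Finset.range n, γ k) / √n) atTop (𝓝 0) := by
  have hx : Tendsto (fun n : ℕ => (n : ℝ) / (n + 1)) atTop (𝓝 1) :=
    tendsto_natCast_div_add_atTop 1
  have hθ : Tendsto (fun n : ℕ => (((n : ℝ) / (n + 1)) ^ (1 / 2 : ℝ) - 1) / (1 / ((n : ℝ) + 1)))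
      atTop (𝓝 (1 / 2 * (-1))) := by
    refine tendsto_rpow_sub_one_div _ hx (tendsto_const_nhds.congr fun n => ?_)
    have : (n : ℝ) + 1 ≠ 0 := by positivity
    field_simp
    ring
  have := tendsto_of_contraction (γ := fun n : ℕ => 1 / (n : ℝ)) (t := 1 / 2) (B := 0)
    (ρ := fun n : ℕ => (∑ k ∈ Finset.range n, γ k) / √n) (θ := fun n : ℕ =>
      -((((n : ℝ) / (n + 1)) ^ (1 / 2 : ℝ) - 1) / (1 / ((n : ℝ) + 1))))
    (b := fun n : ℕ => √(n + 1 : ℝ) * γ n) ?_ tendsto_one_div_atTop_nhds_zero_nat ?_ ?_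
    (by norm_num) h ?_
  · simpa using this
  · intro n; positivity
  · simpa using Real.tendsto_sum_range_one_div_nat_succ_atTop
  · simpa using hθ.neg
  · filter_upwards [eventually_ge_atTop 1] with n hn
    have hn' : (0 : ℝ) < n := by exact_mod_cast hn
    have h1 : √(n : ℝ) ≠ 0 := by positivity
    have h2 : √(n + 1 : ℝ) ≠ 0 := by positivity
    have h3 : √(n + 1 : ℝ) ^ 2 = n + 1 := Real.sq_sqrt (by positivity)
    rw [Finset.sum_range_succ, ← Real.sqrt_eq_rpow, Real.sqrt_div hn'.le]
    push_cast
    have h4 : (n : ℝ) + 1 ≠ 0 := by positivity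
    field_simp
    rw [h3]
    ring

lemma stepSize_rate {γ₁ β : ℝ} (hγ₁ : 0 < γ₁) (hβ : β ∈ Ioc (1 / 2 : ℝ) 1) :
    StepSize (rate γ₁ β) (if β = 1 then γ₁⁻¹ else 0) where
  pos n := by unfold rate; positivity
  tendsto_zero := by
    have := (tendsto_rpow_neg_atTop (show 0 < β by linarith [hβ.1])).comp
      (tendsto_natCast_atTop_atTop (R := ℝ))
    rw [← mul_zero γ₁]
    exact this.const_mul γ₁
  tendsto_sum := by
    have h1 : ¬ Summable fun n : ℕ => rate γ₁ β n := by
      unfold rate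
      rw [summable_mul_left_iff hγ₁.ne', Real.summable_nat_rpow]
      linarith [hβ.2]
    rw [← summable_nat_add_iff 1] at h1
    exact (not_summable_iff_tendsto_nat_atTop_of_nonneg
      (fun n => by unfold rate; positivity)).1 h1
  summable_sq := by
    refine (summable_nat_add_iff (f := fun n => rate γ₁ β n ^ 2) 1).2 ?_
    unfold rate
    simp_rw [mul_pow]
    refine Summable.mul_left _ ?_
    have : ∀ n : ℕ, ((n : ℝ) ^ (-β)) ^ 2 = (n : ℝ) ^ (-(2 * β)) := fun n => by
      rw [← Real.rpow_natCast, ← Real.rpow_mul (by positivity)]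
      congr 1; push_cast; ring
    simp_rw [this]
    rw [Real.summable_nat_rpow]
    linarith [hβ.1]
  ratio := by
    have hx : Tendsto (fun n : ℕ => ((n : ℝ) + 1) / n) atTop (𝓝 1) := by
      simpa using (tendsto_natCast_div_add_atTop (1 : ℝ)).inv₀ one_ne_zero
    have h1 : Tendsto (fun n : ℕ => ((((n : ℝ) + 1) / n) ^ β - 1) / (1 / (n : ℝ))) atTop
        (𝓝 (β * 1)) := by
      refine tendsto_rpow_sub_one_div _ hx (tendsto_const_nhds.congr' ?_)
      filter_upwards [eventually_ge_atTop 1] with n hn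
      have hn' : (n : ℝ) ≠ 0 := by positivity
      field_simp
      ring
    -- Second factor of the ratio: (n+1)^β/γ₁ divided by n. Only for β = 1 does it keep a nonzero
    -- limit.
    have h2 : Tendsto (fun n : ℕ => γ₁⁻¹ * ((((n : ℝ) + 1) / n) ^ β * (n : ℝ) ^ (β - 1))) atTop
        (𝓝 (if β = 1 then γ₁⁻¹ else 0)) := by
      have h3 : Tendsto (fun n : ℕ => (((n : ℝ) + 1) / n) ^ β) atTop (𝓝 1) := by
        simpa using hx.rpow_const (p := β) (Or.inl one_ne_zero)
      split_ifs with hb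
      · subst hb
        simpa using h3.const_mul γ₁⁻¹
      · have hb' : β < 1 := lt_of_le_of_ne hβ.2 hb
        have := (tendsto_rpow_neg_atTop (show 0 < 1 - β by linarith)).comp
          (tendsto_natCast_atTop_atTop (R := ℝ))
        simpa [Function.comp_def] using (h3.mul this).const_mul γ₁⁻¹
    have h4 := h1.mul h2
    rw [show β * 1 * (if β = 1 then γ₁⁻¹ else 0) = if β = 1 then γ₁⁻¹ else 0 by
      split_ifs with h <;> simp [h]] at h4
    refine h4.congr' ?_
    filter_upwards [eventually_ge_atTop 1] with n hn
    have hn' : (0 : ℝ) < n := by exact_mod_cast hn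
    have hn1 : (0 : ℝ) < (n : ℝ) + 1 := by positivity
    unfold rate
    push_cast
    rw [Real.div_rpow hn1.le hn'.le, Real.rpow_neg hn'.le, Real.rpow_neg hn1.le,
      Real.rpow_sub_one hn'.ne']
    have := (Real.rpow_pos_of_pos hn' β).ne'
    have := (Real.rpow_pos_of_pos hn1 β).ne'
    field_simp


/-! ### A law with a positive continuous density -/

/-- `f` is a positive, bounded and Lipschitz density of the law `ν`, which has a finite mean. -/
structure PdfLaw (ν : Measure ℝ) (f : ℝ → ℝ) (M : ℝ≥0) : Prop where
  prob : IsProbabilityMeasure ν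
  eq : ν = (volume : Measure ℝ).withDensity fun x => ENNReal.ofReal (f x)
  pos : ∀ x, 0 < f x
  le : ∀ x, f x ≤ M
  lip : LipschitzWith M f
  integrable_id : Integrable (fun x : ℝ => x) ν

/-- The mean excess `E[(X - ξ)⁺]`. -/
noncomputable def meanExcess (ν : Measure ℝ) (ξ : ℝ) : ℝ := ∫ x, max (x - ξ) 0 ∂ν

/-- Layer-cake formula, then translation by `ξ`. -/
lemma lintegral_excess (ν : Measure ℝ) (ξ : ℝ) :
    ∫⁻ x, ENNReal.ofReal (max (x - ξ) 0) ∂ν = ∫⁻ t in Ioi ξ, ν (Ioi t) := by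
  rw [lintegral_eq_lintegral_meas_lt ν (f := fun x => max (x - ξ) 0)
    (Eventually.of_forall fun x => le_max_right _ _) (by fun_prop)]
  have h := (measurePreserving_add_right (volume : Measure ℝ) ξ).setLIntegral_comp_preimage_emb
    (measurableEmbedding_addRight ξ) (fun t => ν (Ioi t)) (Ioi ξ)
  rw [← h]
  have h2 : (fun x => x + ξ) ⁻¹' Ioi ξ = Ioi 0 := by ext x; simp
  rw [h2]
  refine setLIntegral_congr_fun measurableSet_Ioi fun t ht => ?_
  congr 1
  ext x
  simp only [mem_ofPred_eq, mem_Ioi, lt_max_iff] at ht ⊢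
  constructor
  · rintro (h | h) <;> linarith
  · intro h; left; linarith

lemma integrable_excess {ν : Measure ℝ} [IsFiniteMeasure ν] (h : Integrable (fun x : ℝ => x) ν)
    (ξ : ℝ) : Integrable (fun x => max (x - ξ) 0) ν :=
  (h.sub (integrable_const ξ)).pos_part

lemma integrableOn_tail {ν : Measure ℝ} [IsFiniteMeasure ν] (h : Integrable (fun x : ℝ => x) ν)
    (ξ : ℝ) : IntegrableOn (fun t => ν.real (Ioi t)) (Ioi ξ) := by
  have hm : AEMeasurable (fun t => ν (Ioi t)) (volume.restrict (Ioi ξ)) :=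
    (show Antitone fun t => ν (Ioi t) from
      fun a b hab => measure_mono (Ioi_subset_Ioi hab)).measurable.aemeasurable
  refine integrable_toReal_of_lintegral_ne_top hm ?_
  rw [← lintegral_excess]
  exact (integrable_excess h ξ).lintegral_lt_top.ne

lemma abs_intervalIntegral_le {g : ℝ → ℝ} {a b C : ℝ} (h : ∀ x ∈ uIoc a b, |g x| ≤ C) :
    |∫ x in a..b, g x| ≤ C * |b - a| :=
  intervalIntegral.norm_integral_le_of_norm_le_const (f := g) h

/-- This form exposes the derivative of the mean excess and lets an expansion of the cdf be
integrated over the half line. -/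
lemma meanExcess_eq (ν : Measure ℝ) [IsFiniteMeasure ν] (ξ : ℝ) :
    meanExcess ν ξ = ∫ t in Ioi ξ, ν.real (Ioi t) := by
  have hm : AEMeasurable (fun t => ν (Ioi t)) (volume.restrict (Ioi ξ)) :=
    (show Antitone fun t => ν (Ioi t) from
      fun a b hab => measure_mono (Ioi_subset_Ioi hab)).measurable.aemeasurable
  unfold meanExcess
  rw [integral_eq_lintegral_of_nonneg_ae (f := fun x => max (x - ξ) 0)
    (Eventually.of_forall fun x => le_max_right _ _)
    (by fun_prop), lintegral_excess]
  exact (integral_toReal hm (Eventually.of_forall fun t => measure_lt_top _ _)).symm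

namespace PdfLaw

variable {ν : Measure ℝ} {f : ℝ → ℝ} {M : ℝ≥0} {α : ℝ}

lemma setIntegral_eq (h : PdfLaw ν f M) (g : ℝ → ℝ) {s : Set ℝ} (hs : MeasurableSet s) :
    ∫ x in s, g x ∂ν = ∫ x in s, f x * g x := by
  rw [h.eq, setIntegral_withDensity_eq_setIntegral_toReal_smul]
  · refine integral_congr_ae (Eventually.of_forall fun x => ?_)
    simp [ENNReal.toReal_ofReal (h.pos x).le]
  · exact (h.lip.continuous.measurable).ennreal_ofReal
  · exact Eventually.of_forall fun x => ENNReal.ofReal_lt_top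
  · exact hs

lemma integrable_pdf (h : PdfLaw ν f M) : Integrable f := by
  have := h.prob
  have h1 : Integrable (fun _ : ℝ => (1 : ℝ)) ν := integrable_const 1
  rw [h.eq, integrable_withDensity_iff_integrable_smul'
    (h.lip.continuous.measurable).ennreal_ofReal
    (Eventually.of_forall fun x => ENNReal.ofReal_lt_top)] at h1
  refine h1.congr (Eventually.of_forall fun x => ?_)
  simp [ENNReal.toReal_ofReal (h.pos x).le]

lemma real_eq (h : PdfLaw ν f M) {s : Set ℝ} (hs : MeasurableSet s) :
    ν.real s = ∫ x in s, f x := by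
  have := h.prob
  have := h.setIntegral_eq (fun _ => 1) hs
  simpa using this

lemma cdf_sub (h : PdfLaw ν f M) (a b : ℝ) :
    ν.real (Iic b) - ν.real (Iic a) = ∫ x in a..b, f x := by
  rw [h.real_eq measurableSet_Iic, h.real_eq measurableSet_Iic]
  exact intervalIntegral.integral_Iic_sub_Iic h.integrable_pdf.integrableOn
    h.integrable_pdf.integrableOn

lemma hasDerivAt_cdf (h : PdfLaw ν f M) (x : ℝ) :
    HasDerivAt (fun t => ν.real (Iic t)) (f x) x := by
  have h1 : (fun t => ν.real (Iic t)) = fun t => ν.real (Iic x) + ∫ s in x..t, f s := by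
    ext t; rw [← h.cdf_sub]; ring
  rw [h1]
  exact (intervalIntegral.integral_hasDerivAt_right (by simp)
    (h.lip.continuous.stronglyMeasurableAtFilter _ _) h.lip.continuous.continuousAt).const_add _

lemma continuous_cdf (h : PdfLaw ν f M) : Continuous fun t => ν.real (Iic t) :=
  continuous_iff_continuousAt.2 fun x => (h.hasDerivAt_cdf x).continuousAt

lemma strictMono_cdf (h : PdfLaw ν f M) : StrictMono fun t => ν.real (Iic t) :=
  strictMono_of_hasDerivAt_pos h.hasDerivAt_cdf h.pos

lemma real_Ioi (h : PdfLaw ν f M) (x : ℝ) : ν.real (Ioi x) = 1 - ν.real (Iic x) := by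
  have := h.prob
  rw [← compl_Iic, probReal_compl_eq_one_sub measurableSet_Iic]

lemma tendsto_cdf_atBot (h : PdfLaw ν f M) : Tendsto (fun t => ν.real (Iic t)) atBot (𝓝 0) := by
  have := h.prob
  exact (ProbabilityTheory.tendsto_cdf_atBot ν).congr fun x => cdf_eq_real ν x

lemma tendsto_cdf_atTop (h : PdfLaw ν f M) : Tendsto (fun t => ν.real (Iic t)) atTop (𝓝 1) := by
  have := h.prob
  exact (ProbabilityTheory.tendsto_cdf_atTop ν).congr fun x => cdf_eq_real ν x

lemma cdf_pos (h : PdfLaw ν f M) (x : ℝ) : 0 < ν.real (Iic x) :=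
  lt_of_le_of_lt measureReal_nonneg (h.strictMono_cdf (show x - 1 < x by linarith))

lemma cdf_lt_one (h : PdfLaw ν f M) (x : ℝ) : ν.real (Iic x) < 1 := by
  have := h.prob
  exact (h.strictMono_cdf (show x < x + 1 by linarith)).trans_le measureReal_le_one

lemma exists_cdf_eq (h : PdfLaw ν f M) (hα : α ∈ Ioo (0 : ℝ) 1) : ∃ x, ν.real (Iic x) = α := by
  obtain ⟨a, ha⟩ := (h.tendsto_cdf_atBot.eventually_lt_const hα.1).exists
  obtain ⟨b, hb⟩ := (h.tendsto_cdf_atTop.eventually_const_lt hα.2).exists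
  exact mem_range_of_exists_le_of_exists_ge h.continuous_cdf ⟨a, ha.le⟩ ⟨b, hb.le⟩

lemma valueAtRisk_cdf (h : PdfLaw ν f M) (x : ℝ) : valueAtRisk (ν.real (Iic x)) ν = x := by
  unfold valueAtRisk
  have : {ξ : ℝ | ν.real (Iic x) ≤ ν.real (Iic ξ)} = Ici x := by
    ext y; exact h.strictMono_cdf.le_iff_le
  rw [this, csInf_Ici]

lemma cdf_valueAtRisk (h : PdfLaw ν f M) (hα : α ∈ Ioo (0 : ℝ) 1) :
    ν.real (Iic (valueAtRisk α ν)) = α := by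
  obtain ⟨x, rfl⟩ := h.exists_cdf_eq hα
  rw [h.valueAtRisk_cdf]

lemma meanExcess_sub (h : PdfLaw ν f M) (a b : ℝ) :
    meanExcess ν a - meanExcess ν b = ∫ t in a..b, (1 - ν.real (Iic t)) := by
  have := h.prob
  rw [meanExcess_eq, meanExcess_eq]
  simp_rw [← h.real_Ioi]
  exact intervalIntegral.integral_Ioi_sub_Ioi' (integrableOn_tail h.integrable_id a)
    (integrableOn_tail h.integrable_id b)

lemma hasDerivAt_meanExcess (h : PdfLaw ν f M) (x : ℝ) :
    HasDerivAt (meanExcess ν) (-(1 - ν.real (Iic x))) x := by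
  have h1 : meanExcess ν = fun t => meanExcess ν x - ∫ s in x..t, (1 - ν.real (Iic s)) := by
    ext t; rw [← h.meanExcess_sub]; ring
  rw [h1]
  have hc : Continuous fun s => 1 - ν.real (Iic s) := continuous_const.sub h.continuous_cdf
  exact (intervalIntegral.integral_hasDerivAt_right (by simp)
    (hc.stronglyMeasurableAtFilter _ _) hc.continuousAt).const_sub _

lemma objective_eq (α : ℝ) (ν : Measure ℝ) (ξ : ℝ) :
    objective α ν ξ = ξ + (1 - α)⁻¹ * meanExcess ν ξ := rfl

lemma hasDerivAt_objective (h : PdfLaw ν f M) (hα : α ∈ Ioo (0 : ℝ) 1) (x : ℝ) :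
    HasDerivAt (objective α ν) ((1 - α)⁻¹ * (ν.real (Iic x) - α)) x := by
  have h1 := (hasDerivAt_id x).add ((h.hasDerivAt_meanExcess x).const_mul (1 - α)⁻¹)
  have h2 : 1 - α ≠ 0 := by linarith [hα.2]
  have h3 : (1 - α)⁻¹ * (ν.real (Iic x) - α) = 1 + (1 - α)⁻¹ * -(1 - ν.real (Iic x)) := by
    field_simp
    ring
  rw [h3]
  exact h1

lemma deriv_deriv_objective (h : PdfLaw ν f M) (hα : α ∈ Ioo (0 : ℝ) 1) :
    deriv (deriv (objective α ν)) = fun x => (1 - α)⁻¹ * f x := by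
  have h1 : deriv (objective α ν) = fun x => (1 - α)⁻¹ * (ν.real (Iic x) - α) :=
    funext fun x => (h.hasDerivAt_objective hα x).deriv
  rw [h1]
  exact funext fun x => (((h.hasDerivAt_cdf x).sub_const α).const_mul _).deriv

/-- The Taylor remainder of the objective at the value-at-risk. -/
lemma objective_sub (h : PdfLaw ν f M) (hα : α ∈ Ioo (0 : ℝ) 1) (a b : ℝ) :
    objective α ν b - objective α ν a = ∫ x in a..b, (1 - α)⁻¹ * (ν.real (Iic x) - α) := by
  refine (intervalIntegral.integral_eq_sub_of_hasDerivAt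
    (fun x _ => h.hasDerivAt_objective hα x) ?_).symm
  exact (continuous_const.mul (h.continuous_cdf.sub continuous_const)).intervalIntegrable _ _

lemma abs_cdf_sub_le (h : PdfLaw ν f M) (a b : ℝ) :
    |ν.real (Iic b) - ν.real (Iic a)| ≤ M * |b - a| := by
  rw [h.cdf_sub]
  exact abs_intervalIntegral_le fun x _ => by rw [abs_of_pos (h.pos x)]; exact h.le x

lemma abs_cdf_sub_sub_le (h : PdfLaw ν f M) (a b : ℝ) :
    |ν.real (Iic b) - ν.real (Iic a) - f a * (b - a)| ≤ M * (b - a) ^ 2 := by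
  have h1 : ν.real (Iic b) - ν.real (Iic a) - f a * (b - a) = ∫ x in a..b, (f x - f a) := by
    rw [h.cdf_sub, intervalIntegral.integral_sub (h.lip.continuous.intervalIntegrable _ _) (by simp)]
    simp [mul_comm]
  rw [h1, ← sq_abs (b - a), sq, ← mul_assoc]
  refine abs_intervalIntegral_le fun x hx => ?_
  have := h.lip.dist_le_mul x a
  rw [Real.dist_eq, Real.dist_eq] at this
  refine this.trans ?_
  gcongr ?_ * ?_
  exact abs_sub_left_of_mem_uIcc (uIoc_subset_uIcc hx)

/-- The derivative of the objective vanishes at the quantile and is (1-α)⁻¹M-Lipschitz. This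
flatness makes errors on the quantile second order for the expected shortfall. -/
lemma objective_bound (h : PdfLaw ν f M) (hα : α ∈ Ioo (0 : ℝ) 1) {θ : ℝ}
    (hθ : ν.real (Iic θ) = α) (x : ℝ) :
    |objective α ν x - objective α ν θ| ≤ (1 - α)⁻¹ * M * (x - θ) ^ 2 := by
  have h0 : 0 < (1 - α)⁻¹ := by have := hα.2; simp; linarith
  rw [h.objective_sub hα, ← sq_abs (x - θ), sq, ← mul_assoc]
  refine abs_intervalIntegral_le fun y hy => ?_
  rw [abs_mul, abs_of_pos h0, mul_assoc]
  gcongr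
  rw [← hθ]
  refine (h.abs_cdf_sub_le _ _).trans ?_
  exact mul_le_mul_of_nonneg_left (abs_sub_left_of_mem_uIcc (uIoc_subset_uIcc hy)) M.2

/-- The derivative (1-α)⁻¹(F - α) is strictly increasing with its zero at the quantile. Assumptions
quantified over all minimizers thus concern a single point. -/
lemma isMinOn_iff (h : PdfLaw ν f M) (hα : α ∈ Ioo (0 : ℝ) 1) (x : ℝ) :
    IsMinOn (objective α ν) univ x ↔ x = valueAtRisk α ν := by
  have h0 : 0 < (1 - α)⁻¹ := by have := hα.2; simp; linarith
  constructor
  · intro hx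
    have h1 := (hx.isLocalMin univ_mem).hasDerivAt_eq_zero (h.hasDerivAt_objective hα x)
    have h2 : ν.real (Iic x) = α := by
      rcases mul_eq_zero.1 h1 with h1 | h1 <;> linarith
    rw [← h2, h.valueAtRisk_cdf]
  · rintro rfl y -
    set θ := valueAtRisk α ν
    have hθ : ν.real (Iic θ) = α := h.cdf_valueAtRisk hα
    suffices 0 ≤ objective α ν y - objective α ν θ by
      change objective α ν θ ≤ objective α ν y; linarith
    rw [h.objective_sub hα]
    rcases le_total θ y with hy | hy
    · refine intervalIntegral.integral_nonneg hy fun u hu => mul_nonneg h0.le ?_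
      have := h.strictMono_cdf.monotone hu.1
      simp only [hθ] at this
      linarith
    · rw [intervalIntegral.integral_symm, ← intervalIntegral.integral_neg]
      refine intervalIntegral.integral_nonneg hy fun u hu => ?_
      have := h.strictMono_cdf.monotone hu.2
      simp only [hθ] at this
      rw [← mul_neg]
      exact mul_nonneg h0.le (by linarith)

lemma leastArgmin_objective (h : PdfLaw ν f M) (hα : α ∈ Ioo (0 : ℝ) 1) :
    leastArgmin (objective α ν) = valueAtRisk α ν := by
  unfold leastArgmin
  simp_rw [h.isMinOn_iff hα]
  simp

lemma image_cdf_Ioi (h : PdfLaw ν f M) (θ : ℝ) :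
    (fun t => ν.real (Iic t)) '' Ioi θ = Ioo (ν.real (Iic θ)) 1 := by
  ext y
  constructor
  · rintro ⟨x, hx, rfl⟩
    exact ⟨h.strictMono_cdf hx, h.cdf_lt_one x⟩
  · rintro ⟨h1, h2⟩
    obtain ⟨x, hx⟩ := h.exists_cdf_eq ⟨(h.cdf_pos θ).trans h1, h2⟩
    exact ⟨x, h.strictMono_cdf.lt_iff_lt.1 (by simpa [hx] using h1), hx⟩

/-- Rockafellar–Uryasev formula: the substitution a = F(x) turns the integral of quantiles over (α,
1) into the integral of x over (θ, ∞) against the law, and P(X > θ) = 1 - α. -/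
lemma expectedShortfall_eq (h : PdfLaw ν f M) (hα : α ∈ Ioo (0 : ℝ) 1) :
    expectedShortfall α ν = objective α ν (valueAtRisk α ν) := by
  have := h.prob
  set θ := valueAtRisk α ν with hθ
  have hF : ν.real (Iic θ) = α := h.cdf_valueAtRisk hα
  have h0 : 1 - α ≠ 0 := by linarith [hα.2]
  have h1 : ∫ a in α..1, valueAtRisk a ν = ∫ x in Ioi θ, x ∂ν := by
    rw [intervalIntegral.integral_of_le hα.2.le, integral_Ioc_eq_integral_Ioo]
    have h2 := integral_image_eq_integral_abs_deriv_smul (s := Ioi θ) measurableSet_Ioi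
      (fun x _ => (h.hasDerivAt_cdf x).hasDerivWithinAt) h.strictMono_cdf.injective.injOn
      (fun a => valueAtRisk a ν)
    rw [h.image_cdf_Ioi, hF] at h2
    rw [h2, h.setIntegral_eq _ measurableSet_Ioi]
    refine integral_congr_ae (Eventually.of_forall fun x => ?_)
    simp only [h.valueAtRisk_cdf, smul_eq_mul, abs_of_pos (h.pos x)]
  have h3 : meanExcess ν θ = ∫ x in Ioi θ, (x - θ) ∂ν := by
    unfold meanExcess
    rw [← integral_indicator measurableSet_Ioi]
    refine integral_congr_ae (Eventually.of_forall fun x => ?_)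
    by_cases hx : θ < x
    · simp [indicator, hx, hx.le]
    · simp [indicator, hx, not_lt.1 hx]
  have h4 : ν.real (Ioi θ) = 1 - α := by rw [h.real_Ioi, hF]
  rw [integral_sub h.integrable_id.integrableOn (integrable_const _).integrableOn] at h3
  simp only [setIntegral_const, smul_eq_mul, h4] at h3
  unfold expectedShortfall
  rw [h1, objective_eq, h3]
  field_simp
  ring

lemma measure_singleton (h : PdfLaw ν f M) (x : ℝ) : ν {x} = 0 := by
  rw [h.eq]
  exact withDensity_absolutelyContinuous _ _ (by simp)

lemma real_Ici (h : PdfLaw ν f M) (x : ℝ) : ν.real (Ici x) = 1 - ν.real (Iic x) := by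
  rw [← h.real_Ioi]
  have : ν (Ici x) = ν (Ioi x) := by
    refine le_antisymm ?_ (measure_mono Ioi_subset_Ici_self)
    rw [← Ioi_union_left]
    exact (measure_union_le _ _).trans (by rw [h.measure_singleton, add_zero])
  simp [Measure.real, this]

end PdfLaw

/-! ### Mean and increments of the update function -/

lemma H₁_eq_indicator (α ξ x : ℝ) :
    H₁ α ξ x = 1 - (1 - α)⁻¹ * (Ici ξ).indicator (fun _ => (1 : ℝ)) x := by
  simp [H₁, indicator]

lemma abs_H₁_le {α : ℝ} (hα : α ∈ Ioo (0 : ℝ) 1) (ξ x : ℝ) : |H₁ α ξ x| ≤ (1 - α)⁻¹ := by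
  have h1 : (1 : ℝ) ≤ (1 - α)⁻¹ := (one_le_inv₀ (by linarith [hα.2])).2 (by linarith [hα.1])
  unfold H₁
  rw [one_div, abs_le]
  split_ifs <;> constructor <;> linarith

lemma measurable_H₁ (α : ℝ) : Measurable fun p : ℝ × ℝ => H₁ α p.1 p.2 := by
  unfold H₁
  exact measurable_const.sub (measurable_const.mul
    (Measurable.ite (measurableSet_le measurable_fst measurable_snd) measurable_const
      measurable_const))

namespace PdfLaw

variable {ν : Measure ℝ} {f : ℝ → ℝ} {M : ℝ≥0} {α : ℝ}

/-- The mean field of the scheme is the derivative of the objective. -/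
lemma integral_H₁ (h : PdfLaw ν f M) (hα : α ∈ Ioo (0 : ℝ) 1) (ξ : ℝ) :
    ∫ x, H₁ α ξ x ∂ν = (1 - α)⁻¹ * (ν.real (Iic ξ) - α) := by
  have := h.prob
  have h0 : 1 - α ≠ 0 := by linarith [hα.2]
  simp_rw [H₁_eq_indicator]
  rw [integral_sub (integrable_const _)
    (((integrable_const _).indicator measurableSet_Ici).const_mul _), integral_const_mul,
    integral_indicator measurableSet_Ici]
  simp only [integral_const, probReal_univ, smul_eq_mul, mul_one,
    measureReal_restrict_apply, MeasurableSet.univ, univ_inter, h.real_Ici]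
  field_simp
  ring

/-- The two indicators differ exactly on the interval between `ξ` and `θ`, so the square is only of
first order in the distance. -/
lemma integral_H₁_sub_sq (h : PdfLaw ν f M) (α ξ θ : ℝ) :
    ∫ x, (H₁ α ξ x - H₁ α θ x) ^ 2 ∂ν ≤ (1 - α)⁻¹ ^ 2 * M * |ξ - θ| := by
  have := h.prob
  have h1 : ∀ x, (H₁ α ξ x - H₁ α θ x) ^ 2 =
      (1 - α)⁻¹ ^ 2 * (Ico (min ξ θ) (max ξ θ)).indicator (fun _ => (1 : ℝ)) x := by
    intro x
    unfold H₁
    rw [one_div]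
    by_cases h1 : ξ ≤ x <;> by_cases h2 : θ ≤ x <;>
      simp [indicator, h1, h2, not_le.1, -not_le]
  simp_rw [h1]
  rw [integral_const_mul, integral_indicator measurableSet_Ico, mul_assoc]
  gcongr
  simp only [integral_const, smul_eq_mul, mul_one,
    measureReal_restrict_apply, MeasurableSet.univ, univ_inter]
  have h3 : ν.real (Ico (min ξ θ) (max ξ θ)) = ν.real (Ici (min ξ θ)) - ν.real (Ici (max ξ θ)) := by
    rw [← Ici_sdiff_Ici, measureReal_sdiff (Ici_subset_Ici.2 (min_le_max)) measurableSet_Ici]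
  rw [h3, h.real_Ici, h.real_Ici]
  have h4 := h.abs_cdf_sub_le (min ξ θ) (max ξ θ)
  rw [max_sub_min_eq_abs, abs_abs] at h4
  have h5 := le_abs_self (ν.real (Iic (max ξ θ)) - ν.real (Iic (min ξ θ)))
  rw [abs_sub_comm θ ξ] at h4
  linarith

end PdfLaw


/-! ### A quantitative central limit theorem of Lyapunov type -/

/-- Cubic Taylor bound for |x| ≤ 1, crude bound 2 + |x| + x²/2 beyond; an exponent between 2 and 3
dominates both. -/
lemma norm_cexp_sub_taylor_le (x : ℝ) {p : ℝ} (hp : p ∈ Icc (2 : ℝ) 3) :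
    ‖Complex.exp (x * Complex.I) - (1 + x * Complex.I - (x ^ 2 / 2 : ℝ))‖ ≤ 4 * |x| ^ p := by
  rcases le_total |x| 1 with h | h
  · have h1 : ‖(x * Complex.I : ℂ)‖ ≤ 1 := by simpa using h
    have h2 := Complex.exp_bound h1 (n := 3) (by norm_num)
    have h3 : ∑ m ∈ Finset.range 3, (x * Complex.I : ℂ) ^ m / (m.factorial : ℂ) =
        1 + x * Complex.I - (x ^ 2 / 2 : ℝ) := by
      simp [Finset.sum_range_succ, mul_pow, Nat.factorial]
      ring
    rw [h3] at h2
    refine h2.trans ?_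
    have h4 : |x| ^ 3 ≤ |x| ^ p := by
      rw [← Real.rpow_natCast]
      refine Real.rpow_le_rpow_of_exponent_ge_of_imp (abs_nonneg _) h (by push_cast; exact hp.2) ?_
      intro _ h5; norm_num at h5
    have h5 : (0 : ℝ) ≤ |x| ^ p := by positivity
    have h6 : ‖(x * Complex.I : ℂ)‖ = |x| := by simp
    rw [h6]
    norm_num [Nat.factorial]
    nlinarith
  · have h4 : |x| ^ 2 ≤ |x| ^ p := by
      rw [← Real.rpow_natCast]
      exact Real.rpow_le_rpow_of_exponent_le h (by push_cast; exact hp.1)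
    have h5 : ‖Complex.exp (x * Complex.I)‖ = 1 := Complex.norm_exp_ofReal_mul_I x
    calc _ ≤ ‖Complex.exp (x * Complex.I)‖ + (‖(1 : ℂ)‖ + ‖(x * Complex.I : ℂ)‖ +
          ‖((x ^ 2 / 2 : ℝ) : ℂ)‖) := by
          refine (norm_sub_le _ _).trans ?_
          gcongr
          refine (norm_sub_le _ _).trans ?_
          gcongr
          exact norm_add_le _ _
      _ = 2 + |x| + |x| ^ 2 / 2 := by
          rw [h5, Complex.norm_real, Real.norm_of_nonneg (by positivity)]
          simp
          ring
      _ ≤ 4 * |x| ^ p := by nlinarith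

lemma abs_one_sub_sub_exp_neg_le {x r : ℝ} (hx : 0 ≤ x) (hr : r ∈ Icc (1 : ℝ) 2) :
    |1 - x - Real.exp (-x)| ≤ x ^ r := by
  rcases le_total x 1 with h | h
  · have h1 := Real.abs_exp_sub_one_sub_id_le (x := -x) (by rwa [abs_neg, abs_of_nonneg hx])
    rw [abs_sub_comm, show Real.exp (-x) - (1 - x) = Real.exp (-x) - 1 - -x by ring]
    refine h1.trans ?_
    rw [neg_sq, ← Real.rpow_natCast]
    refine Real.rpow_le_rpow_of_exponent_ge_of_imp hx h (by push_cast; exact hr.2) ?_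
    intro _ h5; norm_num at h5
  · have h1 : Real.exp (-x) ≤ 1 := Real.exp_le_one_iff.2 (by linarith)
    have h2 := Real.exp_pos (-x)
    have h3 : x ≤ x ^ r := Real.self_le_rpow_of_one_le h hr.1
    rw [abs_le]
    constructor <;> linarith

/-- Replace the factors one at a time; all the others have norm at most 1. -/
lemma norm_prod_sub_prod_le {ι : Type*} (s : Finset ι) (z w : ι → ℂ) (hz : ∀ i ∈ s, ‖z i‖ ≤ 1)
    (hw : ∀ i ∈ s, ‖w i‖ ≤ 1) : ‖∏ i ∈ s, z i - ∏ i ∈ s, w i‖ ≤ ∑ i ∈ s, ‖z i - w i‖ := by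
  classical
  induction s using Finset.induction_on with
  | empty => simp
  | insert a s ha ih =>
    rw [Finset.prod_insert ha, Finset.prod_insert ha, Finset.sum_insert ha]
    have h1 : z a * ∏ i ∈ s, z i - w a * ∏ i ∈ s, w i =
        (z a - w a) * ∏ i ∈ s, z i + w a * (∏ i ∈ s, z i - ∏ i ∈ s, w i) := by ring
    have h2 : ‖∏ i ∈ s, z i‖ ≤ 1 := by
      rw [norm_prod]
      exact Finset.prod_le_one (fun i _ => norm_nonneg _) fun i hi => hz i (Finset.mem_insert_of_mem hi)
    have h3 := ih (fun i hi => hz i (Finset.mem_insert_of_mem hi))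
      (fun i hi => hw i (Finset.mem_insert_of_mem hi))
    have h4 := hw a (Finset.mem_insert_self a s)
    rw [h1]
    refine (norm_add_le _ _).trans ?_
    rw [norm_mul, norm_mul]
    refine add_le_add (mul_le_of_le_one_right (norm_nonneg _) h2) ?_
    calc _ ≤ 1 * ‖∏ i ∈ s, z i - ∏ i ∈ s, w i‖ := by gcongr
      _ ≤ _ := by rw [one_mul]; exact h3

section

variable {Ω : Type*} [MeasurableSpace Ω] {P : Measure Ω} [IsProbabilityMeasure P]

lemma memLp_of_integrable_rpow {U : Ω → ℝ} (hU : Measurable U) {p : ℝ} (hp : 2 ≤ p)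
    (hint : Integrable (fun ω => |U ω| ^ p) P) : MemLp U 2 P := by
  have h1 : MemLp U (ENNReal.ofReal p) P := by
    refine (integrable_norm_rpow_iff hU.aestronglyMeasurable ?_ ENNReal.ofReal_ne_top).1 ?_
    · simp; linarith
    · rwa [ENNReal.toReal_ofReal (by linarith)]
  refine h1.mono_exponent ?_
  rw [show (2 : ℝ≥0∞) = ENNReal.ofReal 2 by simp]
  exact ENNReal.ofReal_le_ofReal hp

/-- Jensen's inequality. It lets the gap between 1 - σ²/2 and exp(-σ²/2) be paid for by the moment
of order p. -/
lemma rpow_integral_sq_le {U : Ω → ℝ} (hU : Measurable U) {p : ℝ} (hp : 2 ≤ p)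
    (hint : Integrable (fun ω => |U ω| ^ p) P) :
    (∫ ω, U ω ^ 2 ∂P) ^ (p / 2) ≤ ∫ ω, |U ω| ^ p ∂P := by
  have h1 : ∀ ω, (U ω ^ 2) ^ (p / 2) = |U ω| ^ p := fun ω => by
    rw [← sq_abs, ← Real.rpow_natCast, ← Real.rpow_mul (abs_nonneg _)]
    congr 1; push_cast; ring
  have h2 := (convexOn_rpow (p := p / 2) (by linarith)).map_integral_le (μ := P)
    (f := fun ω => U ω ^ 2)
    (Real.continuous_rpow_const (by linarith)).continuousOn isClosed_Ici
    (Eventually.of_forall fun ω => sq_nonneg (U ω)) (memLp_of_integrable_rpow hU hp hint).integrable_sq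
    (by simpa [Function.comp_def, h1] using hint)
  simpa [h1] using h2

/-- Pass through 1 - σ²/2: the Taylor bound costs 4 times the moment, the comparison with the
exponential costs 1. -/
lemma norm_integral_cexp_sub_le {U : Ω → ℝ} (hU : Measurable U) {p : ℝ}
    (hp : p ∈ Icc (2 : ℝ) 3) (hint : Integrable (fun ω => |U ω| ^ p) P) (h0 : ∫ ω, U ω ∂P = 0) :
    ‖∫ ω, Complex.exp (U ω * Complex.I) ∂P - (Real.exp (-((∫ ω, U ω ^ 2 ∂P) / 2)) : ℝ)‖ ≤
      5 * ∫ ω, |U ω| ^ p ∂P := by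
  have hL := memLp_of_integrable_rpow hU hp.1 hint
  have hi1 : Integrable U P := hL.integrable (by norm_num)
  have hi2 : Integrable (fun ω => U ω ^ 2) P := hL.integrable_sq
  have hie : Integrable (fun ω => Complex.exp (U ω * Complex.I)) P := by
    refine Integrable.of_bound (by fun_prop) 1 (Eventually.of_forall fun ω => ?_)
    rw [Complex.norm_exp_ofReal_mul_I]
  set x := (∫ ω, U ω ^ 2 ∂P) / 2 with hx
  have hx0 : 0 ≤ x := by have : 0 ≤ ∫ ω, U ω ^ 2 ∂P := integral_nonneg fun ω => sq_nonneg _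
                         positivity
  have hiq : Integrable (fun ω => (1 : ℂ) + U ω * Complex.I - (U ω ^ 2 / 2 : ℝ)) P :=
    ((integrable_const _).add (hi1.ofReal.mul_const _)).sub (hi2.div_const 2).ofReal
  have e1 : ∫ ω, ((1 : ℂ) + U ω * Complex.I - (U ω ^ 2 / 2 : ℝ)) ∂P = ((1 - x : ℝ) : ℂ) := by
    rw [integral_sub ((integrable_const _).add (hi1.ofReal.mul_const _)) (hi2.div_const 2).ofReal,
      integral_add (integrable_const _) (hi1.ofReal.mul_const _), integral_mul_const,
      integral_complex_ofReal, integral_complex_ofReal, h0, integral_div]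
    simp [hx]
  have e2 : ‖∫ ω, Complex.exp (U ω * Complex.I) ∂P - ((1 - x : ℝ) : ℂ)‖ ≤
      4 * ∫ ω, |U ω| ^ p ∂P := by
    rw [← e1, ← integral_sub hie hiq, ← integral_const_mul]
    exact norm_integral_le_of_norm_le (hint.const_mul 4)
      (Eventually.of_forall fun ω => norm_cexp_sub_taylor_le (U ω) hp)
  have e3 : |1 - x - Real.exp (-x)| ≤ ∫ ω, |U ω| ^ p ∂P := by
    refine (abs_one_sub_sub_exp_neg_le hx0 (r := p / 2)
      ⟨by linarith [hp.1], by linarith [hp.2]⟩).trans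
      (le_trans ?_ (rpow_integral_sq_le hU hp.1 hint))
    refine Real.rpow_le_rpow hx0 ?_ (by linarith [hp.1])
    linarith
  calc _ = ‖(∫ ω, Complex.exp (U ω * Complex.I) ∂P - ((1 - x : ℝ) : ℂ)) +
        ((1 - x - Real.exp (-x) : ℝ) : ℂ)‖ := by congr 1; push_cast; ring
    _ ≤ _ := norm_add_le _ _
    _ ≤ 4 * ∫ ω, |U ω| ^ p ∂P + ∫ ω, |U ω| ^ p ∂P := by
      refine add_le_add e2 ?_
      rw [Complex.norm_real]; exact e3
    _ = _ := by ring

/-- Gaussian approximation of the characteristic function of a sum of independent variables. -/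
lemma norm_integral_cexp_sum_sub_le {U : ℕ → Ω → ℝ} (hU : ∀ k, Measurable (U k))
    (hind : iIndepFun U P) {p : ℝ} (hp : p ∈ Icc (2 : ℝ) 3)
    (hint : ∀ k, Integrable (fun ω => |U k ω| ^ p) P) (h0 : ∀ k, ∫ ω, U k ω ∂P = 0) (n : ℕ) :
    ‖∫ ω, Complex.exp ((∑ k ∈ Finset.range n, U k ω : ℝ) * Complex.I) ∂P -
      (Real.exp (-((∑ k ∈ Finset.range n, ∫ ω, U k ω ^ 2 ∂P) / 2)) : ℝ)‖ ≤
      5 * ∑ k ∈ Finset.range n, ∫ ω, |U k ω| ^ p ∂P := by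
  have hc : ∀ V : Ω → ℝ, Measurable V →
      ∫ ω, Complex.exp (V ω * Complex.I) ∂P = charFun (P.map V) 1 := by
    intro V hV
    rw [charFun_apply_real, integral_map hV.aemeasurable (by fun_prop)]
    simp
  have h1 := congrFun ((hind.restrict (Finset.range n)).charFun_map_fun_finsetSum_eq_prod
    (fun k _ => (hU k).aemeasurable)) 1
  rw [hc _ (Finset.measurable_fun_sum _ fun k _ => hU k), h1, Finset.prod_apply,
    Finset.sum_div, ← Finset.sum_neg_distrib, Real.exp_sum]
  push_cast
  refine (norm_prod_sub_prod_le _ _ _ (fun k _ => ?_) fun k _ => ?_).trans ?_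
  · have := Measure.isProbabilityMeasure_map (μ := P) (hU k).aemeasurable
    exact norm_charFun_le_one _
  · rw [show -(((∫ ω, U k ω ^ 2 ∂P : ℝ) : ℂ) / 2) = ((-((∫ ω, U k ω ^ 2 ∂P) / 2) : ℝ) : ℂ) by
      push_cast; rfl, Complex.norm_exp_ofReal, Real.exp_le_one_iff]
    have : 0 ≤ ∫ ω, U k ω ^ 2 ∂P := integral_nonneg fun ω => sq_nonneg _
    linarith
  · rw [Finset.mul_sum]
    refine Finset.sum_le_sum fun k _ => ?_
    rw [← hc _ (hU k)]
    have := norm_integral_cexp_sub_le (hU k) hp (hint k) (h0 k)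
    push_cast at this
    exact this

end


/-! ### Runs of the scheme for the value-at-risk -/

/-- The indicator of the event that `|ξ j - θ| ≤ r` for all `j ∈ [N, k]`. -/
noncomputable def good {Ω : Type*} (ξ : ℕ → Ω → ℝ) (θ r : ℝ) (N k : ℕ) (ω : Ω) : ℝ :=
  {ω | ∀ j, N ≤ j → j ≤ k → |ξ j ω - θ| ≤ r}.indicator 1 ω

section good

variable {Ω : Type*} {ξ : ℕ → Ω → ℝ} {θ r : ℝ} {N k : ℕ} {ω : Ω}

lemma good_eq_one (h : ∀ j, N ≤ j → j ≤ k → |ξ j ω - θ| ≤ r) : good ξ θ r N k ω = 1 :=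
  indicator_of_mem (s := {ω | ∀ j, N ≤ j → j ≤ k → |ξ j ω - θ| ≤ r}) h 1

lemma good_eq_zero (h : ¬ ∀ j, N ≤ j → j ≤ k → |ξ j ω - θ| ≤ r) : good ξ θ r N k ω = 0 :=
  indicator_of_notMem (s := {ω | ∀ j, N ≤ j → j ≤ k → |ξ j ω - θ| ≤ r}) h 1

lemma good_cases (ξ : ℕ → Ω → ℝ) (θ r : ℝ) (N k : ℕ) (ω : Ω) :
    (good ξ θ r N k ω = 1 ∧ ∀ j, N ≤ j → j ≤ k → |ξ j ω - θ| ≤ r) ∨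
      (good ξ θ r N k ω = 0 ∧ ¬ ∀ j, N ≤ j → j ≤ k → |ξ j ω - θ| ≤ r) := by
  by_cases h : ∀ j, N ≤ j → j ≤ k → |ξ j ω - θ| ≤ r
  · exact Or.inl ⟨good_eq_one h, h⟩
  · exact Or.inr ⟨good_eq_zero h, h⟩

lemma good_nonneg (ξ : ℕ → Ω → ℝ) (θ r : ℝ) (N k : ℕ) (ω : Ω) : 0 ≤ good ξ θ r N k ω := by
  rcases good_cases ξ θ r N k ω with h | h <;> rw [h.1]; norm_num

lemma good_le_one (ξ : ℕ → Ω → ℝ) (θ r : ℝ) (N k : ℕ) (ω : Ω) : good ξ θ r N k ω ≤ 1 := by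
  rcases good_cases ξ θ r N k ω with h | h <;> rw [h.1]; norm_num

lemma good_sq (ξ : ℕ → Ω → ℝ) (θ r : ℝ) (N k : ℕ) (ω : Ω) :
    good ξ θ r N k ω ^ 2 = good ξ θ r N k ω := by
  rcases good_cases ξ θ r N k ω with h | h <;> rw [h.1] <;> norm_num

lemma good_mono {N' k' : ℕ} (hN : N ≤ N') (hk : k' ≤ k) (ω : Ω) :
    good ξ θ r N k ω ≤ good ξ θ r N' k' ω := by
  rcases good_cases ξ θ r N k ω with h | h
  · rw [h.1, good_eq_one fun j h1 h2 => h.2 j (hN.trans h1) (h2.trans hk)]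
  · rw [h.1]; exact good_nonneg _ _ _ _ _ _

lemma measurable_good_of_measurable [MeasurableSpace Ω] (hξ : ∀ j ≤ k, Measurable (ξ j)) (θ r : ℝ)
    (N : ℕ) : Measurable (good ξ θ r N k) := by
  refine Measurable.indicator measurable_one ?_
  have : {ω | ∀ j, N ≤ j → j ≤ k → |ξ j ω - θ| ≤ r} =
      ⋂ j, ⋂ (_ : N ≤ j), ⋂ (_ : j ≤ k), (fun ω => |ξ j ω - θ|) ⁻¹' Iic r := by
    ext ω; simp
  rw [this]
  refine MeasurableSet.iInter fun j => MeasurableSet.iInter fun _ => MeasurableSet.iInter fun hj => ?_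
  have h2 : Measurable fun y : ℝ => |y - θ| := by fun_prop
  exact (h2.comp (hξ j hj)) measurableSet_Iic

end good

section

variable {Ω : Type*} [mΩ : MeasurableSpace Ω] {P : Measure Ω}

/-- `X 0, X 1, …` have law `ν`, and `X n` is independent of the past `𝓕 n`. -/
structure Innovations (P : Measure Ω) (ν : Measure ℝ) (𝓕 : Filtration ℕ mΩ) (X : ℕ → Ω → ℝ) :
    Prop where
  meas : ∀ n, Measurable[𝓕 (n + 1)] (X n)
  law : ∀ n, P.map (X n) = ν
  indep : ∀ n, Indep (𝓕 n) (MeasurableSpace.comap (X n) inferInstance) P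

/-- `ξ` is the Robbins-Monro iteration for the value-at-risk driven by the innovations `X`. -/
structure IsRun (P : Measure Ω) (α : ℝ) (γ : ℕ → ℝ) (ν : Measure ℝ) (𝓕 : Filtration ℕ mΩ)
    (ξ X : ℕ → Ω → ℝ) : Prop extends Innovations P ν 𝓕 X where
  meas_zero : Measurable[𝓕 0] (ξ 0)
  step : ∀ n ω, ξ (n + 1) ω = ξ n ω - γ (n + 1) * H₁ α (ξ n ω) (X n ω)

namespace Innovations

variable {ν : Measure ℝ} {𝓕 : Filtration ℕ mΩ} {X : ℕ → Ω → ℝ}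

lemma measurable (h : Innovations P ν 𝓕 X) (n : ℕ) : Measurable (X n) :=
  (h.meas n).mono (𝓕.le _) le_rfl

/-- Integration of the innovation, the past being frozen. -/
lemma integral_freeze [IsProbabilityMeasure P] (h : Innovations P ν 𝓕 X) {n : ℕ} {E : Type*}
    [MeasurableSpace E] {U : Ω → E} (hU : Measurable[𝓕 n] U) {g : E × ℝ → ℝ} (hg : Measurable g)
    (hint : Integrable (fun ω => g (U ω, X n ω)) P) :
    ∫ ω, g (U ω, X n ω) ∂P = ∫ ω, ∫ x, g (U ω, x) ∂ν ∂P := by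
  have hU' : Measurable U := hU.mono (𝓕.le _) le_rfl
  have hX := h.measurable n
  have hind : IndepFun U (X n) P :=
    indep_of_indep_of_le_left (h.indep n) hU.comap_le
  have hmap := (indepFun_iff_map_prod_eq_prod_map_map hU'.aemeasurable hX.aemeasurable).1 hind
  have h1 := Measure.isProbabilityMeasure_map (μ := P) hX.aemeasurable
  have h2 := Measure.isProbabilityMeasure_map (μ := P) hU'.aemeasurable
  have hint' : Integrable g ((P.map U).prod (P.map (X n))) := by
    rw [← hmap]
    exact (integrable_map_measure hg.aestronglyMeasurable (hU'.prodMk hX).aemeasurable).2 hint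
  have e1 : ∫ ω, g (U ω, X n ω) ∂P = ∫ p, g p ∂(P.map fun ω => (U ω, X n ω)) :=
    (integral_map (hU'.prodMk hX).aemeasurable hg.aestronglyMeasurable).symm
  rw [e1, hmap, integral_prod _ hint', h.law n,
    integral_map hU'.aemeasurable]
  have : SFinite ν := by rw [← h.law n]; infer_instance
  exact (hg.stronglyMeasurable.integral_prod_right').aestronglyMeasurable

lemma integral_mul_freeze [IsProbabilityMeasure P] (h : Innovations P ν 𝓕 X) {n : ℕ}
    {W ξ : Ω → ℝ} (hW : Measurable[𝓕 n] W) (hξ : Measurable[𝓕 n] ξ) {g : ℝ → ℝ → ℝ}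
    (hg : Measurable fun p : ℝ × ℝ => g p.1 p.2)
    (hint : Integrable (fun ω => W ω * g (ξ ω) (X n ω)) P) :
    ∫ ω, W ω * g (ξ ω) (X n ω) ∂P = ∫ ω, W ω * ∫ x, g (ξ ω) x ∂ν ∂P := by
  have h1 := h.integral_freeze (hW.prodMk hξ)
    (g := fun p : (ℝ × ℝ) × ℝ => p.1.1 * g p.1.2 p.2)
    (by
      refine (measurable_fst.comp measurable_fst).mul ?_
      exact hg.comp ((measurable_snd.comp measurable_fst).prodMk measurable_snd)) hint
  rw [h1]
  simp_rw [integral_const_mul]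

end Innovations

namespace IsRun

variable {α : ℝ} {γ : ℕ → ℝ} {ν : Measure ℝ} {𝓕 : Filtration ℕ mΩ} {ξ X : ℕ → Ω → ℝ}

lemma adapted (h : IsRun P α γ ν 𝓕 ξ X) (n : ℕ) : Measurable[𝓕 n] (ξ n) := by
  induction n with
  | zero => exact h.meas_zero
  | succ n ih =>
    have h1 : Measurable[𝓕 (n + 1)] (ξ n) := ih.mono (𝓕.mono n.le_succ) le_rfl
    have h2 : ξ (n + 1) = fun ω => ξ n ω - γ (n + 1) * H₁ α (ξ n ω) (X n ω) :=
      funext fun ω => h.step n ω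
    rw [h2]
    exact h1.sub (((measurable_H₁ α).comp (h1.prodMk (h.meas n))).const_mul _)

lemma measurable_good_past (h : IsRun P α γ ν 𝓕 ξ X) (θ r : ℝ) (N k : ℕ) :
    Measurable[𝓕 k] (good ξ θ r N k) :=
  @measurable_good_of_measurable _ _ _ (𝓕 k)
    (fun j hj => (h.adapted j).mono (𝓕.mono hj) le_rfl) θ r N

lemma measurable_xi (h : IsRun P α γ ν 𝓕 ξ X) (n : ℕ) : Measurable (ξ n) :=
  (h.adapted n).mono (𝓕.le n) le_rfl

lemma measurable_good (h : IsRun P α γ ν 𝓕 ξ X) (θ r : ℝ) (N k : ℕ) :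
    Measurable (good ξ θ r N k) :=
  (h.measurable_good_past θ r N k).mono (𝓕.le k) le_rfl

variable [IsProbabilityMeasure P]

lemma memLp (h : IsRun P α γ ν 𝓕 ξ X) (hα : α ∈ Ioo (0 : ℝ) 1) {θ : ℝ}
    (h0 : MemLp (fun ω => ξ 0 ω - θ) 2 P) (n : ℕ) : MemLp (fun ω => ξ n ω - θ) 2 P := by
  induction n with
  | zero => exact h0
  | succ n ih =>
    have hb : MemLp (fun ω => γ (n + 1) * H₁ α (ξ n ω) (X n ω)) 2 P := by
      refine MemLp.const_mul ?_ _
      refine MemLp.of_bound ((measurable_H₁ α).comp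
        ((h.measurable_xi n).prodMk (h.measurable n))).aestronglyMeasurable (1 - α)⁻¹
        (Eventually.of_forall fun ω => abs_H₁_le hα _ _)
    refine (ih.sub hb).ae_eq (Eventually.of_forall fun ω => ?_)
    simp only [Pi.sub_apply, h.step]
    ring

end IsRun

end

/-! ### Drift toward the quantile -/

/-- `ν` has a regular density `f`, bounded below by `m` near its quantile `θ`. -/
structure QuantileLaw (α : ℝ) (ν : Measure ℝ) (f : ℝ → ℝ) (M : ℝ≥0) (m θ : ℝ) : Prop
    extends PdfLaw ν f M where
  cdf_eq : ν.real (Iic θ) = α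
  lower : ∀ x, |x - θ| ≤ 1 → m ≤ f x

namespace QuantileLaw

variable {α : ℝ} {ν : Measure ℝ} {f : ℝ → ℝ} {M : ℝ≥0} {m θ : ℝ}

/-- Within distance 1 the density is at least m, which gives quadratic growth; farther out,
monotonicity of the cdf preserves the gain reached at distance 1. A local lower bound on the density
thus yields a global drift. -/
lemma cdf_sub_mul_ge (h : QuantileLaw α ν f M m θ) (x : ℝ) :
    m * min ((x - θ) ^ 2) 1 ≤ (x - θ) * (ν.real (Iic x) - α) := by
  have hloc : ∀ y, |y - θ| ≤ 1 → m * (y - θ) ^ 2 ≤ (y - θ) * (ν.real (Iic y) - α) := by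
    intro y hy
    rw [← h.cdf_eq, h.cdf_sub]
    rcases le_total θ y with hy' | hy'
    · have h1 : m * (y - θ) ≤ ∫ x in θ..y, f x := by
        have := intervalIntegral.integral_mono_on (f := fun _ => m) (g := f) (μ := volume) hy'
          (by simp) (h.lip.continuous.intervalIntegrable _ _) fun x hx => h.lower x (by
            rw [abs_le] at hy ⊢; constructor <;> linarith [hx.1, hx.2])
        simpa [mul_comm] using this
      nlinarith
    · have h1 : m * (θ - y) ≤ ∫ x in y..θ, f x := by
        have := intervalIntegral.integral_mono_on (f := fun _ => m) (g := f) (μ := volume) hy'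
          (by simp) (h.lip.continuous.intervalIntegrable _ _) fun x hx => h.lower x (by
            rw [abs_le] at hy ⊢; constructor <;> linarith [hx.1, hx.2])
        simpa [mul_comm] using this
      rw [intervalIntegral.integral_symm]
      nlinarith
  rcases le_total |x - θ| 1 with hx | hx
  · rw [min_eq_left (by rw [← sq_abs]; nlinarith [abs_nonneg (x - θ)])]
    exact hloc x hx
  · rw [min_eq_right (by rw [← sq_abs]; nlinarith [abs_nonneg (x - θ)]), mul_one]
    rcases le_total θ x with hy' | hy'
    · rw [abs_of_nonneg (by linarith)] at hx
      have h1 := hloc (θ + 1) (by simp)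
      have h2 := h.strictMono_cdf.monotone (show θ + 1 ≤ x by linarith)
      have h3 := h.strictMono_cdf.monotone (show θ ≤ θ + 1 by linarith)
      simp only [h.cdf_eq] at h2 h3
      simp only [add_sub_cancel_left, one_pow, mul_one, one_mul] at h1
      nlinarith
    · rw [abs_of_nonpos (by linarith)] at hx
      have h1 := hloc (θ - 1) (by simp)
      have h2 := h.strictMono_cdf.monotone (show x ≤ θ - 1 by linarith)
      have h3 := h.strictMono_cdf.monotone (show θ - 1 ≤ θ by linarith)
      simp only [h.cdf_eq] at h2 h3
      simp only [sub_sub_cancel_left, even_two, Even.neg_pow, one_pow, mul_one, neg_mul,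
        one_mul] at h1
      nlinarith

lemma cdf_sub_mul_nonneg (h : QuantileLaw α ν f M m θ) (x : ℝ) :
    0 ≤ (x - θ) * (ν.real (Iic x) - α) := by
  rw [← h.cdf_eq]
  rcases le_total θ x with hy' | hy'
  · exact mul_nonneg (by linarith) (by linarith [h.strictMono_cdf.monotone hy'])
  · exact mul_nonneg_of_nonpos_of_nonpos (by linarith) (by linarith [h.strictMono_cdf.monotone hy'])

/-- Unlike the global bound, the constant here tends to the true slope f(θ) as r decreases, as
required for the rate when β = 1. -/
lemma cdf_sub_mul_ge_local (h : QuantileLaw α ν f M m θ) {x r : ℝ} (hx : |x - θ| ≤ r) :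
    (f θ - M * r) * (x - θ) ^ 2 ≤ (x - θ) * (ν.real (Iic x) - α) := by
  have h1 := h.abs_cdf_sub_sub_le θ x
  rw [h.cdf_eq] at h1
  set d := ν.real (Iic x) - α - f θ * (x - θ) with hd
  have h2 : (x - θ) * (ν.real (Iic x) - α) = f θ * (x - θ) ^ 2 + (x - θ) * d := by rw [hd]; ring
  have h3 : |(x - θ) * d| ≤ r * (M * (x - θ) ^ 2) := by
    rw [abs_mul]
    exact mul_le_mul hx h1 (abs_nonneg _) ((abs_nonneg _).trans hx)
  have h4 := neg_abs_le ((x - θ) * d)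
  rw [h2]
  nlinarith

end QuantileLaw


lemma _root_.MeasureTheory.Integrable.fun_sub {S : Type*} [MeasurableSpace S] {μ : Measure S}
    {g k : S → ℝ} (hg : Integrable g μ) (hk : Integrable k μ) :
    Integrable (fun s => g s - k s) μ := hg.sub hk

lemma inv_one_sub_pos {α : ℝ} (hα : α ∈ Ioo (0 : ℝ) 1) : 0 < (1 - α)⁻¹ := by
  have := hα.2
  simp
  linarith

/-! ### Stability of the iterates near the quantile -/

section

variable {Ω : Type*} [mΩ : MeasurableSpace Ω] {P : Measure Ω} [IsProbabilityMeasure P]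

omit [IsProbabilityMeasure P] in
lemma integrable_bdd_mul {W g : Ω → ℝ} {C : ℝ} (hW : Measurable W) (hC : ∀ ω, |W ω| ≤ C)
    (hg : Integrable g P) : Integrable (fun ω => W ω * g ω) P :=
  hg.bdd_mul hW.aestronglyMeasurable (Eventually.of_forall hC)

namespace IsRun

variable {α : ℝ} {γ : ℕ → ℝ} {ν : Measure ℝ} {𝓕 : Filtration ℕ mΩ} {ξ X : ℕ → Ω → ℝ}
  {f : ℝ → ℝ} {M : ℝ≥0} {m θ : ℝ}

omit [IsProbabilityMeasure P] in
lemma measurable_H₁_comp (h : IsRun P α γ ν 𝓕 ξ X) (n : ℕ) :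
    Measurable fun ω => H₁ α (ξ n ω) (X n ω) :=
  (NestedSA.measurable_H₁ α).comp ((h.measurable_xi n).prodMk (h.measurable n))

lemma integral_mul_H₁ (h : IsRun P α γ ν 𝓕 ξ X) (hα : α ∈ Ioo (0 : ℝ) 1) (hν : PdfLaw ν f M)
    {n : ℕ} {W : Ω → ℝ} (hW : Measurable[𝓕 n] W) (hWi : Integrable W P) :
    ∫ ω, W ω * H₁ α (ξ n ω) (X n ω) ∂P =
      ∫ ω, W ω * ((1 - α)⁻¹ * (ν.real (Iic (ξ n ω)) - α)) ∂P := by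
  rw [h.integral_mul_freeze hW (h.adapted n) (NestedSA.measurable_H₁ α)]
  · simp_rw [hν.integral_H₁ hα]
  · exact hWi.mul_bdd (h.measurable_H₁_comp n).aestronglyMeasurable
      (Eventually.of_forall fun ω => abs_H₁_le hα _ _)

/-- Expand the square; freezing the past turns the cross term into the drift, and `H₁` is bounded.
The weight `W` is 1 for the global estimate and an indicator `good` for the localized ones. -/
lemma integral_sq_step (h : IsRun P α γ ν 𝓕 ξ X) (hα : α ∈ Ioo (0 : ℝ) 1) (hν : PdfLaw ν f M)
    (h0 : MemLp (fun ω => ξ 0 ω - θ) 2 P) {n : ℕ} {W : Ω → ℝ} (hW : Measurable[𝓕 n] W)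
    (hW0 : ∀ ω, 0 ≤ W ω) (hW1 : ∀ ω, W ω ≤ 1) :
    ∫ ω, W ω * (ξ (n + 1) ω - θ) ^ 2 ∂P ≤ ∫ ω, W ω * (ξ n ω - θ) ^ 2 ∂P -
      2 * γ (n + 1) * (1 - α)⁻¹ *
        ∫ ω, W ω * ((ξ n ω - θ) * (ν.real (Iic (ξ n ω)) - α)) ∂P +
      (1 - α)⁻¹ ^ 2 * γ (n + 1) ^ 2 := by
  have hWm : Measurable W := hW.mono (𝓕.le n) le_rfl
  have hWb : ∀ ω, |W ω| ≤ 1 := fun ω => by rw [abs_of_nonneg (hW0 ω)]; exact hW1 ω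
  have hL := h.memLp hα h0 n
  have hz : Integrable (fun ω => W ω * (ξ n ω - θ)) P :=
    integrable_bdd_mul hWm hWb (hL.integrable (by norm_num))
  have hzm : Measurable[𝓕 n] fun ω => W ω * (ξ n ω - θ) := hW.mul ((h.adapted n).sub_const θ)
  have hH := h.measurable_H₁_comp n
  have hHb : ∀ ω, |H₁ α (ξ n ω) (X n ω)| ≤ (1 - α)⁻¹ := fun ω => abs_H₁_le hα _ _
  have i1 : Integrable (fun ω => W ω * (ξ n ω - θ) ^ 2) P :=
    integrable_bdd_mul hWm hWb hL.integrable_sq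
  have i2 : Integrable (fun ω => W ω * (ξ n ω - θ) * H₁ α (ξ n ω) (X n ω)) P :=
    hz.mul_bdd hH.aestronglyMeasurable (Eventually.of_forall hHb)
  have i3 : Integrable (fun ω => W ω * H₁ α (ξ n ω) (X n ω) ^ 2) P := by
    refine integrable_bdd_mul hWm hWb (Integrable.of_bound (hH.pow_const 2).aestronglyMeasurable
      ((1 - α)⁻¹ ^ 2) (Eventually.of_forall fun ω => ?_))
    rw [norm_pow]
    exact pow_le_pow_left₀ (norm_nonneg _) (hHb ω) 2
  have e1 : ∀ ω, W ω * (ξ (n + 1) ω - θ) ^ 2 = W ω * (ξ n ω - θ) ^ 2 -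
      2 * γ (n + 1) * (W ω * (ξ n ω - θ) * H₁ α (ξ n ω) (X n ω)) +
      γ (n + 1) ^ 2 * (W ω * H₁ α (ξ n ω) (X n ω) ^ 2) := by
    intro ω; rw [h.step]; ring
  have e2 : ∫ ω, W ω * (ξ n ω - θ) * H₁ α (ξ n ω) (X n ω) ∂P =
      (1 - α)⁻¹ * ∫ ω, W ω * ((ξ n ω - θ) * (ν.real (Iic (ξ n ω)) - α)) ∂P := by
    rw [h.integral_mul_H₁ hα hν hzm hz, ← integral_const_mul]
    refine integral_congr_ae (Eventually.of_forall fun ω => ?_)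
    simp only
    ring
  have e3 : ∫ ω, W ω * H₁ α (ξ n ω) (X n ω) ^ 2 ∂P ≤ (1 - α)⁻¹ ^ 2 := by
    refine (integral_mono i3 (integrable_const ((1 - α)⁻¹ ^ 2)) fun ω => ?_).trans (by simp)
    have : H₁ α (ξ n ω) (X n ω) ^ 2 ≤ (1 - α)⁻¹ ^ 2 := by
      rw [← sq_abs]; exact pow_le_pow_left₀ (abs_nonneg _) (hHb ω) 2
    calc _ ≤ 1 * H₁ α (ξ n ω) (X n ω) ^ 2 :=
          mul_le_mul_of_nonneg_right (hW1 ω) (sq_nonneg _)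
      _ ≤ _ := by rw [one_mul]; exact this
  simp_rw [e1]
  have i4 := i2.const_mul (2 * γ (n + 1))
  have i5 := i3.const_mul (γ (n + 1) ^ 2)
  rw [integral_add (i1.fun_sub i4) i5, integral_sub i1 i4, integral_const_mul, integral_const_mul, e2]
  have := mul_le_mul_of_nonneg_left e3 (sq_nonneg (γ (n + 1)))
  linarith

lemma integrable_min_sq (h : IsRun P α γ ν 𝓕 ξ X) (θ : ℝ) (n : ℕ) :
    Integrable (fun ω => min ((ξ n ω - θ) ^ 2) 1) P := by
  have := h.measurable_xi n
  refine Integrable.of_bound (by fun_prop) 1 (Eventually.of_forall fun ω => ?_)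
  rw [Real.norm_of_nonneg (by positivity)]
  exact min_le_right _ _

lemma integrable_mul_cdf (h : IsRun P α γ ν 𝓕 ξ X) (hα : α ∈ Ioo (0 : ℝ) 1) (hν : PdfLaw ν f M)
    (h0 : MemLp (fun ω => ξ 0 ω - θ) 2 P) (n : ℕ) :
    Integrable (fun ω => (ξ n ω - θ) * (ν.real (Iic (ξ n ω)) - α)) P := by
  have hm := hν.continuous_cdf.measurable.comp (h.measurable_xi n)
  have := hν.prob
  refine ((h.memLp hα h0 n).integrable (by norm_num)).mul_bdd (c := 1)
    (hm.sub_const α).aestronglyMeasurable (Eventually.of_forall fun ω => ?_)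
  rw [Real.norm_eq_abs, abs_le]
  have h1 : 0 ≤ ν.real (Iic (ξ n ω)) := measureReal_nonneg
  have h2 : ν.real (Iic (ξ n ω)) ≤ 1 := measureReal_le_one
  constructor <;> linarith [hα.1, hα.2]

/-- Telescoped square step with the global drift bound: the series of γ_k E[min(|ξ_k - θ|², 1)] is
bounded uniformly over the laws. -/
lemma sum_integral_min_le (h : IsRun P α γ ν 𝓕 ξ X) (hα : α ∈ Ioo (0 : ℝ) 1)
    (hγ : ∀ n, 0 < γ (n + 1)) (hν : QuantileLaw α ν f M m θ)
    (h0 : MemLp (fun ω => ξ 0 ω - θ) 2 P) (n : ℕ) :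
    ∫ ω, (ξ n ω - θ) ^ 2 ∂P +
      ∑ k ∈ Finset.range n, 2 * γ (k + 1) * (1 - α)⁻¹ * (m * ∫ ω, min ((ξ k ω - θ) ^ 2) 1 ∂P) ≤
    ∫ ω, (ξ 0 ω - θ) ^ 2 ∂P + (1 - α)⁻¹ ^ 2 * ∑ k ∈ Finset.range n, γ (k + 1) ^ 2 := by
  induction n with
  | zero => simp
  | succ n ih =>
    rw [Finset.sum_range_succ, Finset.sum_range_succ]
    have h1 := h.integral_sq_step hα hν.toPdfLaw h0 (n := n) (W := fun _ => 1) measurable_const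
      (by simp) (by simp)
    simp only [one_mul] at h1
    have h2 : m * ∫ ω, min ((ξ n ω - θ) ^ 2) 1 ∂P ≤
        ∫ ω, (ξ n ω - θ) * (ν.real (Iic (ξ n ω)) - α) ∂P := by
      rw [← integral_const_mul]
      exact integral_mono ((h.integrable_min_sq θ n).const_mul m)
        (h.integrable_mul_cdf hα hν.toPdfLaw h0 n) fun ω => hν.cdf_sub_mul_ge _
    have h3 : 0 ≤ 2 * γ (n + 1) * (1 - α)⁻¹ := by
      have := hγ n
      have := inv_one_sub_pos hα
      positivity
    have h4 := mul_le_mul_of_nonneg_left h2 h3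
    rw [mul_add]
    linarith

/-- Once the iterates are close to `θ`, they stay there with high probability. -/
lemma integral_good_step (h : IsRun P α γ ν 𝓕 ξ X) (hα : α ∈ Ioo (0 : ℝ) 1)
    (hγ : ∀ n, 0 < γ (n + 1)) (hν : QuantileLaw α ν f M m θ)
    (h0 : MemLp (fun ω => ξ 0 ω - θ) 2 P) {r : ℝ} (hr : 0 ≤ r) {n k : ℕ} (hk : n ≤ k) :
    ∫ ω, good ξ θ r n k ω * (ξ k ω - θ) ^ 2 ∂P +
      r ^ 2 * ∫ ω, (good ξ θ r n n ω - good ξ θ r n k ω) ∂P ≤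
    ∫ ω, good ξ θ r n n ω * (ξ n ω - θ) ^ 2 ∂P +
      (1 - α)⁻¹ ^ 2 * ∑ j ∈ Finset.Ico n k, γ (j + 1) ^ 2 := by
  have hgi : ∀ k, Integrable (good ξ θ r n k) P := fun k =>
    Integrable.of_bound (h.measurable_good θ r n k).aestronglyMeasurable 1
      (Eventually.of_forall fun ω => by
        rw [Real.norm_of_nonneg (good_nonneg _ _ _ _ _ _)]; exact good_le_one _ _ _ _ _ _)
  have hgz : ∀ k l, Integrable (fun ω => good ξ θ r n k ω * (ξ l ω - θ) ^ 2) P := fun k l =>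
    integrable_bdd_mul (C := 1) (h.measurable_good θ r n k) (fun ω => by
      rw [abs_of_nonneg (good_nonneg _ _ _ _ _ _)]; exact good_le_one _ _ _ _ _ _)
      (h.memLp hα h0 l).integrable_sq
  induction k, hk using Nat.le_induction with
  | base => simp
  | succ k hk ih =>
    rw [Finset.sum_Ico_succ_top hk]
    have h1 := h.integral_sq_step hα hν.toPdfLaw h0 (n := k) (W := good ξ θ r n k)
      (h.measurable_good_past θ r n k) (good_nonneg _ _ _ _ _) (good_le_one _ _ _ _ _)
    have h2 : 0 ≤ ∫ ω, good ξ θ r n k ω * ((ξ k ω - θ) * (ν.real (Iic (ξ k ω)) - α)) ∂P :=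
      integral_nonneg fun ω => mul_nonneg (good_nonneg _ _ _ _ _ _) (hν.cdf_sub_mul_nonneg _)
    have h3 : 0 ≤ 2 * γ (k + 1) * (1 - α)⁻¹ := by
      have := hγ k
      have := inv_one_sub_pos hα
      positivity
    have h4 := mul_nonneg h3 h2
    -- On paths that leave the ball at time k + 1 the squared distance exceeds r², which pays for
    -- the lost indicator.
    have h5 : ∫ ω, good ξ θ r n (k + 1) ω * (ξ (k + 1) ω - θ) ^ 2 ∂P +
        r ^ 2 * ∫ ω, (good ξ θ r n k ω - good ξ θ r n (k + 1) ω) ∂P ≤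
        ∫ ω, good ξ θ r n k ω * (ξ (k + 1) ω - θ) ^ 2 ∂P := by
      rw [← integral_const_mul, ← integral_add (hgz _ _) (((hgi _).fun_sub (hgi _)).const_mul _)]
      refine integral_mono ((hgz _ _).add (((hgi _).fun_sub (hgi _)).const_mul _)) (hgz _ _)
        fun ω => ?_
      simp only [Pi.add_apply, Pi.sub_apply]
      rcases good_cases ξ θ r n k ω with hc | hc
      · rcases good_cases ξ θ r n (k + 1) ω with hd | hd
        · rw [hc.1, hd.1]; simp
        · have h6 : r < |ξ (k + 1) ω - θ| := by
            by_contra hcon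
            refine hd.2 fun j h7 h8 => ?_
            rcases Nat.lt_or_ge k j with h9 | h9
            · obtain rfl : j = k + 1 := by omega
              exact not_lt.1 hcon
            · exact hc.2 j h7 h9
          rw [hc.1, hd.1, ← sq_abs (ξ (k + 1) ω - θ)]
          nlinarith
      · have h6 := good_mono (ξ := ξ) (θ := θ) (r := r) (le_refl n) k.le_succ ω
        have h7 : good ξ θ r n (k + 1) ω = 0 :=
          le_antisymm (h6.trans hc.1.le) (good_nonneg _ _ _ _ _ _)
        rw [hc.1, h7]; simp
    have h6 : ∫ ω, (good ξ θ r n n ω - good ξ θ r n (k + 1) ω) ∂P =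
        ∫ ω, (good ξ θ r n n ω - good ξ θ r n k ω) ∂P +
        ∫ ω, (good ξ θ r n k ω - good ξ θ r n (k + 1) ω) ∂P := by
      rw [← integral_add ((hgi _).fun_sub (hgi _)) ((hgi _).fun_sub (hgi _))]
      simp
    rw [h6]
    linarith

/-- Maximal inequality. The factor 2 counts the truncated square at time n twice: once for paths
already outside the ball at n (Chebyshev), once as initial energy of paths that leave later. -/
lemma integral_one_sub_good_le (h : IsRun P α γ ν 𝓕 ξ X) (hα : α ∈ Ioo (0 : ℝ) 1)
    (hγ : ∀ n, 0 < γ (n + 1)) (hν : QuantileLaw α ν f M m θ)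
    (h0 : MemLp (fun ω => ξ 0 ω - θ) 2 P) {r : ℝ} (hr : 0 < r) (hr1 : r ≤ 1) {n k : ℕ}
    (hk : n ≤ k) :
    r ^ 2 * ∫ ω, (1 - good ξ θ r n k ω) ∂P ≤
      2 * ∫ ω, min ((ξ n ω - θ) ^ 2) 1 ∂P +
        (1 - α)⁻¹ ^ 2 * ∑ j ∈ Finset.Ico n k, γ (j + 1) ^ 2 := by
  have hgi : ∀ k, Integrable (good ξ θ r n k) P := fun k =>
    Integrable.of_bound (h.measurable_good θ r n k).aestronglyMeasurable 1
      (Eventually.of_forall fun ω => by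
        rw [Real.norm_of_nonneg (good_nonneg _ _ _ _ _ _)]; exact good_le_one _ _ _ _ _ _)
  have hgz : ∀ k l, Integrable (fun ω => good ξ θ r n k ω * (ξ l ω - θ) ^ 2) P := fun k l =>
    integrable_bdd_mul (C := 1) (h.measurable_good θ r n k) (fun ω => by
      rw [abs_of_nonneg (good_nonneg _ _ _ _ _ _)]; exact good_le_one _ _ _ _ _ _)
      (h.memLp hα h0 l).integrable_sq
  have h1 := h.integral_good_step hα hγ hν h0 hr.le hk
  have h2 : 0 ≤ ∫ ω, good ξ θ r n k ω * (ξ k ω - θ) ^ 2 ∂P :=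
    integral_nonneg fun ω => mul_nonneg (good_nonneg _ _ _ _ _ _) (sq_nonneg _)
  have h3 : ∫ ω, good ξ θ r n n ω * (ξ n ω - θ) ^ 2 ∂P ≤ ∫ ω, min ((ξ n ω - θ) ^ 2) 1 ∂P := by
    refine integral_mono (hgz _ _) (h.integrable_min_sq θ n) fun ω => ?_
    simp only
    rcases good_cases ξ θ r n n ω with hc | hc
    · have h4 := hc.2 n le_rfl le_rfl
      have h5 : (ξ n ω - θ) ^ 2 ≤ 1 := by
        rw [← sq_abs]; nlinarith [abs_nonneg (ξ n ω - θ)]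
      rw [hc.1, one_mul, min_eq_left h5]
    · rw [hc.1, zero_mul]; positivity
  have h4 : r ^ 2 * ∫ ω, (1 - good ξ θ r n n ω) ∂P ≤ ∫ ω, min ((ξ n ω - θ) ^ 2) 1 ∂P := by
    rw [← integral_const_mul]
    refine integral_mono (((integrable_const _).fun_sub (hgi _)).const_mul _)
      (h.integrable_min_sq θ n) fun ω => ?_
    simp only
    rcases good_cases ξ θ r n n ω with hc | hc
    · rw [hc.1, sub_self, mul_zero]; positivity
    · have h5 : r < |ξ n ω - θ| := by
        by_contra hcon
        refine hc.2 fun j h7 h8 => ?_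
        obtain rfl : j = n := by omega
        exact not_lt.1 hcon
      rw [hc.1, sub_zero, mul_one, ← sq_abs (ξ n ω - θ)]
      refine le_min ?_ ?_ <;> nlinarith
  have h5 : ∫ ω, (1 - good ξ θ r n k ω) ∂P = ∫ ω, (1 - good ξ θ r n n ω) ∂P +
      ∫ ω, (good ξ θ r n n ω - good ξ θ r n k ω) ∂P := by
    rw [← integral_add ((integrable_const _).fun_sub (hgi _)) ((hgi _).fun_sub (hgi _))]
    simp
  rw [h5]
  linarith

end IsRun

lemma exists_forall_sum_Ico_le {g : ℕ → ℝ} (hg : Summable g) (hg0 : ∀ n, 0 ≤ g n) {ε : ℝ}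
    (hε : 0 < ε) : ∃ N, ∀ n k, N ≤ n → ∑ j ∈ Finset.Ico n k, g j ≤ ε := by
  obtain ⟨N, hN⟩ := eventually_atTop.1
    ((tendsto_order.1 (tendsto_sum_nat_add g)).2 ε hε)
  refine ⟨N, fun n k hn => ?_⟩
  rw [Finset.sum_Ico_eq_sum_range]
  refine le_trans ?_ (hN n hn).le
  have hs : Summable fun j => g (j + n) := (summable_nat_add_iff n).2 hg
  simp_rw [add_comm n]
  exact hs.sum_le_tsum _ fun j _ => hg0 _

/-- Stability of the scheme, uniformly over the laws, the initial values and the runs. -/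
theorem exists_forall_integral_one_sub_good_le (P : Measure Ω) [IsProbabilityMeasure P]
    {α : ℝ} (hα : α ∈ Ioo (0 : ℝ) 1) {γ : ℕ → ℝ}
    {κ : ℝ} (hγ : StepSize γ κ) (M : ℝ≥0) {m : ℝ} (hm : 0 < m) (C₀ : ℝ) {r : ℝ} (hr : 0 < r)
    (hr1 : r ≤ 1) {η : ℝ} (hη : 0 < η) :
    ∃ N, ∀ (ν : Measure ℝ) (f : ℝ → ℝ) (θ : ℝ) (𝓕 : Filtration ℕ mΩ) (ξ X : ℕ → Ω → ℝ),
      QuantileLaw α ν f M m θ → IsRun P α γ ν 𝓕 ξ X → MemLp (fun ω => ξ 0 ω - θ) 2 P →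
      ∫ ω, (ξ 0 ω - θ) ^ 2 ∂P ≤ C₀ → ∀ N', N ≤ N' → ∀ k, 
      ∫ ω, (1 - good ξ θ r N' k ω) ∂P ≤ η := by
  have hκ := inv_one_sub_pos hα
  -- The maximal inequality spends 2δ on the starting time and δ on the tail of the squared steps,
  -- in total η r².
  set δ := η * r ^ 2 / 3 with hδ
  have hδ0 : 0 < δ := by positivity
  set C₁ := C₀ + (1 - α)⁻¹ ^ 2 * ∑' k, γ (k + 1) ^ 2 with hC₁
  obtain ⟨N₀, hN₀⟩ := exists_forall_sum_Ico_le (hγ.summable_sq.mul_left ((1 - α)⁻¹ ^ 2))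
    (fun n => by positivity) hδ0
  set c := 2 * (1 - α)⁻¹ * (m * δ) with hc
  have hc0 : 0 < c := by positivity
  -- Between `N₀` and `N₁` the steps sum to more than `C₁ / c`, so the truncated error cannot stay
  -- above δ throughout.
  obtain ⟨N₁, hN₁⟩ := (hγ.tendsto_sum.eventually_gt_atTop
    (C₁ / c + ∑ k ∈ Finset.range N₀, γ (k + 1))).exists
  refine ⟨N₁, fun ν f θ 𝓕 ξ X hν h h0 hC N' hN' k => ?_⟩
  have hmin0 : ∀ n, 0 ≤ ∫ ω, min ((ξ n ω - θ) ^ 2) 1 ∂P := fun n =>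
    integral_nonneg fun ω => by positivity
  obtain ⟨n, hn0, hn1, hn⟩ : ∃ n, N₀ ≤ n ∧ n < N₁ ∧ ∫ ω, min ((ξ n ω - θ) ^ 2) 1 ∂P ≤ δ := by
    by_contra! hcon
    have h1 := h.sum_integral_min_le hα hγ.pos hν h0 N₁
    have h2 : 0 ≤ ∫ ω, (ξ N₁ ω - θ) ^ 2 ∂P := integral_nonneg fun ω => sq_nonneg _
    have h3 : ∑ k ∈ Finset.range N₁, γ (k + 1) ^ 2 ≤ ∑' k, γ (k + 1) ^ 2 :=
      hγ.summable_sq.sum_le_tsum _ fun j _ => sq_nonneg _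
    have h4 : c * (∑ k ∈ Finset.range N₁, γ (k + 1) - ∑ k ∈ Finset.range N₀, γ (k + 1)) ≤
        ∑ k ∈ Finset.range N₁, 2 * γ (k + 1) * (1 - α)⁻¹ *
          (m * ∫ ω, min ((ξ k ω - θ) ^ 2) 1 ∂P) := by
      rcases le_total N₀ N₁ with h01 | h01
      · rw [← Finset.sum_Ico_eq_sub _ h01, Finset.mul_sum]
        refine (Finset.sum_le_sum fun j hj => ?_).trans (Finset.sum_le_sum_of_subset_of_nonneg
          (s := Finset.Ico N₀ N₁) (fun j hj => ?_) fun j _ _ => ?_)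
        · have h5 := hcon j (Finset.mem_Ico.1 hj).1 (Finset.mem_Ico.1 hj).2
          have h6 := hγ.pos j
          calc c * γ (j + 1) = 2 * γ (j + 1) * (1 - α)⁻¹ * (m * δ) := by rw [hc]; ring
            _ ≤ _ := by gcongr
        · exact Finset.mem_range.2 (Finset.mem_Ico.1 hj).2
        · have h6 := hγ.pos j
          have := hmin0 j
          positivity
      · have h5 : ∑ k ∈ Finset.range N₁, γ (k + 1) ≤ ∑ k ∈ Finset.range N₀, γ (k + 1) :=
          Finset.sum_le_sum_of_subset_of_nonneg
            (fun j hj => Finset.mem_range.2 ((Finset.mem_range.1 hj).trans_le h01))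
            fun j _ _ => (hγ.pos j).le
        refine (mul_nonpos_of_nonneg_of_nonpos hc0.le (by linarith)).trans ?_
        refine Finset.sum_nonneg fun j _ => ?_
        have h6 := hγ.pos j
        have := hmin0 j
        positivity
    have h5 : C₁ < c * (∑ k ∈ Finset.range N₁, γ (k + 1) -
        ∑ k ∈ Finset.range N₀, γ (k + 1)) := by
      rw [← div_lt_iff₀' hc0]; linarith
    have h6 := mul_le_mul_of_nonneg_left h3 (sq_nonneg ((1 - α)⁻¹))
    linarith
  -- The visit time n depends on the run; `max n k` covers a `k` below it, and a later starting time
  -- or an earlier end only enlarges the good event.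
  have h1 := h.integral_one_sub_good_le hα hγ.pos hν h0 hr hr1 (le_max_left n k)
  have h2 := hN₀ n (max n k) hn0
  rw [← Finset.mul_sum] at h2
  have h3 : r ^ 2 * ∫ ω, (1 - good ξ θ r n (max n k) ω) ∂P ≤ r ^ 2 * η := by
    calc _ ≤ 2 * δ + δ := by linarith
      _ = r ^ 2 * η := by rw [hδ]; ring
  have hgi : ∀ n k, Integrable (good ξ θ r n k) P := fun n k =>
    Integrable.of_bound (h.measurable_good θ r n k).aestronglyMeasurable 1
      (Eventually.of_forall fun ω => by
        rw [Real.norm_of_nonneg (good_nonneg _ _ _ _ _ _)]; exact good_le_one _ _ _ _ _ _)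
  refine le_trans (integral_mono ((integrable_const _).fun_sub (hgi _ _))
    ((integrable_const _).fun_sub (hgi n (max n k))) fun ω => ?_)
    (le_of_mul_le_mul_left h3 (by positivity))
  simp only
  have := good_mono (ξ := ξ) (θ := θ) (r := r) (hn1.le.trans hN') (le_max_right n k) ω
  linarith

end


/-! ### Localized rates and martingale remainders -/

/-- Starting at N ≥ 1 keeps away from `γ 0`, whose positivity is not part of `StepSize`: `rate γ₁ β
0` is in fact 0 for β > 0. -/
lemma StepSize.exists_bound_mul {γ : ℕ → ℝ} {κ : ℝ} (hγ : StepSize γ κ) {b : ℕ → ℝ}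
    {a j q B : ℝ} (hpos : 0 < j * a - q * κ) (hb : Tendsto b atTop (𝓝 B)) {N : ℕ} (hN : 1 ≤ N)
    (U : ℝ) :
    ∃ C, 0 ≤ C ∧ ∀ u : ℕ → ℝ, u N ≤ U → (∀ n, N ≤ n →
        u (n + 1) ≤ |1 - a * γ (n + 1)| ^ j * u n + γ (n + 1) * (γ (n + 1) ^ q * b n)) →
      ∀ n, N ≤ n → u n ≤ C * γ n ^ q := by
  obtain ⟨x, hx, hbd⟩ := hγ.exists_bound hpos hb N U
  obtain ⟨C, hC⟩ := hx.bddAbove_range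
  refine ⟨max C 0, le_max_right _ _, fun u h1 h2 n hn => (hbd u h1 h2 n hn).trans ?_⟩
  obtain ⟨k, rfl⟩ : ∃ k, n = k + 1 := ⟨n - 1, by omega⟩
  have h3 : x (k + 1) / γ (k + 1) ^ q ≤ max C 0 := (hC ⟨k + 1, rfl⟩).trans (le_max_left _ _)
  exact (div_le_iff₀ (Real.rpow_pos_of_pos (hγ.pos k) q)).1 h3

section

variable {Ω : Type*} [mΩ : MeasurableSpace Ω] {P : Measure Ω} [IsProbabilityMeasure P]

/-- The solution of `T (n+1) = ρ n T n + e n` started from `T₀` at time `N`. -/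
def recFrom {Ω : Type*} (N : ℕ) (T₀ : Ω → ℝ) (ρ : ℕ → ℝ) (e : ℕ → Ω → ℝ) : ℕ → Ω → ℝ
  | 0, ω => T₀ ω
  | n + 1, ω => if n < N then T₀ ω else ρ n * recFrom N T₀ ρ e n ω + e n ω

section recFrom

variable {Ω : Type*} {N : ℕ} {T₀ : Ω → ℝ} {ρ : ℕ → ℝ} {e : ℕ → Ω → ℝ}

lemma recFrom_self (ω : Ω) : recFrom N T₀ ρ e N ω = T₀ ω := by
  cases N with
  | zero => rfl
  | succ n => simp [recFrom]

lemma recFrom_succ {n : ℕ} (hn : N ≤ n) (ω : Ω) :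
    recFrom N T₀ ρ e (n + 1) ω = ρ n * recFrom N T₀ ρ e n ω + e n ω := by
  simp [recFrom, not_lt.2 hn]

lemma measurable_recFrom [mΩ : MeasurableSpace Ω] {𝓕 : Filtration ℕ mΩ}
    (hT : Measurable[𝓕 N] T₀) (he : ∀ n, Measurable[𝓕 (n + 1)] (e n)) {n : ℕ} (hn : N ≤ n) :
    Measurable[𝓕 n] (recFrom N T₀ ρ e n) := by
  induction n, hn using Nat.le_induction with
  | base => rw [funext recFrom_self]; exact hT
  | succ n hn ih =>
    rw [funext (recFrom_succ hn)]
    exact ((ih.mono (𝓕.mono n.le_succ) le_rfl).const_mul _).add (he n)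

end recFrom

/-- One application of Markov's inequality to 1 - I + |A|/d + B²/d², which is at least 1 on the
event. It mixes the L¹ and L² norms in which the two remainders are controlled. -/
lemma measureReal_lt_le_of_split {Z A B I : Ω → ℝ} (hI : Integrable I P)
    (hI1 : ∀ ω, I ω ≤ 1) (hA : Integrable A P) (hB : MemLp B 2 P)
    (hsplit : ∀ ω, I ω = 0 ∨ |Z ω| ≤ |A ω| + |B ω|) {d : ℝ} (hd : 0 < d) :
    P.real {ω | 2 * d < |Z ω|} ≤
      ∫ ω, (1 - I ω) ∂P + (∫ ω, |A ω| ∂P) / d + (∫ ω, B ω ^ 2 ∂P) / d ^ 2 := by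
  have i1 : Integrable (fun ω => 1 - I ω) P := (integrable_const _).fun_sub hI
  have i2 : Integrable (fun ω => |A ω| / d) P := hA.abs.div_const d
  have i3 : Integrable (fun ω => B ω ^ 2 / d ^ 2) P := hB.integrable_sq.div_const _
  have h1 := mul_meas_ge_le_integral_of_nonneg (μ := P)
    (f := fun ω => 1 - I ω + |A ω| / d + B ω ^ 2 / d ^ 2)
    (Eventually.of_forall fun ω => by
      have h2 := hI1 ω
      have h3 : 0 ≤ |A ω| / d := by positivity
      have h4 : 0 ≤ B ω ^ 2 / d ^ 2 := by positivity
      simp only [Pi.zero_apply]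
      linarith)
    ((i1.fun_add i2).fun_add i3) 1
  rw [one_mul, integral_add (i1.fun_add i2) i3, integral_add i1 i2, integral_div, integral_div] at h1
  refine le_trans (measureReal_mono fun ω hω => ?_) h1
  simp only [mem_ofPred_eq] at hω ⊢
  have h3 : 0 ≤ |A ω| / d := by positivity
  have h4 : 0 ≤ B ω ^ 2 / d ^ 2 := by positivity
  rcases hsplit ω with h | h
  · linarith
  · have h2 := hI1 ω
    rcases le_or_gt d |A ω| with h5 | h5
    · have : 1 ≤ |A ω| / d := (one_le_div hd).2 h5
      linarith
    · have h6 : d ≤ |B ω| := by linarith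
      have : 1 ≤ B ω ^ 2 / d ^ 2 := by
        rw [one_le_div (by positivity), ← sq_abs (B ω)]
        exact pow_le_pow_left₀ hd.le h6 2
      linarith

namespace IsRun

variable {α : ℝ} {γ : ℕ → ℝ} {ν : Measure ℝ} {𝓕 : Filtration ℕ mΩ} {ξ X : ℕ → Ω → ℝ}
  {f : ℝ → ℝ} {M : ℝ≥0} {m θ : ℝ}

lemma integrable_good (h : IsRun P α γ ν 𝓕 ξ X) (θ r : ℝ) (N k : ℕ) :
    Integrable (good ξ θ r N k) P :=
  Integrable.of_bound (h.measurable_good θ r N k).aestronglyMeasurable 1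
    (Eventually.of_forall fun ω => by
      rw [Real.norm_of_nonneg (good_nonneg _ _ _ _ _ _)]; exact good_le_one _ _ _ _ _ _)

lemma integrable_good_mul (h : IsRun P α γ ν 𝓕 ξ X) (θ r : ℝ) (N k : ℕ) {g : Ω → ℝ}
    (hg : Integrable g P) : Integrable (fun ω => good ξ θ r N k ω * g ω) P :=
  integrable_bdd_mul (C := 1) (h.measurable_good θ r N k) (fun ω => by
    rw [abs_of_nonneg (good_nonneg _ _ _ _ _ _)]; exact good_le_one _ _ _ _ _ _) hg

/-- One step of a recursion with a martingale increment. -/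
lemma memLp_mart_step (h : IsRun P α γ ν 𝓕 ξ X) {n : ℕ} {T I : Ω → ℝ} (hTL : MemLp T 2 P)
    (hI : Measurable[𝓕 n] I) {g : ℝ → ℝ → ℝ}
    (hg : Measurable fun p : ℝ × ℝ => g p.1 p.2) {B : ℝ}
    (hB : ∀ ω, |I ω * g (ξ n ω) (X n ω)| ≤ B) (ρ w : ℝ) :
    MemLp (fun ω => ρ * T ω + w * (I ω * g (ξ n ω) (X n ω))) 2 P := by
  have hI' : Measurable I := hI.mono (𝓕.le n) le_rfl
  have hgm : Measurable fun ω => g (ξ n ω) (X n ω) :=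
    hg.comp ((h.measurable_xi n).prodMk (h.measurable n))
  have h1 : MemLp (fun ω => I ω * g (ξ n ω) (X n ω)) 2 P :=
    MemLp.of_bound (hI'.mul hgm).aestronglyMeasurable B (Eventually.of_forall hB)
  exact (hTL.const_mul ρ).add (h1.const_mul w)

/-- The increment has zero mean given the past, so the cross term vanishes and the energies add. -/
lemma integral_mart_step (h : IsRun P α γ ν 𝓕 ξ X) {n : ℕ} {T I : Ω → ℝ}
    (hT : Measurable[𝓕 n] T) (hTL : MemLp T 2 P) (hI : Measurable[𝓕 n] I) {g : ℝ → ℝ → ℝ}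
    (hg : Measurable fun p : ℝ × ℝ => g p.1 p.2) (hg0 : ∀ s, ∫ x, g s x ∂ν = 0) {B : ℝ}
    (hB : ∀ ω, |I ω * g (ξ n ω) (X n ω)| ≤ B) (ρ w : ℝ) :
    ∫ ω, (ρ * T ω + w * (I ω * g (ξ n ω) (X n ω))) ^ 2 ∂P =
      ρ ^ 2 * ∫ ω, T ω ^ 2 ∂P + w ^ 2 * ∫ ω, (I ω * g (ξ n ω) (X n ω)) ^ 2 ∂P := by
  have hI' : Measurable I := hI.mono (𝓕.le n) le_rfl
  have hgm : Measurable fun ω => g (ξ n ω) (X n ω) :=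
    hg.comp ((h.measurable_xi n).prodMk (h.measurable n))
  have hL : MemLp (fun ω => I ω * g (ξ n ω) (X n ω)) 2 P :=
    MemLp.of_bound (hI'.mul hgm).aestronglyMeasurable B (Eventually.of_forall hB)
  have i1 := hTL.integrable_sq.const_mul (ρ ^ 2)
  have i2 : Integrable (fun ω => T ω * I ω * g (ξ n ω) (X n ω)) P := by
    refine ((hTL.integrable (by norm_num)).mul_bdd hL.aestronglyMeasurable
      (Eventually.of_forall hB)).congr (Eventually.of_forall fun ω => ?_)
    simp only
    ring
  have i3 := hL.integrable_sq.const_mul (w ^ 2)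
  have e1 : ∀ ω, (ρ * T ω + w * (I ω * g (ξ n ω) (X n ω))) ^ 2 =
      ρ ^ 2 * T ω ^ 2 + 2 * ρ * w * (T ω * I ω * g (ξ n ω) (X n ω)) +
        w ^ 2 * (I ω * g (ξ n ω) (X n ω)) ^ 2 := fun ω => by ring
  have e2 : ∫ ω, T ω * I ω * g (ξ n ω) (X n ω) ∂P = 0 := by
    have hTI : Measurable[𝓕 n] fun ω => T ω * I ω := hT.mul hI
    rw [h.integral_mul_freeze hTI (h.adapted n) hg i2]
    simp [hg0]
  simp_rw [e1]
  rw [integral_add (i1.fun_add (i2.const_mul _)) i3, integral_add i1 (i2.const_mul _),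
    integral_const_mul, integral_const_mul, integral_const_mul, e2]
  ring

/-- From |z| ≤ s/2 + z²/(2s), with `s` later taken to be √γ_n. -/
lemma integral_good_mul_abs_le (h : IsRun P α γ ν 𝓕 ξ X) (hα : α ∈ Ioo (0 : ℝ) 1)
    (h0 : MemLp (fun ω => ξ 0 ω - θ) 2 P) {r : ℝ} {N n : ℕ} {C s : ℝ} (hs : 0 < s)
    (hC : ∫ ω, good ξ θ r N n ω * (ξ n ω - θ) ^ 2 ∂P ≤ C * s ^ 2) :
    ∫ ω, good ξ θ r N n ω * |ξ n ω - θ| ∂P ≤ (1 + C) / 2 * s := by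
  have hL := h.memLp hα h0 n
  have i1 := h.integrable_good_mul θ r N n (hL.integrable (by norm_num)).abs
  have i2 := h.integrable_good_mul θ r N n hL.integrable_sq
  have h1 : ∫ ω, good ξ θ r N n ω * |ξ n ω - θ| ∂P ≤
      ∫ ω, (s / 2 + (2 * s)⁻¹ * (good ξ θ r N n ω * (ξ n ω - θ) ^ 2)) ∂P := by
    refine integral_mono i1 ((integrable_const _).fun_add (i2.const_mul _)) fun ω => ?_
    simp only
    have h2 : |ξ n ω - θ| ≤ s / 2 + (2 * s)⁻¹ * (ξ n ω - θ) ^ 2 := by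
      rw [← sq_abs (ξ n ω - θ)]
      have : s / 2 + (2 * s)⁻¹ * |ξ n ω - θ| ^ 2 - |ξ n ω - θ| =
          (|ξ n ω - θ| - s) ^ 2 / (2 * s) := by field_simp; ring
      have h3 : 0 ≤ (|ξ n ω - θ| - s) ^ 2 / (2 * s) := by positivity
      linarith
    rcases good_cases ξ θ r N n ω with hc | hc
    · rw [hc.1]; linarith
    · rw [hc.1]; simp; positivity
  rw [integral_add (integrable_const _) (i2.const_mul _), integral_const_mul] at h1
  simp only [integral_const, probReal_univ, smul_eq_mul, one_mul] at h1
  refine h1.trans ?_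
  calc s / 2 + (2 * s)⁻¹ * ∫ ω, good ξ θ r N n ω * (ξ n ω - θ) ^ 2 ∂P
      ≤ s / 2 + (2 * s)⁻¹ * (C * s ^ 2) := by gcongr
    _ = (1 + C) / 2 * s := by field_simp

end IsRun

/-- Localized quadratic convergence rate, uniformly over the laws and the runs. -/
lemma exists_forall_integral_good_mul_sq_le (P : Measure Ω) [IsProbabilityMeasure P] {α : ℝ}
    (hα : α ∈ Ioo (0 : ℝ) 1) {γ : ℕ → ℝ} {κ : ℝ} (hγ : StepSize γ κ) (M : ℝ≥0) (m : ℝ) {b : ℝ}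
    (hb : κ < 2 * b) {r : ℝ} {N : ℕ} (hN : 1 ≤ N) :
    ∃ C, 0 ≤ C ∧ ∀ (ν : Measure ℝ) (f : ℝ → ℝ) (θ : ℝ) (𝓕 : Filtration ℕ mΩ)
      (ξ X : ℕ → Ω → ℝ), QuantileLaw α ν f M m θ → IsRun P α γ ν 𝓕 ξ X →
      MemLp (fun ω => ξ 0 ω - θ) 2 P → b ≤ (1 - α)⁻¹ * (f θ - M * r) → ∀ n, N ≤ n →
      ∫ ω, good ξ θ r N n ω * (ξ n ω - θ) ^ 2 ∂P ≤ C * γ n := by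
  -- Squaring doubles the slope: j = q = 1 with slope 2b requires κ < 2b. At time N the localization
  -- bounds the energy by r².
  obtain ⟨C, hC0, hC⟩ := hγ.exists_bound_mul (a := 2 * b) (j := 1) (q := 1) (by linarith)
    (tendsto_const_nhds (x := (1 - α)⁻¹ ^ 2)) hN (r ^ 2)
  refine ⟨C, hC0, fun ν f θ 𝓕 ξ X hν h h0 hbν => ?_⟩
  have hκ := inv_one_sub_pos hα
  have hz : ∀ k l, Integrable (fun ω => good ξ θ r N k ω * (ξ l ω - θ) ^ 2) P := fun k l =>
    h.integrable_good_mul θ r N k (h.memLp hα h0 l).integrable_sq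
  have := hC (fun n => ∫ ω, good ξ θ r N n ω * (ξ n ω - θ) ^ 2 ∂P) ?_ ?_
  · simpa using this
  · refine (integral_mono (hz N N) (integrable_const (r ^ 2)) fun ω => ?_).trans (by simp)
    simp only
    rcases good_cases ξ θ r N N ω with hc | hc
    · rw [hc.1, one_mul, ← sq_abs]
      exact pow_le_pow_left₀ (abs_nonneg _) (hc.2 N le_rfl le_rfl) 2
    · rw [hc.1, zero_mul]; positivity
  · intro n hn
    have hγn := hγ.pos n
    have h1 := h.integral_sq_step hα hν.toPdfLaw h0 (n := n) (W := good ξ θ r N n)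
      (h.measurable_good_past θ r N n) (good_nonneg _ _ _ _ _) (good_le_one _ _ _ _ _)
    -- The indicator decreases in time, so the one known at time n may be used, and it is measurable
    -- with respect to the past.
    have h2 : ∫ ω, good ξ θ r N (n + 1) ω * (ξ (n + 1) ω - θ) ^ 2 ∂P ≤
        ∫ ω, good ξ θ r N n ω * (ξ (n + 1) ω - θ) ^ 2 ∂P :=
      integral_mono (hz _ _) (hz _ _) fun ω =>
        mul_le_mul_of_nonneg_right (good_mono le_rfl n.le_succ ω) (sq_nonneg _)
    have h3 : (f θ - M * r) * ∫ ω, good ξ θ r N n ω * (ξ n ω - θ) ^ 2 ∂P ≤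
        ∫ ω, good ξ θ r N n ω * ((ξ n ω - θ) * (ν.real (Iic (ξ n ω)) - α)) ∂P := by
      rw [← integral_const_mul]
      refine integral_mono ((hz _ _).const_mul _)
        (h.integrable_good_mul θ r N n (h.integrable_mul_cdf hα hν.toPdfLaw h0 n)) fun ω => ?_
      simp only
      rcases good_cases ξ θ r N n ω with hc | hc
      · rw [hc.1, one_mul, one_mul]
        exact hν.cdf_sub_mul_ge_local (hc.2 n hn le_rfl)
      · rw [hc.1]; simp
    set u := ∫ ω, good ξ θ r N n ω * (ξ n ω - θ) ^ 2 ∂P with hu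
    have hu0 : 0 ≤ u := integral_nonneg fun ω => mul_nonneg (good_nonneg _ _ _ _ _ _) (sq_nonneg _)
    have h4 : b * u ≤ (1 - α)⁻¹ *
        ∫ ω, good ξ θ r N n ω * ((ξ n ω - θ) * (ν.real (Iic (ξ n ω)) - α)) ∂P := by
      calc b * u ≤ (1 - α)⁻¹ * (f θ - M * r) * u := by gcongr
        _ = (1 - α)⁻¹ * ((f θ - M * r) * u) := by ring
        _ ≤ _ := by gcongr
    have h5 : (1 - 2 * b * γ (n + 1)) * u ≤ |1 - 2 * b * γ (n + 1)| ^ (1 : ℝ) * u := by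
      rw [Real.rpow_one]
      exact mul_le_mul_of_nonneg_right (le_abs_self _) hu0
    have h6 := mul_le_mul_of_nonneg_left h4 (show 0 ≤ 2 * γ (n + 1) by positivity)
    rw [Real.rpow_one (γ (n + 1))]
    refine (h2.trans h1).trans ?_
    linarith

end


/-! ### Linearization of the scheme -/

/-- The linear part of the error `ξ n - θ`: the solution of
`L (n+1) = (1 - a γ (n+1)) L n - γ (n+1) H₁(θ, X n)`, `L 0 = 0`. -/
noncomputable def linPart {Ω : Type*} (α : ℝ) (γ : ℕ → ℝ) (a θ : ℝ) (X : ℕ → Ω → ℝ) (n : ℕ)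
    (ω : Ω) : ℝ :=
  -∑ k ∈ Finset.range n, weight γ a n k * H₁ α θ (X k ω)

lemma linPart_succ {Ω : Type*} (α : ℝ) (γ : ℕ → ℝ) (a θ : ℝ) (X : ℕ → Ω → ℝ) (n : ℕ) (ω : Ω) :
    linPart α γ a θ X (n + 1) ω =
      (1 - a * γ (n + 1)) * linPart α γ a θ X n ω - γ (n + 1) * H₁ α θ (X n ω) := by
  unfold linPart
  rw [sum_weight_succ γ a n (fun k c => c * H₁ α θ (X k ω)), mul_neg, Finset.mul_sum]
  simp_rw [mul_assoc]
  ring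

lemma abs_linPart_le {Ω : Type*} {α : ℝ} (hα : α ∈ Ioo (0 : ℝ) 1) (γ : ℕ → ℝ) (a θ : ℝ)
    (X : ℕ → Ω → ℝ) (n : ℕ) (ω : Ω) :
    |linPart α γ a θ X n ω| ≤ ∑ k ∈ Finset.range n, |weight γ a n k| * (1 - α)⁻¹ := by
  unfold linPart
  rw [abs_neg]
  refine (Finset.abs_sum_le_sum_abs _ _).trans (Finset.sum_le_sum fun k _ => ?_)
  rw [abs_mul]
  exact mul_le_mul_of_nonneg_left (abs_H₁_le hα _ _) (abs_nonneg _)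

lemma measurable_H₁_right (α θ : ℝ) : Measurable (H₁ α θ) :=
  (measurable_H₁ α).comp (measurable_const.prodMk measurable_id)

lemma integral_sub_mean_sq_le {ν : Measure ℝ} [IsProbabilityMeasure ν] {Y : ℝ → ℝ}
    (hY : MemLp Y 2 ν) {c : ℝ} (hc : ∫ x, Y x ∂ν = c) :
    ∫ x, (Y x - c) ^ 2 ∂ν ≤ ∫ x, Y x ^ 2 ∂ν := by
  have i1 := hY.integrable_sq
  have i2 : Integrable Y ν := hY.integrable (by norm_num)
  have e : ∀ x, (Y x - c) ^ 2 = Y x ^ 2 - 2 * c * Y x + c ^ 2 := fun x => by ring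
  simp_rw [e]
  rw [integral_add (i1.fun_sub (i2.const_mul _)) (integrable_const _),
    integral_sub i1 (i2.const_mul _), integral_const_mul, hc]
  simp only [integral_const, probReal_univ, smul_eq_mul, one_mul]
  nlinarith [sq_nonneg c]

section

variable {Ω : Type*} [mΩ : MeasurableSpace Ω] {P : Measure Ω} [IsProbabilityMeasure P]

namespace IsRun

variable {α : ℝ} {γ : ℕ → ℝ} {ν : Measure ℝ} {𝓕 : Filtration ℕ mΩ} {ξ X : ℕ → Ω → ℝ}
  {f : ℝ → ℝ} {M : ℝ≥0} {m θ : ℝ}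

lemma measurable_linPart (h : IsRun P α γ ν 𝓕 ξ X) (a θ : ℝ) (n : ℕ) :
    Measurable[𝓕 n] (linPart α γ a θ X n) := by
  induction n with
  | zero =>
    have : linPart α γ a θ X 0 = fun _ => 0 := by ext ω; simp [linPart]
    rw [this]; exact measurable_const
  | succ n ih =>
    rw [funext (linPart_succ α γ a θ X n)]
    exact ((ih.mono (𝓕.mono n.le_succ) le_rfl).const_mul _).sub
      (((measurable_H₁_right α θ).comp (h.meas n)).const_mul _)

/-- The difference between the error and `linPart` solves the same linear recursion, driven by H₁(ξ)
- H₁(θ) - a(ξ - θ). `A` receives the conditional mean: a quadratic Taylor remainder and the slope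
mismatch ε₀, together O(γ) + ε₀ O(√γ) in L¹. `B` receives the centred part, whose conditional
variance is of order |ξ - θ|, hence √γ after localization. Different norms are needed because the
martingale part gains from orthogonality. -/
lemma exists_split (h : IsRun P α γ ν 𝓕 ξ X) (hα : α ∈ Ioo (0 : ℝ) 1)
    (hγ : ∀ n, 0 < γ (n + 1)) (hν : QuantileLaw α ν f M m θ)
    (h0 : MemLp (fun ω => ξ 0 ω - θ) 2 P) {r : ℝ} {N : ℕ} (hN : 1 ≤ N) {C : ℝ}
    (hC : ∀ n, N ≤ n → ∫ ω, good ξ θ r N n ω * (ξ n ω - θ) ^ 2 ∂P ≤ C * γ n) {a ε₀ : ℝ}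
    (ha : |(1 - α)⁻¹ * f θ - a| ≤ ε₀) :
    ∃ A B : ℕ → Ω → ℝ, (∀ n, N ≤ n → Integrable (A n) P ∧ MemLp (B n) 2 P ∧ ∀ ω,
        good ξ θ r N n ω = 0 ∨ |ξ n ω - θ - linPart α γ a θ X n ω| ≤ |A n ω| + |B n ω|) ∧
      ∫ ω, |A N ω| ∂P ≤ |r| + ∑ k ∈ Finset.range N, |weight γ a N k| * (1 - α)⁻¹ ∧
      (∀ n, N ≤ n → ∫ ω, |A (n + 1) ω| ∂P ≤ |1 - a * γ (n + 1)| * ∫ ω, |A n ω| ∂P +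
        γ (n + 1) * ((1 - α)⁻¹ * M * C * γ n + ε₀ * ((1 + C) / 2 * γ n ^ (1 / 2 : ℝ)))) ∧
      ∫ ω, B N ω ^ 2 ∂P ≤ 0 ∧
      (∀ n, N ≤ n → ∫ ω, B (n + 1) ω ^ 2 ∂P ≤ |1 - a * γ (n + 1)| ^ 2 * ∫ ω, B n ω ^ 2 ∂P +
        γ (n + 1) ^ 2 * ((1 - α)⁻¹ ^ 2 * M * ((1 + C) / 2 * γ n ^ (1 / 2 : ℝ)))) := by
  have hκ := inv_one_sub_pos hα
  have hνp := hν.prob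
  set κ := (1 - α)⁻¹ with hκd
  set I : ℕ → Ω → ℝ := good ξ θ r N with hI
  set G : ℝ → ℝ := fun s => κ * (ν.real (Iic s) - α) with hG
  have hGc : Continuous G := continuous_const.mul (hν.continuous_cdf.sub continuous_const)
  have hGb : ∀ s, |G s| ≤ κ := by
    intro s
    have h1 : 0 ≤ ν.real (Iic s) := measureReal_nonneg
    have h2 : ν.real (Iic s) ≤ 1 := measureReal_le_one
    rw [hG, abs_mul, abs_of_pos hκ]
    refine mul_le_of_le_one_right hκ.le ?_
    rw [abs_le]
    constructor <;> linarith [hα.1, hα.2]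
  have hGθ : G θ = 0 := by simp [hG, hν.cdf_eq]
  have hGint : ∀ s, ∫ x, H₁ α s x ∂ν = G s := fun s => hν.integral_H₁ hα s
  have hGlin : ∀ s, |G s - a * (s - θ)| ≤ κ * M * (s - θ) ^ 2 + ε₀ * |s - θ| := by
    intro s
    have h1 := hν.abs_cdf_sub_sub_le θ s
    rw [hν.cdf_eq] at h1
    have h2 : G s - a * (s - θ) = κ * (ν.real (Iic s) - α - f θ * (s - θ)) +
        (κ * f θ - a) * (s - θ) := by simp only [hG]; ring
    rw [h2]
    refine (abs_add_le _ _).trans (add_le_add ?_ ?_)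
    · rw [abs_mul, abs_of_pos hκ, mul_assoc]
      exact mul_le_mul_of_nonneg_left h1 hκ.le
    · rw [abs_mul]
      exact mul_le_mul_of_nonneg_right ha (abs_nonneg _)
  -- Martingale increment: centred under ν for every frozen s, and zero in mean square at s = θ.
  set g : ℝ → ℝ → ℝ := fun s x => H₁ α s x - H₁ α θ x - G s with hg
  have hgm : Measurable fun p : ℝ × ℝ => g p.1 p.2 :=
    ((NestedSA.measurable_H₁ α).sub ((measurable_H₁_right α θ).comp measurable_snd)).sub
      (hGc.measurable.comp measurable_fst)
  have hHL : ∀ s, MemLp (H₁ α s) 2 ν := fun s => MemLp.of_bound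
    (measurable_H₁_right α s).aestronglyMeasurable κ (Eventually.of_forall fun x => abs_H₁_le hα s x)
  have hHi : ∀ s, Integrable (H₁ α s) ν := fun s => (hHL s).integrable (by norm_num)
  have hd : ∀ s, ∫ x, (H₁ α s x - H₁ α θ x) ∂ν = G s := fun s => by
    rw [integral_sub (hHi s) (hHi θ), hGint, hGint, hGθ, sub_zero]
  have hg0 : ∀ s, ∫ x, g s x ∂ν = 0 := fun s => by
    simp only [hg]
    rw [integral_sub ((hHi s).fun_sub (hHi θ)) (integrable_const _), hd]
    simp
  have hg2 : ∀ s, ∫ x, g s x ^ 2 ∂ν ≤ κ ^ 2 * M * |s - θ| := fun s =>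
    (integral_sub_mean_sq_le ((hHL s).sub (hHL θ)) (hd s)).trans
      (hν.integral_H₁_sub_sq α s θ)
  have hgb : ∀ s x, |g s x| ≤ 3 * κ := by
    intro s x
    have h1 := abs_H₁_le hα s x
    have h2 := abs_H₁_le hα θ x
    have h3 := hGb s
    rw [abs_le] at *
    simp only [hg]
    constructor <;> linarith [h1.1, h2.1, h3.1, h1.2, h2.2, h3.2]
  have hI01 : ∀ n ω, I n ω = 0 ∨ I n ω = 1 := fun n ω =>
    (good_cases ξ θ r N n ω).symm.imp And.left And.left
  have hIg : ∀ n ω, |I n ω * g (ξ n ω) (X n ω)| ≤ 3 * κ := by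
    intro n ω
    rcases hI01 n ω with hc | hc
    · rw [hc]; simp; positivity
    · rw [hc, one_mul]; exact hgb _ _
  have hIm : ∀ n, Measurable[𝓕 n] (I n) := fun n => h.measurable_good_past θ r N n
  set ρ : ℕ → ℝ := fun n => 1 - a * γ (n + 1) with hρ
  set D : ℕ → Ω → ℝ := fun n ω => ξ n ω - θ - linPart α γ a θ X n ω with hD
  have hDm : ∀ n, Measurable[𝓕 n] (D n) := fun n =>
    ((h.adapted n).sub_const θ).sub (h.measurable_linPart a θ n)
  -- The indicator `I n` cuts the forcings off after the exit, so `A` and `B` are defined everywhere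
  -- with the right moments while their sum is the true remainder only on the good event.
  set eA : ℕ → Ω → ℝ := fun n ω => -γ (n + 1) * (I n ω * (G (ξ n ω) - a * (ξ n ω - θ))) with heA
  set eB : ℕ → Ω → ℝ := fun n ω => -γ (n + 1) * (I n ω * g (ξ n ω) (X n ω)) with heB
  set A : ℕ → Ω → ℝ := recFrom N (fun ω => I N ω * D N ω) ρ eA with hA
  set B : ℕ → Ω → ℝ := recFrom N (fun _ => 0) ρ eB with hB
  have heBm : ∀ n, Measurable[𝓕 (n + 1)] (eB n) := by
    intro n
    have h1 : Measurable[𝓕 (n + 1)] (I n) := (hIm n).mono (𝓕.mono n.le_succ) le_rfl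
    have h2 : Measurable[𝓕 (n + 1)] (ξ n) := (h.adapted n).mono (𝓕.mono n.le_succ) le_rfl
    exact (h1.mul (hgm.comp (h2.prodMk (h.meas n)))).const_mul _
  have hBm : ∀ n, N ≤ n → Measurable[𝓕 n] (B n) := fun n hn =>
    measurable_recFrom measurable_const heBm hn
  have hBL : ∀ n, N ≤ n → MemLp (B n) 2 P := by
    intro n hn
    induction n, hn using Nat.le_induction with
    | base => rw [hB, funext recFrom_self]; exact memLp_const 0
    | succ n hn ih =>
      rw [hB, funext (recFrom_succ hn)]
      exact h.memLp_mart_step ih (hIm n) hgm (hIg n) _ _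
  have hzL := h.memLp hα h0
  have hDN : ∀ ω, |I N ω * D N ω| ≤ |r| + ∑ k ∈ Finset.range N, |weight γ a N k| * κ := by
    intro ω
    rcases good_cases ξ θ r N N ω with hc | hc
    · have h1 := (hc.2 N le_rfl le_rfl).trans (le_abs_self r)
      have h2 := abs_linPart_le hα γ a θ X N ω
      simp only [hI, hc.1, one_mul, hD]
      exact (abs_sub _ _).trans (add_le_add h1 h2)
    · simp only [hI, hc.1, zero_mul, abs_zero]
      positivity
  have hAerr : ∀ n, Integrable (fun ω => I n ω * (G (ξ n ω) - a * (ξ n ω - θ))) P := by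
    intro n
    refine h.integrable_good_mul θ r N n (Integrable.fun_sub ?_
      (((hzL n).integrable (by norm_num)).const_mul a))
    exact Integrable.of_bound (hGc.measurable.comp (h.measurable_xi n)).aestronglyMeasurable κ
      (Eventually.of_forall fun ω => hGb _)
  have hAi : ∀ n, N ≤ n → Integrable (A n) P := by
    intro n hn
    induction n, hn using Nat.le_induction with
    | base =>
      rw [hA, funext recFrom_self]
      refine Integrable.of_bound ?_ _ (Eventually.of_forall hDN)
      exact (((hIm N).mul (hDm N)).mono (𝓕.le N) le_rfl).aestronglyMeasurable
    | succ n hn ih =>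
      rw [hA, funext (recFrom_succ hn)]
      exact (ih.const_mul _).add ((hAerr n).const_mul _)
  have hsplit : ∀ n, N ≤ n → ∀ ω, I n ω = 0 ∨ D n ω = A n ω + B n ω := by
    intro n hn
    induction n, hn using Nat.le_induction with
    | base =>
      intro ω
      -- At time N the whole remainder is placed in `A`; it is bounded there by r plus the size of
      -- `linPart`.
      rcases hI01 N ω with hc | hc
      · exact Or.inl hc
      · right; rw [hA, hB, recFrom_self, recFrom_self, hc]; ring
    | succ n hn ih =>
      intro ω
      rcases hI01 (n + 1) ω with hc | hc
      · exact Or.inl hc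
      · right
        have h1 : I n ω = 1 := by
          have := good_mono (ξ := ξ) (θ := θ) (r := r) (le_refl N) n.le_succ ω
          rcases hI01 n ω with h2 | h2
          · simp only [hI] at hc h2; linarith
          · exact h2
        have h2 : D n ω = A n ω + B n ω := by
          rcases ih ω with h3 | h3
          · rw [h3] at h1; norm_num at h1
          · exact h3
        rw [hA, hB, recFrom_succ hn, recFrom_succ hn]
        change D (n + 1) ω = ρ n * A n ω + eA n ω + (ρ n * B n ω + eB n ω)
        have h3 : ρ n * A n ω + eA n ω + (ρ n * B n ω + eB n ω) =
            ρ n * D n ω + eA n ω + eB n ω := by rw [h2]; ring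
        rw [h3]
        simp only [heA, heB, h1, hD, hρ, hg, h.step, linPart_succ]
        ring
  have hs : ∀ n, N ≤ n → 0 < γ n ^ (1 / 2 : ℝ) ∧ (γ n ^ (1 / 2 : ℝ)) ^ 2 = γ n := by
    intro n hn
    obtain ⟨k, rfl⟩ : ∃ k, n = k + 1 := ⟨n - 1, by omega⟩
    have := hγ k
    refine ⟨by positivity, ?_⟩
    rw [← Real.rpow_natCast, ← Real.rpow_mul this.le]
    norm_num
  have hIz : ∀ n, N ≤ n → ∫ ω, I n ω * |ξ n ω - θ| ∂P ≤ (1 + C) / 2 * γ n ^ (1 / 2 : ℝ) := by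
    intro n hn
    refine h.integral_good_mul_abs_le hα h0 (hs n hn).1 ?_
    rw [(hs n hn).2]
    exact hC n hn
  have iz : ∀ n, Integrable (fun ω => I n ω * |ξ n ω - θ|) P := fun n =>
    h.integrable_good_mul θ r N n ((hzL n).integrable (by norm_num)).abs
  have iz2 : ∀ n, Integrable (fun ω => I n ω * (ξ n ω - θ) ^ 2) P := fun n =>
    h.integrable_good_mul θ r N n (hzL n).integrable_sq
  refine ⟨A, B, fun n hn => ⟨hAi n hn, hBL n hn, fun ω => ?_⟩, ?_, fun n hn => ?_, ?_,
    fun n hn => ?_⟩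
  · refine (hsplit n hn ω).imp id fun h1 => ?_
    change |D n ω| ≤ _
    rw [h1]; exact abs_add_le _ _
  · rw [hA, funext recFrom_self]
    refine (integral_mono (Integrable.abs ?_) (integrable_const _) hDN).trans (by simp)
    have := hAi N le_rfl
    rwa [hA, funext recFrom_self] at this
  · have h1 : ∀ ω, |A (n + 1) ω| ≤ |1 - a * γ (n + 1)| * |A n ω| +
        γ (n + 1) * (κ * M * (I n ω * (ξ n ω - θ) ^ 2) + ε₀ * (I n ω * |ξ n ω - θ|)) := by
      intro ω
      have h2 : A (n + 1) ω = ρ n * A n ω + eA n ω := recFrom_succ hn ω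
      rw [h2]
      refine (abs_add_le _ _).trans (add_le_add (abs_mul _ _).le ?_)
      simp only [heA]
      rw [abs_mul, abs_neg, abs_of_pos (hγ n)]
      refine mul_le_mul_of_nonneg_left ?_ (hγ n).le
      rcases hI01 n ω with hc | hc
      · rw [hc]; simp
      · rw [hc, one_mul, one_mul, one_mul]; exact hGlin _
    have i1 := (hAi n hn).abs.const_mul |1 - a * γ (n + 1)|
    have i2 := ((iz2 n).const_mul (κ * M)).fun_add ((iz n).const_mul ε₀)
    refine (integral_mono (hAi (n + 1) (by omega)).abs (i1.fun_add (i2.const_mul (γ (n + 1))))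
      h1).trans ?_
    rw [integral_add i1 (i2.const_mul _), integral_const_mul, integral_const_mul,
      integral_add ((iz2 n).const_mul _) ((iz n).const_mul _), integral_const_mul,
      integral_const_mul]
    have hε : 0 ≤ ε₀ := (abs_nonneg _).trans ha
    have h3 := hC n hn
    have h4 := hIz n hn
    have h5 := (hγ n).le
    have h6 : κ * M * ∫ ω, I n ω * (ξ n ω - θ) ^ 2 ∂P ≤ κ * M * C * γ n := by
      rw [mul_assoc (κ * M)]
      exact mul_le_mul_of_nonneg_left h3 (by positivity)
    gcongr
  · rw [hB, funext recFrom_self]; simp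
  · have h1 : ∀ ω, B (n + 1) ω = ρ n * B n ω + -γ (n + 1) * (I n ω * g (ξ n ω) (X n ω)) :=
      fun ω => recFrom_succ hn ω
    simp_rw [h1]
    rw [h.integral_mart_step (hBm n hn) (hBL n hn) (hIm n) hgm hg0 (hIg n), sq_abs, neg_sq]
    refine add_le_add le_rfl (mul_le_mul_of_nonneg_left ?_ (sq_nonneg _))
    have h2 : ∀ ω, (I n ω * g (ξ n ω) (X n ω)) ^ 2 = I n ω * g (ξ n ω) (X n ω) ^ 2 := by
      intro ω; rw [mul_pow, hI, good_sq]
    have i1 : Integrable (fun ω => I n ω * g (ξ n ω) (X n ω) ^ 2) P := by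
      refine h.integrable_good_mul θ r N n (Integrable.of_bound ?_ ((3 * κ) ^ 2)
        (Eventually.of_forall fun ω => ?_))
      · exact ((hgm.comp ((h.measurable_xi n).prodMk (h.measurable n))).pow_const
          2).aestronglyMeasurable
      · rw [norm_pow]; exact pow_le_pow_left₀ (norm_nonneg _) (hgb _ _) 2
    simp_rw [h2]
    rw [h.integral_mul_freeze (g := fun s x => g s x ^ 2) (hIm n) (h.adapted n)
      (hgm.pow_const 2) i1]
    have h3 : ∫ ω, I n ω * ∫ x, g (ξ n ω) x ^ 2 ∂ν ∂P ≤
        ∫ ω, κ ^ 2 * M * (I n ω * |ξ n ω - θ|) ∂P := by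
      refine integral_mono_of_nonneg (Eventually.of_forall fun ω => ?_) ((iz n).const_mul _)
        (Eventually.of_forall fun ω => ?_)
      · exact mul_nonneg (good_nonneg _ _ _ _ _ _) (integral_nonneg fun x => sq_nonneg _)
      · simp only
        rcases hI01 n ω with hc | hc
        · rw [hc]; simp
        · rw [hc, one_mul, one_mul]; exact hg2 _
    refine h3.trans ?_
    rw [integral_const_mul]
    exact mul_le_mul_of_nonneg_left (hIz n hn) (by positivity)

end IsRun

end


/-! ### Uniform linearization in probability -/

section

variable {Ω : Type*} [mΩ : MeasurableSpace Ω]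

/-- Collects, with constants common to all laws whose slope at the quantile is near a, the stability
of the iterates and the localized rate. -/
lemma exists_stable_rate (P : Measure Ω) [IsProbabilityMeasure P] {α : ℝ}
    (hα : α ∈ Ioo (0 : ℝ) 1) {γ : ℕ → ℝ} {κ : ℝ} (hγ : StepSize γ κ) (M : ℝ≥0) {m : ℝ}
    (hm : 0 < m) (C₀ : ℝ) {a : ℝ} (ha : 0 < a) (hκa : κ < 2 * a) {η : ℝ} (hη : 0 < η) :
    ∃ ε₀ > 0, ∃ r > 0, ∃ N, 1 ≤ N ∧ ∃ C, 0 ≤ C ∧ ∀ (ν : Measure ℝ) (f : ℝ → ℝ) (θ : ℝ)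
      (𝓕 : Filtration ℕ mΩ) (ξ X : ℕ → Ω → ℝ), QuantileLaw α ν f M m θ → IsRun P α γ ν 𝓕 ξ X →
      MemLp (fun ω => ξ 0 ω - θ) 2 P → ∫ ω, (ξ 0 ω - θ) ^ 2 ∂P ≤ C₀ →
      |(1 - α)⁻¹ * f θ - a| ≤ ε₀ → (∀ n, ∫ ω, (1 - good ξ θ r N n ω) ∂P ≤ η) ∧
      ∀ n, N ≤ n → ∫ ω, good ξ θ r N n ω * (ξ n ω - θ) ^ 2 ∂P ≤ C * γ n := by
  have hk := inv_one_sub_pos hα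
  set k := (1 - α)⁻¹ with hkd
  -- A slope strictly between κ/2 and a. Half of the gap a - b is left for the variation of the
  -- density over the ball of radius r, the other half for the slope mismatch.
  set b := (a + max (κ / 2) 0) / 2 with hb
  have hmx : max (κ / 2) 0 < a := max_lt (by linarith) ha
  have hba : b < a := by linarith
  have hκb : κ < 2 * b := by linarith [le_max_left (κ / 2) 0]
  set r := min 1 ((a - b) / (2 * k * (M + 1))) with hr
  have hr0 : 0 < r := lt_min one_pos (div_pos (by linarith) (by positivity))
  have hr1 : r ≤ 1 := min_le_left _ _
  have hrM : k * (M * r) ≤ (a - b) / 2 := by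
    have h1 : r ≤ (a - b) / (2 * k * (M + 1)) := min_le_right _ _
    rw [le_div_iff₀ (by positivity)] at h1
    nlinarith [mul_pos hk hr0]
  obtain ⟨N₀, hN₀⟩ := exists_forall_integral_one_sub_good_le P hα hγ M hm C₀ hr0 hr1 hη
  obtain ⟨C, hC0, hC⟩ := exists_forall_integral_good_mul_sq_le P hα hγ M m hκb (r := r)
    (le_max_right N₀ 1)
  refine ⟨(a - b) / 2, by linarith, r, hr0, _, le_max_right N₀ 1, C, hC0,
    fun ν f θ 𝓕 ξ X hν h h0 hC₀ haε => ⟨fun n => hN₀ ν f θ 𝓕 ξ X hν h h0 hC₀ _ (le_max_left _ _) n,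
      hC ν f θ 𝓕 ξ X hν h h0 ?_⟩⟩
  have h1 := (abs_le.1 haε).1
  rw [mul_sub]
  linarith

/-- The error of the scheme agrees with its linear part up to `o(√γ n)` in probability, uniformly
over the laws and the runs. -/
theorem exists_forall_measureReal_sub_linPart_le (P : Measure Ω) [IsProbabilityMeasure P] {α : ℝ}
    (hα : α ∈ Ioo (0 : ℝ) 1) {γ : ℕ → ℝ} {κ : ℝ} (hγ : StepSize γ κ) (M : ℝ≥0) {m : ℝ}
    (hm : 0 < m) (C₀ : ℝ) {a : ℝ} (ha : 0 < a) (hκa : κ < 2 * a) {δ η : ℝ} (hδ : 0 < δ)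
    (hη : 0 < η) :
    ∃ ε₀ > 0, ∃ N₂, ∀ (ν : Measure ℝ) (f : ℝ → ℝ) (θ : ℝ) (𝓕 : Filtration ℕ mΩ)
      (ξ X : ℕ → Ω → ℝ), QuantileLaw α ν f M m θ → IsRun P α γ ν 𝓕 ξ X →
      MemLp (fun ω => ξ 0 ω - θ) 2 P → ∫ ω, (ξ 0 ω - θ) ^ 2 ∂P ≤ C₀ →
      |(1 - α)⁻¹ * f θ - a| ≤ ε₀ → ∀ n, N₂ ≤ n →
      P.real {ω | δ * γ n ^ (1 / 2 : ℝ) < |ξ n ω - θ - linPart α γ a θ X n ω|} ≤ η := by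
  have hk := inv_one_sub_pos hα
  set k := (1 - α)⁻¹ with hkd
  obtain ⟨ε₁, hε₁, r, -, N, hN1, C, hC0, hNC⟩ := exists_stable_rate P hα hγ M hm C₀ ha hκa
    (show 0 < η / 3 by positivity)
  -- Chung's constant for j = 1, q = 1/2, the normalisation of `A` by √γ. The mismatch ε₀ then
  -- contributes at most ηδ/16 to the limit, below the ηδ/6 required.
  set t := a - κ / 2 with ht
  have ht0 : 0 < t := by linarith
  set ε₀ := min ε₁ (η * δ * t / (8 * (1 + C))) with hε
  have hε0 : 0 < ε₀ := lt_min hε₁ (by positivity)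
  -- The forcing involves γ n while Chung's recursion is normalised by γ (n + 1); the ratio corrects
  -- the shift.
  have hq : Tendsto (fun n => (γ n / γ (n + 1)) ^ (1 / 2 : ℝ)) atTop (𝓝 1) := by
    simpa using hγ.tendsto_ratio.rpow_const (p := 1 / 2) (Or.inl one_ne_zero)
  have hs : Tendsto (fun n => γ n ^ (1 / 2 : ℝ)) atTop (𝓝 0) := by
    simpa using hγ.tendsto_zero.rpow_const (p := 1 / 2) (Or.inr (by norm_num))
  obtain ⟨x, hx, hxb⟩ := hγ.exists_bound (a := a) (j := 1) (q := 1 / 2)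
    (b := fun n => (k * M * C * γ n ^ (1 / 2 : ℝ) + ε₀ * ((1 + C) / 2)) *
      (γ n / γ (n + 1)) ^ (1 / 2 : ℝ)) (B := (k * M * C * 0 + ε₀ * ((1 + C) / 2)) * 1)
    (by linarith) (((hs.const_mul _).add_const _).mul hq) N
    (|r| + ∑ i ∈ Finset.range N, |weight γ a N i| * k)
  -- The energy of `B` is normalised by γ itself; its forcing carries an extra √γ, so the limit is
  -- 0.
  obtain ⟨y, hy, hyb⟩ := hγ.exists_bound (a := a) (j := 2) (q := 1)
    (b := fun n => k ^ 2 * M * ((1 + C) / 2 * γ n ^ (1 / 2 : ℝ)))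
    (B := k ^ 2 * M * ((1 + C) / 2 * 0)) (by linarith) ((hs.const_mul _).const_mul _) N 0
  have hγ' : ∀ n, N ≤ n → 0 < γ n := by
    intro n hn
    obtain ⟨j, rfl⟩ : ∃ j, n = j + 1 := ⟨n - 1, by omega⟩
    exact hγ.pos j
  have ex : ∀ᶠ n in atTop, x n / γ n ^ (1 / 2 : ℝ) ≤ η * δ / 6 := by
    have : (k * M * C * 0 + ε₀ * ((1 + C) / 2)) * 1 / (1 * a - 1 / 2 * κ) < η * δ / 6 := by
      have h1 : ε₀ ≤ η * δ * t / (8 * (1 + C)) := min_le_right _ _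
      rw [le_div_iff₀ (by positivity)] at h1
      have h2 : (1 * a - 1 / 2 * κ) = t := by rw [ht]; ring
      rw [h2, div_lt_iff₀ ht0]
      have h3 : 0 < η * δ * t := by positivity
      linarith
    exact (hx.eventually_lt_const this).mono fun n hn => hn.le
  have ey : ∀ᶠ n in atTop, y n / γ n ^ (1 : ℝ) ≤ η * δ ^ 2 / 12 := by
    refine (hy.eventually_lt_const ?_).mono fun n hn => hn.le
    rw [mul_zero, mul_zero, zero_div]
    positivity
  obtain ⟨N₂, hN₂⟩ := eventually_atTop.1 ((ex.and ey).and (eventually_ge_atTop N))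
  refine ⟨ε₀, hε0, N₂, fun ν f θ 𝓕 ξ X hν h h0 hC₀ haε n hn => ?_⟩
  obtain ⟨⟨hxn, hyn⟩, hNn⟩ := hN₂ n hn
  obtain ⟨hgood, hCn⟩ := hNC ν f θ 𝓕 ξ X hν h h0 hC₀ (haε.trans (min_le_left _ _))
  obtain ⟨A, B, hAB, hA0, hA, hB0, hB⟩ := h.exists_split hα hγ.pos hν h0 hN1 hCn haε
  have hAn := hxb (fun n => ∫ ω, |A n ω| ∂P) hA0 (fun i hi => by
    refine (hA i hi).trans (le_of_eq ?_)
    have g0 := hγ' i hi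
    have g1 := hγ.pos i
    have e1 : γ i = γ i ^ (1 / 2 : ℝ) * γ i ^ (1 / 2 : ℝ) := by
      rw [← Real.rpow_add g0]; norm_num
    rw [Real.rpow_one, Real.div_rpow g0.le g1.le]
    have e2 : γ (i + 1) ^ (1 / 2 : ℝ) ≠ 0 := (Real.rpow_pos_of_pos g1 _).ne'
    rw [mul_div_assoc', mul_div_cancel₀ _ e2]
    nth_rw 1 [e1]
    ring) n hNn
  have hBn := hyb (fun n => ∫ ω, B n ω ^ 2 ∂P) hB0 (fun i hi => by
    refine (hB i hi).trans (le_of_eq ?_)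
    rw [Real.rpow_one, Real.rpow_two]
    ring) n hNn
  have g0 := hγ' n hNn
  obtain ⟨hAi, hBi, hspl⟩ := hAB n hNn
  set s := γ n ^ (1 / 2 : ℝ) with hsd
  have hs0 : 0 < s := Real.rpow_pos_of_pos g0 _
  have hss : s ^ 2 = γ n := by
    rw [hsd, ← Real.rpow_natCast, ← Real.rpow_mul g0.le]; norm_num
  -- With threshold δ√γ/2 for each part, the bounds ηδ/6 and ηδ²/12 both become η/3.
  have key := measureReal_lt_le_of_split (h.integrable_good θ r N n) (good_le_one _ _ _ _ _)
    hAi hBi hspl (show 0 < δ * s / 2 by positivity)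
  rw [show 2 * (δ * s / 2) = δ * s by ring] at key
  refine key.trans ?_
  have h1 := hgood n
  have h2 : (∫ ω, |A n ω| ∂P) / (δ * s / 2) ≤ η / 3 := by
    rw [div_le_iff₀ hs0] at hxn
    rw [div_le_iff₀ (by positivity)]
    linarith
  have h3 : (∫ ω, B n ω ^ 2 ∂P) / (δ * s / 2) ^ 2 ≤ η / 3 := by
    rw [Real.rpow_one, div_le_iff₀ g0, ← hss] at hyn
    rw [div_le_iff₀ (by positivity)]
    linarith
  linarith

end


/-! ### The expected shortfall component -/

/-- The integrand `ξ + (1 - α)⁻¹ (x - ξ)⁺` of the objective function. -/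
noncomputable def gain (α ξ x : ℝ) : ℝ := ξ + (1 - α)⁻¹ * max (x - ξ) 0

lemma continuous_gain (α : ℝ) : Continuous fun p : ℝ × ℝ => gain α p.1 p.2 := by
  unfold gain; fun_prop

lemma abs_gain_sub_le {α : ℝ} (hα : α ∈ Ioo (0 : ℝ) 1) (s θ x : ℝ) :
    |gain α s x - gain α θ x| ≤ (1 + (1 - α)⁻¹) * |s - θ| := by
  have hk := inv_one_sub_pos hα
  have e : gain α s x - gain α θ x = (s - θ) + (1 - α)⁻¹ * (max (x - s) 0 - max (x - θ) 0) := by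
    unfold gain; ring
  have h1 : |max (x - s) 0 - max (x - θ) 0| ≤ |s - θ| := by
    refine (abs_max_sub_max_le_abs _ _ _).trans (le_of_eq ?_)
    rw [show x - s - (x - θ) = -(s - θ) by ring, abs_neg]
  rw [e, add_mul, one_mul]
  refine (abs_add_le _ _).trans (add_le_add le_rfl ?_)
  rw [abs_mul, abs_of_pos hk]
  exact mul_le_mul_of_nonneg_left h1 hk.le

lemma integrable_gain {ν : Measure ℝ} [IsFiniteMeasure ν] (h : Integrable (fun x : ℝ => x) ν)
    (α ξ : ℝ) : Integrable (gain α ξ) ν :=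
  (integrable_const ξ).add ((integrable_excess h ξ).const_mul _)

lemma integral_gain {ν : Measure ℝ} [IsProbabilityMeasure ν] (h : Integrable (fun x : ℝ => x) ν)
    (α ξ : ℝ) : ∫ x, gain α ξ x ∂ν = objective α ν ξ := by
  unfold gain objective
  rw [integral_add (integrable_const _) ((integrable_excess h ξ).const_mul _), integral_const_mul]
  simp

section

variable {Ω : Type*} [mΩ : MeasurableSpace Ω]

variable {P : Measure Ω} [IsProbabilityMeasure P]

/-- A crude bound, used for the finitely many terms before the localization starts; it follows from
boundedness of the mean square error. -/
lemma IsRun.integral_abs_gain_sub_le {α : ℝ} {γ : ℕ → ℝ} {ν : Measure ℝ} {𝓕 : Filtration ℕ mΩ}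
    {ξ X : ℕ → Ω → ℝ} {f : ℝ → ℝ} {M : ℝ≥0} {m θ : ℝ}
    (h : IsRun P α γ ν 𝓕 ξ X) (hα : α ∈ Ioo (0 : ℝ) 1)
    (hγ : ∀ n, 0 < γ (n + 1)) (hm : 0 < m) (hγ2 : Summable fun n => γ (n + 1) ^ 2)
    (hν : QuantileLaw α ν f M m θ)
    (h0 : MemLp (fun ω => ξ 0 ω - θ) 2 P) {C₀ : ℝ} (hC₀ : ∫ ω, (ξ 0 ω - θ) ^ 2 ∂P ≤ C₀) (n : ℕ) :
    Integrable (fun ω => gain α (ξ n ω) (X n ω) - gain α θ (X n ω)) P ∧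
    ∫ ω, |gain α (ξ n ω) (X n ω) - gain α θ (X n ω)| ∂P ≤
      (1 + (1 - α)⁻¹) * (1 + (C₀ + (1 - α)⁻¹ ^ 2 * ∑' k, γ (k + 1) ^ 2)) := by
  have hk := inv_one_sub_pos hα
  have hz := h.memLp hα h0 n
  have iz := (hz.integrable (by norm_num)).abs
  have hm1 : Measurable fun ω => gain α (ξ n ω) (X n ω) - gain α θ (X n ω) :=
    ((continuous_gain α).measurable.comp ((h.measurable_xi n).prodMk (h.measurable n))).sub
      ((continuous_gain α).measurable.comp (measurable_const.prodMk (h.measurable n)))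
  have hi : Integrable (fun ω => gain α (ξ n ω) (X n ω) - gain α θ (X n ω)) P :=
    (iz.const_mul (1 + (1 - α)⁻¹)).mono' hm1.aestronglyMeasurable
      (Eventually.of_forall fun ω => abs_gain_sub_le hα _ _ _)
  refine ⟨hi, ?_⟩
  have h1 := h.sum_integral_min_le hα hγ hν h0 n
  have h2 : 0 ≤ ∑ k ∈ Finset.range n,
      2 * γ (k + 1) * (1 - α)⁻¹ * (m * ∫ ω, min ((ξ k ω - θ) ^ 2) 1 ∂P) := by
    refine Finset.sum_nonneg fun k _ => ?_
    have h3 : 0 ≤ ∫ ω, min ((ξ k ω - θ) ^ 2) 1 ∂P :=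
      integral_nonneg fun ω => le_min (sq_nonneg _) zero_le_one
    have := hγ k
    positivity
  have h3 : ∑ k ∈ Finset.range n, γ (k + 1) ^ 2 ≤ ∑' k, γ (k + 1) ^ 2 :=
    hγ2.sum_le_tsum _ fun k _ => sq_nonneg _
  have h4 : (1 - α)⁻¹ ^ 2 * ∑ k ∈ Finset.range n, γ (k + 1) ^ 2 ≤
      (1 - α)⁻¹ ^ 2 * ∑' k, γ (k + 1) ^ 2 := by gcongr
  calc ∫ ω, |gain α (ξ n ω) (X n ω) - gain α θ (X n ω)| ∂P
      ≤ ∫ ω, (1 + (1 - α)⁻¹) * (1 + (ξ n ω - θ) ^ 2) ∂P := by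
        refine integral_mono hi.abs (((integrable_const _).add hz.integrable_sq).const_mul _)
          fun ω => ?_
        refine (abs_gain_sub_le hα _ _ _).trans (mul_le_mul_of_nonneg_left ?_ (by positivity))
        rw [← sq_abs (ξ n ω - θ)]
        nlinarith [sq_nonneg (|ξ n ω - θ| - 1), abs_nonneg (ξ n ω - θ)]
    _ ≤ _ := by
        rw [integral_const_mul, integral_add (integrable_const _) hz.integrable_sq]
        simp only [integral_const, probReal_univ, smul_eq_mul, one_mul]
        refine mul_le_mul_of_nonneg_left ?_ (by positivity)
        linarith

/-- Replacing the iterates by the quantile changes the average of the gains by `o(1/√n)` in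
probability, uniformly over the laws and the runs. -/
theorem exists_forall_measureReal_sum_gain_le (P : Measure Ω) [IsProbabilityMeasure P] {α : ℝ}
    (hα : α ∈ Ioo (0 : ℝ) 1) {γ : ℕ → ℝ} {κ : ℝ} (hγ : StepSize γ κ)
    (hγs : Tendsto (fun n : ℕ => √(n + 1 : ℝ) * γ n) atTop (𝓝 0)) (M : ℝ≥0) {m : ℝ}
    (hm : 0 < m) (C₀ : ℝ) {a : ℝ} (ha : 0 < a) (hκa : κ < 2 * a) {δ η : ℝ} (hδ : 0 < δ)
    (hη : 0 < η) :
    ∃ ε₀ > 0, ∃ N₂ : ℕ, ∀ (ν : Measure ℝ) (f : ℝ → ℝ) (θ : ℝ) (𝓕 : Filtration ℕ mΩ)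
      (ξ X : ℕ → Ω → ℝ), QuantileLaw α ν f M m θ → IsRun P α γ ν 𝓕 ξ X →
      MemLp (fun ω => ξ 0 ω - θ) 2 P → ∫ ω, (ξ 0 ω - θ) ^ 2 ∂P ≤ C₀ →
      |(1 - α)⁻¹ * f θ - a| ≤ ε₀ → ∀ n, N₂ ≤ n →
      P.real {ω | δ * √(n : ℝ) < |∑ k ∈ Finset.range n,
        (gain α (ξ k ω) (X k ω) - gain α θ (X k ω))|} ≤ η := by
  have hk := inv_one_sub_pos hα
  obtain ⟨ε₀, hε₀, r, hr, N, hN1, C, hC0, hNC⟩ := exists_stable_rate P hα hγ M hm C₀ ha hκa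
    (show 0 < η / 3 by positivity)
  set κ' := (1 - α)⁻¹ with hκ'
  set L := 1 + κ' with hL
  have hL0 : 0 < L := by positivity
  set C₁ := L * (1 + (C₀ + κ' ^ 2 * ∑' k, γ (k + 1) ^ 2)) with hC₁
  -- This sum bounds both the accumulated drift and the energy of the martingale part. It is o(√n),
  -- hence negligible against √n for the first and against n for the second.
  set S : ℕ → ℝ := fun n => ∑ k ∈ Finset.Ico N n, γ k with hS
  have hsq : Tendsto (fun n : ℕ => √(n : ℝ)) atTop atTop :=
    Real.tendsto_sqrt_atTop.comp tendsto_natCast_atTop_atTop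
  have hSn : Tendsto (fun n : ℕ => S n / √(n : ℝ)) atTop (𝓝 0) := by
    have h1 := (tendsto_sum_div_sqrt hγs).sub
      (hsq.const_div_atTop (∑ k ∈ Finset.range N, γ k))
    rw [sub_zero] at h1
    refine h1.congr' ?_
    filter_upwards [eventually_ge_atTop N] with n hn
    simp only [hS]
    rw [← sub_div, Finset.sum_Ico_eq_sub _ hn]
  have hlim1 : Tendsto (fun n : ℕ => (N * C₁ + κ' * M * C * S n) / (δ * √(n : ℝ) / 2)) atTop
      (𝓝 0) := by
    have h1 := ((hsq.const_div_atTop (N * C₁)).add (hSn.const_mul (κ' * M * C))).const_mul (2 / δ)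
    simp only [mul_zero, add_zero] at h1
    refine h1.congr fun n => ?_
    field_simp
  have hlim2 : Tendsto (fun n : ℕ => (L ^ 2 * C * S n) / (δ * √(n : ℝ) / 2) ^ 2) atTop (𝓝 0) := by
    have h1 := (hSn.mul (hsq.const_div_atTop (1 : ℝ))).const_mul (L ^ 2 * C * 4 / δ ^ 2)
    simp only [mul_zero] at h1
    refine h1.congr fun n => ?_
    ring
  obtain ⟨N₂, hN₂⟩ := eventually_atTop.1
    (((hlim1.eventually_lt_const (show 0 < η / 3 by positivity)).and
      (hlim2.eventually_lt_const (show 0 < η / 3 by positivity))).and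
      ((eventually_ge_atTop N).and (eventually_ge_atTop 1)))
  refine ⟨ε₀, hε₀, N₂, fun ν f θ 𝓕 ξ X hν h h0 hC₀ haε n hn => ?_⟩
  obtain ⟨⟨hl1, hl2⟩, hNn, h1n⟩ := hN₂ n hn
  obtain ⟨hgood, hrate⟩ := hNC ν f θ 𝓕 ξ X hν h h0 hC₀ haε
  have hνp := hν.prob
  set V := objective α ν with hV
  set D : ℕ → Ω → ℝ := fun k ω => gain α (ξ k ω) (X k ω) - gain α θ (X k ω) with hD
  set I : ℕ → Ω → ℝ := good ξ θ r N with hI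
  have hDi := fun k => h.integral_abs_gain_sub_le hα hγ.pos hm hγ.summable_sq hν h0 hC₀ k
  have hVc : Continuous V :=
    continuous_iff_continuousAt.2 fun x => (hν.hasDerivAt_objective hα x).continuousAt
  set g : ℝ → ℝ → ℝ := fun s x => gain α s x - gain α θ x - (V s - V θ) with hg
  have hgθ : Measurable (gain α θ) :=
    (continuous_gain α).measurable.comp (measurable_const.prodMk measurable_id)
  have hgm : Measurable fun p : ℝ × ℝ => g p.1 p.2 :=
    ((continuous_gain α).measurable.sub (hgθ.comp measurable_snd)).sub
      ((hVc.measurable.comp measurable_fst).sub_const _)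
  have hgi : ∀ s, Integrable (gain α s) ν := fun s => integrable_gain hν.integrable_id α s
  have hgd : ∀ s, ∫ x, (gain α s x - gain α θ x) ∂ν = V s - V θ := fun s => by
    rw [integral_sub (hgi s) (hgi θ), integral_gain hν.integrable_id,
      integral_gain hν.integrable_id]
  have hVd : ∀ s, |V s - V θ| ≤ L * |s - θ| := fun s => by
    rw [← hgd s]
    refine (norm_integral_le_of_norm_le_const (f := fun x => gain α s x - gain α θ x) (C := L * |s - θ|)
      (Eventually.of_forall fun x => abs_gain_sub_le hα s θ x)).trans ?_
    simp
  have hg0 : ∀ s, ∫ x, g s x ∂ν = 0 := fun s => by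
    simp only [hg]
    rw [integral_sub ((hgi s).fun_sub (hgi θ)) (integrable_const _), hgd]
    simp
  have hgL : ∀ s, MemLp (fun x => gain α s x - gain α θ x) 2 ν := fun s =>
    MemLp.of_bound ((hgi s).fun_sub (hgi θ)).aestronglyMeasurable (L * |s - θ|)
      (Eventually.of_forall fun x => abs_gain_sub_le hα s θ x)
  -- The gain is Lipschitz in its first argument, so here the variance is of second order, unlike
  -- for `H₁`.
  have hg2 : ∀ s, ∫ x, g s x ^ 2 ∂ν ≤ L ^ 2 * (s - θ) ^ 2 := fun s => by
    refine (integral_sub_mean_sq_le (hgL s) (hgd s)).trans ?_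
    refine (integral_mono (hgL s).integrable_sq (integrable_const (L ^ 2 * (s - θ) ^ 2))
      fun x => ?_).trans (by simp)
    rw [← sq_abs (gain α s x - gain α θ x), ← sq_abs (s - θ), ← mul_pow]
    exact pow_le_pow_left₀ (abs_nonneg _) (abs_gain_sub_le hα s θ x) 2
  have hI01 : ∀ k ω, I k ω = 0 ∨ I k ω = 1 := fun k ω =>
    (good_cases ξ θ r N k ω).symm.imp And.left And.left
  have hIg : ∀ k, N ≤ k → ∀ ω, |I k ω * g (ξ k ω) (X k ω)| ≤ 2 * L * r := by
    intro k hk ω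
    rcases good_cases ξ θ r N k ω with hc | hc
    · simp only [hI, hc.1, one_mul, hg]
      have h1 := hc.2 k hk le_rfl
      have h2 := abs_gain_sub_le hα (ξ k ω) θ (X k ω)
      have h3 := hVd (ξ k ω)
      refine (abs_sub _ _).trans ?_
      nlinarith
    · simp only [hI, hc.1, zero_mul, abs_zero]; positivity
  have hIm : ∀ k, Measurable[𝓕 k] (I k) := fun k => h.measurable_good_past θ r N k
  have hzL := h.memLp hα h0
  have iz2 : ∀ k, Integrable (fun ω => I k ω * (ξ k ω - θ) ^ 2) P := fun k =>
    h.integrable_good_mul θ r N k (hzL k).integrable_sq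
  set E : ℕ → Ω → ℝ := fun k ω => I k ω * (V (ξ k ω) - V θ) with hE
  have hEi : ∀ k, Integrable (E k) P := fun k => by
    refine h.integrable_good_mul θ r N k
      ((((hzL k).integrable (by norm_num)).abs.const_mul L).mono'
        ((hVc.measurable.comp (h.measurable_xi k)).sub_const _).aestronglyMeasurable
        (Eventually.of_forall fun ω => hVd _))
  -- The drift V(ξ) - V(θ) is quadratic because θ minimises V, so the localized rate bounds it by a
  -- multiple of γ k.
  have hEb : ∀ k, N ≤ k → ∫ ω, |E k ω| ∂P ≤ κ' * M * C * γ k := fun k hk => by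
    refine (integral_mono (hEi k).abs ((iz2 k).const_mul (κ' * M)) fun ω => ?_).trans ?_
    · simp only [hE, abs_mul]
      rw [abs_of_nonneg (good_nonneg _ _ _ _ _ _)]
      have h1 := mul_le_mul_of_nonneg_left (hν.objective_bound hα hν.cdf_eq (ξ k ω))
        (good_nonneg ξ θ r N k ω)
      refine h1.trans (le_of_eq ?_)
      simp only [hI]; ring
    · rw [integral_const_mul, mul_assoc (κ' * M)]
      exact mul_le_mul_of_nonneg_left (hrate k hk) (by positivity)
  -- `A` holds the terms before N, without localization, and the later drifts; `B` is the localized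
  -- martingale, with multiplier 1.
  set A : Ω → ℝ := fun ω => ∑ k ∈ Finset.range N, |D k ω| + ∑ k ∈ Finset.Ico N n, |E k ω| with hA
  set B : ℕ → Ω → ℝ := recFrom N (fun _ => 0) (fun _ => 1)
    fun k ω => 1 * (I k ω * g (ξ k ω) (X k ω)) with hB
  have hBm : ∀ k, N ≤ k → Measurable[𝓕 k] (B k) := fun k hk =>
    measurable_recFrom measurable_const (fun k => by
      have h1 : Measurable[𝓕 (k + 1)] (I k) := (hIm k).mono (𝓕.mono k.le_succ) le_rfl
      have h2 : Measurable[𝓕 (k + 1)] (ξ k) := (h.adapted k).mono (𝓕.mono k.le_succ) le_rfl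
      exact (h1.mul (hgm.comp (h2.prodMk (h.meas k)))).const_mul _) hk
  have hBL : ∀ k, N ≤ k → MemLp (B k) 2 P ∧
      ∫ ω, B k ω ^ 2 ∂P ≤ L ^ 2 * C * ∑ j ∈ Finset.Ico N k, γ j := by
    intro k hk
    induction k, hk using Nat.le_induction with
    | base => rw [hB, funext recFrom_self]; exact ⟨memLp_const 0, by simp⟩
    | succ k hk ih =>
      rw [hB, funext (recFrom_succ hk)]
      refine ⟨h.memLp_mart_step ih.1 (hIm k) hgm (hIg k hk) _ _, ?_⟩
      rw [h.integral_mart_step (hBm k hk) ih.1 (hIm k) hgm hg0 (hIg k hk), one_pow, one_mul,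
        one_mul, Finset.sum_Ico_succ_top hk, mul_add]
      refine add_le_add ih.2 ?_
      have h2 : ∀ ω, (I k ω * g (ξ k ω) (X k ω)) ^ 2 = I k ω * g (ξ k ω) (X k ω) ^ 2 := by
        intro ω; rw [mul_pow, hI, good_sq]
      have i1 : Integrable (fun ω => I k ω * g (ξ k ω) (X k ω) ^ 2) P := by
        simp_rw [← h2]
        refine (MemLp.of_bound ?_ _ (Eventually.of_forall (hIg k hk))).integrable_sq
        exact (((hIm k).mono (𝓕.le k) le_rfl).mul
          (hgm.comp ((h.measurable_xi k).prodMk (h.measurable k)))).aestronglyMeasurable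
      simp_rw [h2]
      rw [h.integral_mul_freeze (g := fun s x => g s x ^ 2) (hIm k) (h.adapted k)
        (hgm.pow_const 2) i1, mul_assoc]
      refine le_trans ?_ (mul_le_mul_of_nonneg_left (hrate k hk) (sq_nonneg L))
      rw [← integral_const_mul]
      refine integral_mono_of_nonneg (Eventually.of_forall fun ω => ?_) ((iz2 k).const_mul _)
        (Eventually.of_forall fun ω => ?_)
      · exact mul_nonneg (good_nonneg _ _ _ _ _ _) (integral_nonneg fun x => sq_nonneg _)
      · simp only
        have := mul_le_mul_of_nonneg_left (hg2 (ξ k ω)) (good_nonneg ξ θ r N k ω)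
        simp only [hI]
        linarith
  have hDE : ∀ k, N ≤ k → ∀ ω, good ξ θ r N k ω = 1 →
      ∑ j ∈ Finset.Ico N k, D j ω = ∑ j ∈ Finset.Ico N k, E j ω + B k ω := by
    intro k hk
    induction k, hk using Nat.le_induction with
    | base => intro ω _; simp [hB, recFrom_self]
    | succ k hk ih =>
      intro ω hω
      have h1 : I k ω = 1 := by
        have := good_mono (ξ := ξ) (θ := θ) (r := r) (le_refl N) k.le_succ ω
        rcases hI01 k ω with h2 | h2
        · simp only [hI] at h2; linarith
        · exact h2
      rw [Finset.sum_Ico_succ_top hk, Finset.sum_Ico_succ_top hk, ih ω h1, hB, recFrom_succ hk]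
      simp only [hE, hD, hg, h1]
      ring
  have hAi : Integrable A P := (integrable_finsetSum _ fun k _ => (hDi k).1.abs).add
    (integrable_finsetSum _ fun k _ => (hEi k).abs)
  have hA0 : ∀ ω, 0 ≤ A ω := fun ω => by positivity
  have hAb : ∫ ω, |A ω| ∂P ≤ N * C₁ + κ' * M * C * S n := by
    simp_rw [abs_of_nonneg (hA0 _)]
    simp only [hA]
    rw [integral_add (integrable_finsetSum _ fun k _ => (hDi k).1.abs)
      (integrable_finsetSum _ fun k _ => (hEi k).abs),
      integral_finsetSum _ fun k _ => (hDi k).1.abs, integral_finsetSum _ fun k _ => (hEi k).abs]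
    refine add_le_add ?_ ?_
    · refine (Finset.sum_le_card_nsmul _ _ C₁ fun k _ => (hDi k).2).trans (by simp)
    · rw [hS, Finset.mul_sum]
      exact Finset.sum_le_sum fun k hk => hEb k (Finset.mem_Ico.1 hk).1
  have hsplit : ∀ ω, good ξ θ r N n ω = 0 ∨
      |∑ k ∈ Finset.range n, D k ω| ≤ |A ω| + |B n ω| := by
    intro ω
    rcases hI01 n ω with hc | hc
    · exact Or.inl hc
    · right
      rw [← Finset.sum_range_add_sum_Ico _ hNn, hDE n hNn ω hc, ← add_assoc,
        abs_of_nonneg (hA0 ω)]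
      refine (abs_add_le _ _).trans (add_le_add ((abs_add_le _ _).trans (add_le_add ?_ ?_)) le_rfl)
      · exact Finset.abs_sum_le_sum_abs _ _
      · exact Finset.abs_sum_le_sum_abs _ _
  have hn0 : 0 < √(n : ℝ) := Real.sqrt_pos.2 (by exact_mod_cast h1n)
  have key := measureReal_lt_le_of_split (h.integrable_good θ r N n) (good_le_one _ _ _ _ _)
    hAi (hBL n hNn).1 hsplit (show 0 < δ * √(n : ℝ) / 2 by positivity)
  rw [show 2 * (δ * √(n : ℝ) / 2) = δ * √(n : ℝ) by ring] at key
  refine key.trans ?_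
  have h1 := hgood n
  have h2 : (∫ ω, |A ω| ∂P) / (δ * √(n : ℝ) / 2) ≤ η / 3 :=
    (div_le_div_of_nonneg_right hAb (by positivity)).trans hl1.le
  have h3 : (∫ ω, B n ω ^ 2 ∂P) / (δ * √(n : ℝ) / 2) ^ 2 ≤ η / 3 :=
    (div_le_div_of_nonneg_right (hBL n hNn).2 (by positivity)).trans hl2.le
  linarith

end


/-! ### The nested stochastic approximation scheme as a run -/

section

variable {Ω : Type*} [mΩ : MeasurableSpace Ω]

/-- The filtration generated by an initial value and the successive innovations. -/
def pastFiltration {ξ₀ : Ω → ℝ} {X : ℕ → Ω → ℝ} (hξ : Measurable ξ₀) (hX : ∀ n, Measurable (X n)) :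
    Filtration ℕ mΩ where
  seq n := MeasurableSpace.comap (fun ω => (ξ₀ ω, fun i : Finset.range n => X i ω)) inferInstance
  mono' n k hnk := by
    have h1 : (fun ω => (ξ₀ ω, fun i : Finset.range n => X i ω)) =
        (fun p : ℝ × (Finset.range k → ℝ) => (p.1, fun i : Finset.range n =>
          p.2 ⟨i, Finset.range_mono hnk i.2⟩)) ∘ fun ω => (ξ₀ ω, fun i : Finset.range k => X i ω) :=
      rfl
    simp only
    rw [h1, ← MeasurableSpace.comap_comp]
    refine MeasurableSpace.comap_mono (Measurable.comap_le ?_)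
    fun_prop
  le' n := Measurable.comap_le (by fun_prop)

/-- The joint law of the three variables is a triple product, which may be reassociated. -/
lemma indepFun_prodMk_of_indepFun {P : Measure Ω} [IsProbabilityMeasure P] {A B C : Type*}
    [MeasurableSpace A] [MeasurableSpace B] [MeasurableSpace C] {U : Ω → A} {S : Ω → B} {T : Ω → C}
    (hU : Measurable U) (hS : Measurable S) (hT : Measurable T) (hST : IndepFun S T P)
    (hUST : IndepFun U (fun ω => (S ω, T ω)) P) : IndepFun (fun ω => (U ω, S ω)) T P := by
  have hUS : IndepFun U S P := hUST.comp measurable_id measurable_fst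
  have p1 := Measure.isProbabilityMeasure_map (μ := P) hU.aemeasurable
  have p2 := Measure.isProbabilityMeasure_map (μ := P) hS.aemeasurable
  have p3 := Measure.isProbabilityMeasure_map (μ := P) hT.aemeasurable
  rw [indepFun_iff_map_prod_eq_prod_map_map (by fun_prop) (by fun_prop)] at *
  rw [hUS, ← MeasurableEquiv.prodAssoc.map_measurableEquiv_injective.eq_iff,
    Measure.prodAssoc_prod, ← hST, ← hUST, Measure.map_map (by fun_prop) (by fun_prop)]
  rfl

lemma innovations_pastFiltration {P : Measure Ω} [IsProbabilityMeasure P] {ξ₀ : Ω → ℝ}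
    {X : ℕ → Ω → ℝ} (hξ : Measurable ξ₀) (hX : ∀ n, Measurable (X n)) {ν : Measure ℝ}
    (hlaw : ∀ n, P.map (X n) = ν) (hind : iIndepFun X P)
    (hξX : IndepFun ξ₀ (fun ω n => X n ω) P) :
    Innovations P ν (pastFiltration hξ hX) X where
  meas n := by
    refine Measurable.of_comap_le ?_
    have h1 : X n = (fun p : ℝ × (Finset.range (n + 1) → ℝ) => p.2 ⟨n, by simp⟩) ∘
        fun ω => (ξ₀ ω, fun i : Finset.range (n + 1) => X i ω) := rfl
    rw [h1, ← MeasurableSpace.comap_comp]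
    exact MeasurableSpace.comap_mono (Measurable.comap_le (by fun_prop))
  law := hlaw
  indep n := by
    refine indepFun_prodMk_of_indepFun hξ (by fun_prop) (hX n) ?_ ?_
    · exact (hind.indepFun_finset (Finset.range n) {n} (by simp) hX).comp measurable_id
        (φ := id) (ψ := fun p : ({n} : Finset ℕ) → ℝ => p ⟨n, by simp⟩) (by fun_prop)
    · exact hξX.comp (φ := id) (ψ := fun p : ℕ → ℝ => ((fun i : Finset.range n => p i), p n))
        measurable_id (by fun_prop)

lemma isRun_nsa {P : Measure Ω} [IsProbabilityMeasure P] {ξ₀ : Ω → ℝ}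
    {X : ℕ → Ω → ℝ} (hξ : Measurable ξ₀) (hX : ∀ n, Measurable (X n)) {ν : Measure ℝ}
    (hlaw : ∀ n, P.map (X n) = ν) (hind : iIndepFun X P)
    (hξX : IndepFun ξ₀ (fun ω n => X n ω) P) (α γ₁ β : ℝ) :
    IsRun P α (rate γ₁ β) ν (pastFiltration hξ hX)
      (fun n ω => (nsa α γ₁ β (ξ₀ ω) (fun n => X n ω) n).1) X where
  toInnovations := innovations_pastFiltration hξ hX hlaw hind hξX
  meas_zero := by
    refine Measurable.of_comap_le ?_
    change MeasurableSpace.comap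
      (Prod.fst ∘ fun ω => (ξ₀ ω, fun i : Finset.range 0 => X i ω)) _ ≤ _
    rw [← MeasurableSpace.comap_comp]
    exact MeasurableSpace.comap_mono (Measurable.comap_le (by fun_prop))
  step n ω := by simp [nsa]

/-- The step 1/(n+1) makes χ the running average of the gains along the iterates, whatever its
initial value. -/
lemma natCast_mul_nsa_snd (α γ₁ β ξ₀ : ℝ) (x : ℕ → ℝ) (n : ℕ) :
    (n : ℝ) * (nsa α γ₁ β ξ₀ x n).2 =
      ∑ k ∈ Finset.range n, gain α (nsa α γ₁ β ξ₀ x k).1 (x k) := by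
  induction n with
  | zero => simp
  | succ n ih =>
    rw [Finset.sum_range_succ, ← ih]
    have : (n : ℝ) + 1 ≠ 0 := by positivity
    simp only [nsa, H₂, gain]
    push_cast
    field_simp
    ring

lemma measurable_nsa {ξ₀ : Ω → ℝ} {X : ℕ → Ω → ℝ} (hξ : Measurable ξ₀)
    (hX : ∀ n, Measurable (X n)) (α γ₁ β : ℝ) (n : ℕ) :
    Measurable fun ω => nsa α γ₁ β (ξ₀ ω) (fun n => X n ω) n := by
  induction n with
  | zero => simp only [nsa]; fun_prop
  | succ n ih =>
    simp only [nsa]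
    have h1 : Measurable fun ω =>
        H₁ α (nsa α γ₁ β (ξ₀ ω) (fun n => X n ω) n).1 (X n ω) :=
      (measurable_H₁ α).comp (ih.fst.prodMk (hX n))
    have h2 := hX n
    unfold H₂
    fun_prop

end


/-! ### Moments of the losses -/

section

variable {Ω : Type*} [mΩ : MeasurableSpace Ω] {P : Measure Ω} [IsProbabilityMeasure P] {d q : ℕ}
  {Y : Ω → Fin d → ℝ} {Z : Ω → Fin q → ℝ} {φ : (Fin d → ℝ) × (Fin q → ℝ) → ℝ}

lemma measurable_innerMean (hφ : Measurable φ) (K : ℕ) :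
    Measurable fun p : (Fin d → ℝ) × (Fin K → Fin q → ℝ) => innerMean φ K p.1 p.2 := by
  unfold innerMean
  exact (Finset.measurable_fun_sum _ fun k _ =>
    hφ.comp (measurable_fst.prodMk ((measurable_pi_apply k).comp measurable_snd))).const_mul _

/-- Convexity of the power function applied to the average. -/
lemma abs_innerMean_rpow_le {p : ℝ} (hp : 1 ≤ p) {K : ℕ} (hK : 0 < K) (y : Fin d → ℝ)
    (z : Fin K → Fin q → ℝ) :
    |innerMean φ K y z| ^ p ≤ ∑ k, 1 / (K : ℝ) * |φ (y, z k)| ^ p := by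
  have hK' : (0 : ℝ) < K := by exact_mod_cast hK
  refine le_trans (Real.rpow_le_rpow (abs_nonneg _) ?_ (by linarith))
    (Real.rpow_arith_mean_le_arith_mean_rpow _ (fun _ => 1 / (K : ℝ)) (fun k => |φ (y, z k)|)
    (fun _ _ => by positivity) (by simp [hK'.ne']) (fun _ _ => abs_nonneg _) hp)
  unfold innerMean
  rw [abs_mul, abs_of_pos (show 0 < 1 / (K : ℝ) by positivity), ← Finset.mul_sum]
  exact mul_le_mul_of_nonneg_left (Finset.abs_sum_le_sum_abs _ _) (by positivity)

lemma isProbabilityMeasure_lossLaw (hY : Measurable Y) (hZ : Measurable Z) (hφ : Measurable φ)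
    (h : ℝ) : IsProbabilityMeasure (lossLaw P Y Z φ h) := by
  have p1 := Measure.isProbabilityMeasure_map (μ := P) hY.aemeasurable
  have p2 := Measure.isProbabilityMeasure_map (μ := P) hZ.aemeasurable
  unfold lossLaw
  split_ifs
  · exact Measure.isProbabilityMeasure_map
      (stronglyMeasurable_condExp.mono hY.comap_le).measurable.aemeasurable
  · exact Measure.isProbabilityMeasure_map (measurable_innerMean hφ _).aemeasurable

/-- Averaging does not increase moments: conditional Jensen for h = 0, and for h = 1/K the power
mean inequality, every pair (Y, Z⁽ᵏ⁾) having the law of (Y, Z). -/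
lemma lossLaw_moment (hY : Measurable Y) (hZ : Measurable Z) (hYZ : IndepFun Y Z P)
    (hφ : Measurable φ) {p : ℝ} (hp : 1 ≤ p)
    (hint : Integrable (fun ω => |φ (Y ω, Z ω)| ^ p) P) {h : ℝ} (hh : h ∈ insert 0 biasSet) :
    Integrable (fun x => |x| ^ p) (lossLaw P Y Z φ h) ∧
      ∫ x, |x| ^ p ∂(lossLaw P Y Z φ h) ≤ ∫ ω, |φ (Y ω, Z ω)| ^ p ∂P := by
  have p1 := Measure.isProbabilityMeasure_map (μ := P) hY.aemeasurable
  have p2 := Measure.isProbabilityMeasure_map (μ := P) hZ.aemeasurable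
  have hm : Measurable fun x : ℝ => |x| ^ p := by fun_prop
  rcases hh with rfl | ⟨K, hK, rfl⟩
  · have hcm : Measurable (P[fun ω => φ (Y ω, Z ω) | MeasurableSpace.comap Y inferInstance]) :=
      (stronglyMeasurable_condExp.mono hY.comap_le).measurable
    have h1 := Integrable.norm_condExp_rpow_le (m := MeasurableSpace.comap Y inferInstance)
      (μ := P) (f := fun ω => φ (Y ω, Z ω)) hp hint
    simp only [lossLaw, if_true]
    rw [integrable_map_measure hm.aestronglyMeasurable hcm.aemeasurable,
      integral_map hcm.aemeasurable hm.aestronglyMeasurable]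
    have i1 : Integrable (P[fun ω => ‖φ (Y ω, Z ω)‖ ^ p | MeasurableSpace.comap Y inferInstance]) P :=
      integrable_condExp
    have i2 : Integrable ((fun x => |x| ^ p) ∘
        P[fun ω => φ (Y ω, Z ω) | MeasurableSpace.comap Y inferInstance]) P := by
      refine i1.mono' (hm.comp hcm).aestronglyMeasurable ?_
      filter_upwards [h1] with ω hω
      rw [Real.norm_of_nonneg (by simp only [Function.comp]; positivity)]
      exact hω
    refine ⟨i2, (integral_mono_ae i2 i1 h1).trans ?_⟩
    rw [integral_condExp hY.comap_le]
    rfl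
  · have hK' : (K : ℝ) ≠ 0 := by exact_mod_cast hK.ne'
    have hne : 1 / (K : ℝ) ≠ 0 := by positivity
    have hfl : ⌊(1 / (K : ℝ))⁻¹⌋₊ = K := by simp
    simp only [lossLaw, if_neg hne]
    rw [hfl]
    set μ := (P.map Y).prod (Measure.pi fun _ : Fin K => P.map Z) with hμ
    have him := measurable_innerMean hφ K
    rw [integrable_map_measure hm.aestronglyMeasurable him.aemeasurable,
      integral_map him.aemeasurable hm.aestronglyMeasurable]
    have hmp : ∀ k : Fin K, MeasurePreserving (fun p : (Fin d → ℝ) × (Fin K → Fin q → ℝ) =>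
        (p.1, p.2 k)) μ ((P.map Y).prod (P.map Z)) := fun k =>
      (MeasurePreserving.id _).prod (measurePreserving_eval (fun _ : Fin K => P.map Z) k)
    have hφp : Measurable fun x => |φ x| ^ p := hm.comp hφ
    have hlaw : (P.map Y).prod (P.map Z) = P.map fun ω => (Y ω, Z ω) :=
      ((indepFun_iff_map_prod_eq_prod_map_map hY.aemeasurable hZ.aemeasurable).1 hYZ).symm
    have hk : ∀ k : Fin K, Integrable (fun p' : (Fin d → ℝ) × (Fin K → Fin q → ℝ) =>
        |φ (p'.1, p'.2 k)| ^ p) μ ∧ ∫ p' : (Fin d → ℝ) × (Fin K → Fin q → ℝ),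
        |φ (p'.1, p'.2 k)| ^ p ∂μ = ∫ ω, |φ (Y ω, Z ω)| ^ p ∂P := by
      intro k
      constructor
      · have := (hmp k).integrable_comp (g := fun x => |φ x| ^ p) hφp.aestronglyMeasurable
        refine this.2 ?_
        rw [hlaw, integrable_map_measure hφp.aestronglyMeasurable (hY.prodMk hZ).aemeasurable]
        exact hint
      · have h1 := integral_map (μ := μ) (hmp k).measurable.aemeasurable
          (f := fun x => |φ x| ^ p) hφp.aestronglyMeasurable
        rw [(hmp k).map_eq, hlaw, integral_map (hY.prodMk hZ).aemeasurable
          hφp.aestronglyMeasurable] at h1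
        exact h1.symm
    have i1 : Integrable (fun p' : (Fin d → ℝ) × (Fin K → Fin q → ℝ) =>
        ∑ k, 1 / (K : ℝ) * |φ (p'.1, p'.2 k)| ^ p) μ :=
      integrable_finsetSum _ fun k _ => (hk k).1.const_mul _
    have i2 : Integrable ((fun x => |x| ^ p) ∘
        fun p' : (Fin d → ℝ) × (Fin K → Fin q → ℝ) => innerMean φ K p'.1 p'.2) μ := by
      refine i1.mono' (hm.comp him).aestronglyMeasurable (Eventually.of_forall fun p' => ?_)
      rw [Real.norm_of_nonneg (by simp only [Function.comp]; positivity)]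
      exact abs_innerMean_rpow_le hp hK _ _
    refine ⟨i2, (integral_mono i2 i1 fun p' => abs_innerMean_rpow_le hp hK _ _).trans ?_⟩
    rw [integral_finsetSum _ fun k _ => (hk k).1.const_mul _]
    simp_rw [integral_const_mul, (hk _).2]
    simp [hK']

end


/-! ### Convergence of the laws of the losses -/

/-- A sequence of laws with regular densities, converging to `ν₀` with a first order expansion of
the cumulative distribution functions in `1/K`, and with uniformly bounded moments of order `p`. -/
structure LossFamily (α : ℝ) (ν : ℕ → Measure ℝ) (ν₀ : Measure ℝ) (f : ℕ → ℝ → ℝ) (f₀ v : ℝ → ℝ)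
    (M : ℝ≥0) (m p B : ℝ) : Prop where
  pdf : ∀ K, PdfLaw (ν K) (f K) M
  pdf_lim : PdfLaw ν₀ f₀ M
  tendsto_pdf : TendstoLocallyUniformly f f₀ atTop
  pos : 0 < m
  lower : ∀ K x, |x - valueAtRisk α ν₀| ≤ 2 → m ≤ f K x
  tendsto_cdf : Tendsto (fun K : ℕ => (K : ℝ) * ((ν K).real (Iic (valueAtRisk α ν₀)) - α)) atTop
    (𝓝 (v (valueAtRisk α ν₀)))
  tendsto_excess : Tendsto (fun K : ℕ => (K : ℝ) * (meanExcess (ν K) (valueAtRisk α ν₀) -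
    meanExcess ν₀ (valueAtRisk α ν₀))) atTop (𝓝 (-∫ x in Ioi (valueAtRisk α ν₀), v x))
  two_lt : 2 < p
  le_three : p ≤ 3
  moment : ∀ K, Integrable (fun x => |x| ^ p) (ν K) ∧ ∫ x, |x| ^ p ∂(ν K) ≤ B
  moment_lim : Integrable (fun x => |x| ^ p) ν₀

lemma integrable_id_of_rpow {ν : Measure ℝ} [IsProbabilityMeasure ν] {p : ℝ} (hp : 2 ≤ p)
    (h : Integrable (fun x : ℝ => |x| ^ p) ν) : Integrable (fun x : ℝ => x) ν :=
  (memLp_of_integrable_rpow (U := fun x : ℝ => x) measurable_id hp h).integrable (by norm_num)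

/-- Since 1/0 = 0, the index K = 0 stands for the limit law, so uniform assumptions hold for all K
without exception. -/
lemma one_div_mem_insert (K : ℕ) : 1 / (K : ℝ) ∈ insert 0 biasSet := by
  rcases Nat.eq_zero_or_pos K with rfl | hK
  · left; simp
  · exact Or.inr ⟨K, hK, rfl⟩

lemma tendsto_one_div_biasSet : Tendsto (fun K : ℕ => 1 / (K : ℝ)) atTop (𝓝[biasSet] 0) :=
  tendsto_nhdsWithin_iff.2 ⟨tendsto_one_div_atTop_nhds_zero_nat,
    (eventually_gt_atTop 0).mono fun K hK => ⟨K, hK, rfl⟩⟩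

/-- Positivity at a given x comes from the lower bound on a ball large enough to contain x. -/
lemma LossAssumptions.exists_pdfLaw {α : ℝ} {ν : ℝ → Measure ℝ} {f : ℝ → ℝ → ℝ} {v : ℝ → ℝ}
    {w : ℝ → ℝ → ℝ} (h : LossAssumptions α ν f v w) (hprob : ∀ b, IsProbabilityMeasure (ν b))
    (hint : ∀ b ∈ insert 0 biasSet, Integrable (fun x : ℝ => x) (ν b)) :
    ∃ M : ℝ≥0, ∀ b ∈ insert 0 biasSet, PdfLaw (ν b) (f b) M := by
  obtain ⟨M, hM⟩ := h.pdf_bounded_lipschitz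
  refine ⟨M, fun b hb => ⟨hprob b, h.law_eq b hb, fun x => ?_,
    fun x => (le_abs_self _).trans ((hM b hb).1 x), (hM b hb).2, hint b hb⟩⟩
  obtain ⟨c, hc, hcx⟩ := h.pdf_pos (|x - valueAtRisk α (ν 0)| + 1) (by positivity)
  refine hc.trans_le (hcx b hb x ?_)
  rw [Metric.mem_ball, Real.dist_eq]
  linarith

/-- The expansion is read at h = 1/K and θ for the cdf; integrated over (θ, ∞) through the tail
formula, it gives the mean excess. -/
lemma LossAssumptions.exists_lossFamily {α : ℝ} (hα : α ∈ Ioo (0 : ℝ) 1) {ν : ℝ → Measure ℝ}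
    {f : ℝ → ℝ → ℝ} {v : ℝ → ℝ} {w : ℝ → ℝ → ℝ} (h : LossAssumptions α ν f v w)
    (hprob : ∀ b, IsProbabilityMeasure (ν b)) {p B : ℝ} (hp : 2 < p) (hp3 : p ≤ 3)
    (hmom : ∀ b ∈ insert 0 biasSet, Integrable (fun x => |x| ^ p) (ν b) ∧
      ∫ x, |x| ^ p ∂(ν b) ≤ B) :
    ∃ M m, LossFamily α (fun K => ν (1 / K)) (ν 0) (fun K => f (1 / K)) (f 0) v M m p B := by
  obtain ⟨M, hM⟩ := h.exists_pdfLaw hprob fun b hb => integrable_id_of_rpow hp.le (hmom b hb).1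
  have h0 := hM 0 (mem_insert _ _)
  -- Radius 3 covers all points within 2 of θ: distance 1 around the quantile of each law, plus 1
  -- for the displacement of that quantile.
  obtain ⟨m, hm, hmx⟩ := h.pdf_pos 3 (by norm_num)
  set θ := valueAtRisk α (ν 0) with hθ
  have hmin : IsMinOn (objective α (ν 0)) univ θ := (h0.isMinOn_iff hα θ).2 rfl
  have hK := one_div_mem_insert
  refine ⟨M, m, fun K => hM _ (hK K), h0, fun u hu x => ?_, hm, fun K x hx => ?_, ?_, ?_, hp, hp3,
    fun K => hmom _ (hK K), (hmom 0 (mem_insert _ _)).1⟩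
  · obtain ⟨t, ht, h1⟩ := h.tendsto_pdf u hu x
    exact ⟨t, ht, tendsto_one_div_biasSet.eventually h1⟩
  · refine hmx _ (hK K) x ?_
    rw [Metric.mem_ball, Real.dist_eq]
    linarith
  · have h1 := ((h.tendsto_w θ hmin).comp tendsto_one_div_biasSet).const_add (v θ)
    rw [add_zero] at h1
    refine h1.congr' ((eventually_gt_atTop 0).mono fun K hK0 => ?_)
    have h2 := h.expansion (1 / K) ⟨K, hK0, rfl⟩ θ
    rw [h0.cdf_valueAtRisk hα] at h2
    have : (K : ℝ) ≠ 0 := by exact_mod_cast hK0.ne'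
    simp only [Function.comp]
    rw [h2]
    field_simp
  · have h1 := (((h.tendsto_integral_w θ hmin).comp tendsto_one_div_biasSet).const_add
      (∫ x in Ioi θ, v x)).neg
    rw [add_zero] at h1
    refine h1.congr' ((eventually_gt_atTop 0).mono fun K hK0 => ?_)
    have hb : 1 / (K : ℝ) ∈ biasSet := ⟨K, hK0, rfl⟩
    have hKl := hM _ (hK K)
    have pK := hprob (1 / K)
    have p0 := hprob 0
    have hK' : (K : ℝ) ≠ 0 := by exact_mod_cast hK0.ne'
    simp only [Function.comp]
    rw [meanExcess_eq, meanExcess_eq, ← integral_sub (integrableOn_tail hKl.integrable_id θ)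
      (integrableOn_tail h0.integrable_id θ)]
    have h2 : ∀ t, (ν (1 / K)).real (Ioi t) - (ν 0).real (Ioi t) =
        -(1 / (K : ℝ)) * (v t + w t (1 / K)) := fun t => by
      rw [hKl.real_Ioi, h0.real_Ioi]
      linarith [h.expansion _ hb t]
    simp_rw [h2]
    rw [integral_const_mul, integral_add (h.integrable_v θ hmin) (h.integrable_w θ hmin _ hb)]
    field_simp

namespace LossFamily

variable {α : ℝ} {ν : ℕ → Measure ℝ} {ν₀ : Measure ℝ} {f : ℕ → ℝ → ℝ} {f₀ v : ℝ → ℝ}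
    {M : ℝ≥0} {m p B : ℝ}

lemma tendsto_pdf_apply (h : LossFamily α ν ν₀ f f₀ v M m p B) (x : ℝ) :
    Tendsto (fun K => f K x) atTop (𝓝 (f₀ x)) :=
  (tendstoLocallyUniformlyOn_univ.2 h.tendsto_pdf).tendsto_at (mem_univ x)

lemma tendsto_cdf_sub (h : LossFamily α ν ν₀ f f₀ v M m p B) :
    Tendsto (fun K => (ν K).real (Iic (valueAtRisk α ν₀)) - α) atTop (𝓝 0) := by
  have h1 := h.tendsto_cdf.mul tendsto_one_div_atTop_nhds_zero_nat
  rw [mul_zero] at h1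
  refine h1.congr' ((eventually_gt_atTop 0).mono fun K hK0 => ?_)
  have : (K : ℝ) ≠ 0 := by exact_mod_cast hK0.ne'
  field_simp

lemma cdf_sub_ge (h : LossFamily α ν ν₀ f f₀ v M m p B) (K : ℕ) {x y : ℝ} (hxy : x ≤ y)
    (hx : |x - valueAtRisk α ν₀| ≤ 2) (hy : |y - valueAtRisk α ν₀| ≤ 2) :
    m * (y - x) ≤ (ν K).real (Iic y) - (ν K).real (Iic x) := by
  rw [(h.pdf K).cdf_sub]
  have := intervalIntegral.integral_mono_on (f := fun _ => m) (g := f K) (μ := volume) hxy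
    (by simp) ((h.pdf K).lip.continuous.intervalIntegrable _ _) fun t ht => h.lower K t ?_
  · simpa [mul_comm] using this
  · rw [abs_le] at *
    constructor <;> linarith [ht.1, ht.2]

/-- Near θ every cdf grows at rate at least m, so |F_K(θ) - α| < m·e confines the quantile to within
e of θ. -/
lemma tendsto_valueAtRisk (h : LossFamily α ν ν₀ f f₀ v M m p B) (hα : α ∈ Ioo (0 : ℝ) 1) :
    Tendsto (fun K => valueAtRisk α (ν K)) atTop (𝓝 (valueAtRisk α ν₀)) := by
  have hm := h.pos
  set θ := valueAtRisk α ν₀ with hθ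
  rw [Metric.tendsto_atTop']
  intro ε hε
  set e := min (ε / 2) 2 with he
  have he0 : 0 < e := by positivity
  have h1 := h.tendsto_cdf_sub.abs
  rw [abs_zero] at h1
  obtain ⟨N, hN⟩ := eventually_atTop.1 (h1.eventually_lt_const (show 0 < m * e by positivity))
  refine ⟨N, fun K hK => ?_⟩
  have h2 := abs_lt.1 (hN K hK.le)
  have hc := (h.pdf K).cdf_valueAtRisk hα
  have hmono := (h.pdf K).strictMono_cdf
  have he2 : |e| ≤ 2 := by rw [abs_of_pos he0]; exact min_le_right _ _
  have h3 := h.cdf_sub_ge K (x := θ) (y := θ + e) (by linarith) (by simp [hθ])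
    (by rw [add_sub_cancel_left]; exact he2)
  have h4 := h.cdf_sub_ge K (x := θ - e) (y := θ) (by linarith)
    (by rw [sub_sub_cancel_left, abs_neg]; exact he2) (by simp [hθ])
  have h5 : valueAtRisk α (ν K) < θ + e := hmono.lt_iff_lt.1 (by linarith)
  have h6 : θ - e < valueAtRisk α (ν K) := hmono.lt_iff_lt.1 (by linarith)
  rw [Real.dist_eq, abs_lt]
  have : e ≤ ε / 2 := min_le_left _ _
  constructor <;> linarith

lemma tendsto_pdf_valueAtRisk (h : LossFamily α ν ν₀ f f₀ v M m p B) (hα : α ∈ Ioo (0 : ℝ) 1) :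
    Tendsto (fun K => f K (valueAtRisk α (ν K))) atTop (𝓝 (f₀ (valueAtRisk α ν₀))) :=
  h.tendsto_pdf.tendsto_comp h.pdf_lim.lip.continuous.continuousAt (h.tendsto_valueAtRisk hα)

lemma eventually_quantileLaw (h : LossFamily α ν ν₀ f f₀ v M m p B) (hα : α ∈ Ioo (0 : ℝ) 1) :
    ∀ᶠ K in atTop, QuantileLaw α (ν K) (f K) M m (valueAtRisk α (ν K)) := by
  have h1 := (tendsto_iff_dist_tendsto_zero.1 (h.tendsto_valueAtRisk hα)).eventually_lt_const
    (show (0 : ℝ) < 1 by norm_num)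
  filter_upwards [h1] with K hK
  rw [Real.dist_eq] at hK
  refine ⟨h.pdf K, (h.pdf K).cdf_valueAtRisk hα, fun x hx => h.lower K x ?_⟩
  have := abs_add_le (x - valueAtRisk α (ν K)) (valueAtRisk α (ν K) - valueAtRisk α ν₀)
  rw [sub_add_sub_cancel] at this
  linarith

/-- First order expansion of the value-at-risk. -/
lemma tendsto_mul_valueAtRisk_sub (h : LossFamily α ν ν₀ f f₀ v M m p B)
    (hα : α ∈ Ioo (0 : ℝ) 1) :
    Tendsto (fun K : ℕ => (K : ℝ) * (valueAtRisk α (ν K) - valueAtRisk α ν₀)) atTop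
      (𝓝 (-(v (valueAtRisk α ν₀) / f₀ (valueAtRisk α ν₀)))) := by
  set θ := valueAtRisk α ν₀ with hθ
  set t : ℕ → ℝ := fun K => valueAtRisk α (ν K) with ht
  have htθ : Tendsto t atTop (𝓝 θ) := h.tendsto_valueAtRisk hα
  -- Difference quotient of the cdf between the two quantiles; `dslope` covers the case where they
  -- coincide. It converges to f₀(θ) by the uniform Lipschitz bound.
  set s : ℕ → ℝ := fun K => dslope (fun x => (ν K).real (Iic x)) θ (t K) with hs
  have hsf : ∀ K, |s K - f K θ| ≤ M * |t K - θ| := by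
    intro K
    simp only [hs]
    rcases eq_or_ne (t K) θ with he | hne
    · rw [he, dslope_same, ((h.pdf K).hasDerivAt_cdf θ).deriv]; simp
    · have h1 := (h.pdf K).abs_cdf_sub_sub_le θ (t K)
      have h2 : 0 < |t K - θ| := abs_pos.2 (sub_ne_zero.2 hne)
      rw [dslope_of_ne _ hne, slope_def_field]
      have h3 : ((ν K).real (Iic (t K)) - (ν K).real (Iic θ)) / (t K - θ) - f K θ =
          ((ν K).real (Iic (t K)) - (ν K).real (Iic θ) - f K θ * (t K - θ)) / (t K - θ) := by
        field_simp [sub_ne_zero.2 hne]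
      rw [h3, abs_div, div_le_iff₀ h2, mul_assoc, ← sq, sq_abs]
      exact h1
  have hsl : Tendsto s atTop (𝓝 (f₀ θ)) := by
    have h1 : Tendsto (fun K => M * |t K - θ|) atTop (𝓝 0) := by
      simpa using ((htθ.sub_const θ).abs.const_mul (M : ℝ))
    have h2 := (squeeze_zero_norm hsf h1).add (h.tendsto_pdf_apply θ)
    simpa using h2
  have hf0 := h.pdf_lim.pos θ
  have h1 := (h.tendsto_cdf.neg).div hsl hf0.ne'
  rw [neg_div] at h1
  refine h1.congr' ?_
  filter_upwards [hsl.eventually_const_lt hf0] with K hK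
  have h2 : (t K - θ) * s K = α - (ν K).real (Iic θ) := by
    have := sub_smul_dslope (fun x => (ν K).real (Iic x)) θ (t K)
    simp only [smul_eq_mul] at this
    rw [hs, this, (h.pdf K).cdf_valueAtRisk hα]
  simp only [Pi.div_apply]
  rw [div_eq_iff hK.ne', mul_assoc, h2]
  ring

/-- First order expansion of the minimum of the objective function. -/
lemma tendsto_mul_objective_sub (h : LossFamily α ν ν₀ f f₀ v M m p B)
    (hα : α ∈ Ioo (0 : ℝ) 1) :
    Tendsto (fun K : ℕ => (K : ℝ) * (objective α (ν K) (valueAtRisk α (ν K)) -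
      objective α ν₀ (valueAtRisk α ν₀))) atTop
      (𝓝 (-∫ x in Ioi (valueAtRisk α ν₀), v x / (1 - α))) := by
  set θ := valueAtRisk α ν₀ with hθ
  have hk := inv_one_sub_pos hα
  have h1 := h.tendsto_mul_valueAtRisk_sub hα
  have h2 := ((h1.pow 2).mul tendsto_one_div_atTop_nhds_zero_nat).const_mul ((1 - α)⁻¹ * M)
  rw [mul_zero, mul_zero] at h2
  -- Moving the point costs K·O((θ_K - θ)²) = O(1/K), because θ_K minimises the objective of its own
  -- law.
  have h3 : Tendsto (fun K : ℕ => (K : ℝ) * (objective α (ν K) (valueAtRisk α (ν K)) -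
      objective α (ν K) θ)) atTop (𝓝 0) := by
    refine squeeze_zero_norm (fun K => ?_) h2
    have h4 := (h.pdf K).objective_bound hα ((h.pdf K).cdf_valueAtRisk hα) θ
    rw [norm_mul, Real.norm_eq_abs, Real.norm_eq_abs, abs_sub_comm, Nat.abs_cast]
    rcases Nat.eq_zero_or_pos K with rfl | hK
    · simp
    · have hK' : (K : ℝ) ≠ 0 := by exact_mod_cast hK.ne'
      refine (mul_le_mul_of_nonneg_left h4 (Nat.cast_nonneg K)).trans (le_of_eq ?_)
      field_simp
      ring
  have h4 := h3.add (h.tendsto_excess.const_mul (1 - α)⁻¹)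
  have h5 : -∫ x in Ioi θ, v x / (1 - α) = 0 + (1 - α)⁻¹ * -∫ x in Ioi θ, v x := by
    rw [integral_div]; ring
  rw [h5]
  refine h4.congr fun K => ?_
  rw [PdfLaw.objective_eq α (ν K) θ, PdfLaw.objective_eq α ν₀ θ]
  ring

end LossFamily


/-! ### Convergence of integrals and moments of the gain -/

lemma one_add_rpow_le {x p : ℝ} (hx : 0 ≤ x) (hp : 0 ≤ p) : (1 + x) ^ p ≤ 2 ^ p * (1 + x ^ p) := by
  have h1 : 0 ≤ x ^ p := by positivity
  rcases le_total x 1 with h | h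
  · calc (1 + x) ^ p ≤ 2 ^ p := Real.rpow_le_rpow (by positivity) (by linarith) hp
      _ ≤ 2 ^ p * (1 + x ^ p) := le_mul_of_one_le_right (by positivity) (by linarith)
  · calc (1 + x) ^ p ≤ (2 * x) ^ p := Real.rpow_le_rpow (by positivity) (by linarith) hp
      _ = 2 ^ p * x ^ p := Real.mul_rpow (by norm_num) hx
      _ ≤ 2 ^ p * (1 + x ^ p) := by gcongr; linarith

/-- For |x| ≥ R one has x² ≤ R^(2-p)|x|^p: a moment of order above 2 makes functions of quadratic
growth uniformly integrable. -/
lemma abs_setIntegral_compl_Icc_le {ν : Measure ℝ} {ψ : ℝ → ℝ} {C p B R : ℝ}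
    (hp : 2 ≤ p) (hC : 0 ≤ C) (hb : ∀ x, |ψ x| ≤ C * (1 + x ^ 2))
    (hi : Integrable (fun x : ℝ => |x| ^ p) ν) (hB : ∫ x, |x| ^ p ∂ν ≤ B) (hR : 1 ≤ R) :
    |∫ x in (Icc (-R) R)ᶜ, ψ x ∂ν| ≤ 2 * C * R ^ (2 - p) * B := by
  have hR0 : 0 < R := by linarith
  have h1 : ∀ x ∈ (Icc (-R) R)ᶜ, ‖ψ x‖ ≤ 2 * C * R ^ (2 - p) * |x| ^ p := by
    intro x hx
    have hxR : R ≤ |x| := by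
      by_contra hc
      exact hx (abs_le.1 (not_le.1 hc).le)
    have hx0 : 0 < |x| := by linarith
    have h2 : x ^ 2 ≤ R ^ (2 - p) * |x| ^ p := by
      have h3 : |x| ^ p = |x| ^ (p - 2) * x ^ 2 := by
        rw [← sq_abs x, ← Real.rpow_natCast, ← Real.rpow_add hx0]
        congr 1; push_cast; ring
      have h4 : 1 ≤ R ^ (2 - p) * |x| ^ (p - 2) := by
        rw [show 2 - p = -(p - 2) by ring, Real.rpow_neg hR0.le, ← div_eq_inv_mul,
          ← Real.div_rpow hx0.le hR0.le]
        exact Real.one_le_rpow ((one_le_div hR0).2 hxR) (by linarith)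
      rw [h3, ← mul_assoc]
      exact le_mul_of_one_le_left (sq_nonneg _) h4
    have h5 : 1 ≤ x ^ 2 := by rw [← sq_abs]; nlinarith
    calc ‖ψ x‖ ≤ C * (1 + x ^ 2) := hb x
      _ ≤ C * (2 * (R ^ (2 - p) * |x| ^ p)) := by gcongr; linarith
      _ = _ := by ring
  calc |∫ x in (Icc (-R) R)ᶜ, ψ x ∂ν| ≤ ∫ x in (Icc (-R) R)ᶜ, 2 * C * R ^ (2 - p) * |x| ^ p ∂ν := by
        refine norm_integral_le_of_norm_le (f := ψ) (hi.const_mul _).integrableOn ?_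
        exact (ae_restrict_iff' measurableSet_Icc.compl).2 (Eventually.of_forall h1)
    _ ≤ ∫ x, 2 * C * R ^ (2 - p) * |x| ^ p ∂ν := by
        refine setIntegral_le_integral (hi.const_mul _) (Eventually.of_forall fun x => ?_)
        simp only [Pi.zero_apply]
        positivity
    _ = 2 * C * R ^ (2 - p) * ∫ x, |x| ^ p ∂ν := integral_const_mul _ _
    _ ≤ _ := by gcongr

lemma integrable_of_abs_le_sq {ν : Measure ℝ} [IsProbabilityMeasure ν] {ψ : ℝ → ℝ} {C p : ℝ}
    (hp : 2 ≤ p) (hm : Measurable ψ) (hb : ∀ x, |ψ x| ≤ C * (1 + x ^ 2))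
    (hi : Integrable (fun x : ℝ => |x| ^ p) ν) : Integrable ψ ν := by
  have h1 := (memLp_of_integrable_rpow (U := fun x : ℝ => x) measurable_id hp hi).integrable_sq
  exact (((integrable_const (1 : ℝ)).fun_add h1).const_mul C).mono' hm.aestronglyMeasurable
    (Eventually.of_forall hb)

/-- At the quantile `H₁` is a centred and scaled Bernoulli variable of parameter 1 - α: variance
α(1-α) over (1-α)². -/
lemma PdfLaw.integral_H₁_sq {ν : Measure ℝ} {f : ℝ → ℝ} {M : ℝ≥0} {α θ : ℝ} (h : PdfLaw ν f M)
    (hα : α ∈ Ioo (0 : ℝ) 1) (hθ : ν.real (Iic θ) = α) :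
    ∫ x, H₁ α θ x ^ 2 ∂ν = α / (1 - α) := by
  have := h.prob
  have h0 : 1 - α ≠ 0 := by linarith [hα.2]
  have e : ∀ x, H₁ α θ x ^ 2 =
      1 + ((1 - α)⁻¹ ^ 2 - 2 * (1 - α)⁻¹) * (Ici θ).indicator (fun _ => (1 : ℝ)) x := by
    intro x
    rw [H₁_eq_indicator]
    by_cases hx : x ∈ Ici θ
    · rw [indicator_of_mem hx]; ring
    · rw [indicator_of_notMem hx]; ring
  simp_rw [e]
  rw [integral_add (integrable_const _)
    (((integrable_const _).indicator measurableSet_Ici).const_mul _), integral_const_mul,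
    integral_indicator_const _ measurableSet_Ici, h.real_Ici, hθ]
  simp
  field_simp
  ring

/-- The excess vanishes off {x ≥ θ}, so the indicator leaves it unchanged and its mean is (1-α)(V(θ)
- θ). This is the source of the off-diagonal entry of the limit covariance. -/
lemma PdfLaw.integral_H₁_mul_gain {ν : Measure ℝ} {f : ℝ → ℝ} {M : ℝ≥0} {α θ : ℝ}
    (h : PdfLaw ν f M) (hα : α ∈ Ioo (0 : ℝ) 1) (hθ : ν.real (Iic θ) = α) :
    ∫ x, H₁ α θ x * (gain α θ x - objective α ν θ) ∂ν =
      -(α * (1 - α)⁻¹ * (objective α ν θ - θ)) := by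
  have := h.prob
  have h0 : 1 - α ≠ 0 := by linarith [hα.2]
  have e : ∀ x, H₁ α θ x * (gain α θ x - objective α ν θ) =
      (gain α θ x - objective α ν θ) - ((1 - α)⁻¹ * (θ - objective α ν θ) *
        (Ici θ).indicator (fun _ => (1 : ℝ)) x + (1 - α)⁻¹ ^ 2 * max (x - θ) 0) := by
    intro x
    rw [H₁_eq_indicator]
    by_cases hx : x ∈ Ici θ
    · simp only [gain, hx, indicator_of_mem]; ring
    · have : x - θ ≤ 0 := by simp at hx; linarith
      simp [hx, gain, this]
  have i1 := integrable_gain h.integrable_id α θ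
  have i2 : Integrable ((Ici θ).indicator fun _ => (1 : ℝ)) ν :=
    (integrable_const _).indicator measurableSet_Ici
  have i3 := integrable_excess h.integrable_id θ
  simp_rw [e]
  rw [integral_sub (i1.fun_sub (integrable_const _)) ((i2.const_mul _).fun_add (i3.const_mul _)),
    integral_sub i1 (integrable_const _), integral_add (i2.const_mul _) (i3.const_mul _),
    integral_const_mul, integral_const_mul, integral_indicator_const _ measurableSet_Ici,
    h.real_Ici, hθ, integral_gain h.integrable_id]
  have e2 : (1 - α)⁻¹ * ∫ x, max (x - θ) 0 ∂ν = objective α ν θ - θ := by unfold objective; ring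
  rw [sq, mul_assoc _ _ (∫ x, max (x - θ) 0 ∂ν), e2]
  simp
  field_simp
  ring

namespace LossFamily

variable {α : ℝ} {ν : ℕ → Measure ℝ} {ν₀ : Measure ℝ} {f : ℕ → ℝ → ℝ} {f₀ v : ℝ → ℝ}
    {M : ℝ≥0} {m p B : ℝ}

/-- On a compact interval dominated convergence applies to the densities; outside, the uniform
moment of order p > 2 makes the integrals small. -/
lemma tendsto_integral (h : LossFamily α ν ν₀ f f₀ v M m p B) {ψ : ℕ → ℝ → ℝ} {ψ₀ : ℝ → ℝ} {C : ℝ}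
    (hm : ∀ K, Measurable (ψ K)) (hm₀ : Measurable ψ₀) (hb : ∀ K x, |ψ K x| ≤ C * (1 + x ^ 2))
    (hlim : ∀ x, Tendsto (fun K => ψ K x) atTop (𝓝 (ψ₀ x))) :
    Tendsto (fun K => ∫ x, ψ K x ∂(ν K)) atTop (𝓝 (∫ x, ψ₀ x ∂ν₀)) := by
  have hC : 0 ≤ C := by have := (abs_nonneg _).trans (hb 0 0); simpa using this
  have hb₀ : ∀ x, |ψ₀ x| ≤ C * (1 + x ^ 2) := fun x =>
    le_of_tendsto (hlim x).abs (Eventually.of_forall fun K => hb K x)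
  have hp := h.two_lt
  set B' := max B (∫ x, |x| ^ p ∂ν₀) with hB'
  have hint : ∀ K, Integrable (ψ K) (ν K) := fun K => by
    have := (h.pdf K).prob
    exact integrable_of_abs_le_sq hp.le (hm K) (hb K) (h.moment K).1
  have hint₀ : Integrable ψ₀ ν₀ := by
    have := h.pdf_lim.prob
    exact integrable_of_abs_le_sq hp.le hm₀ hb₀ h.moment_lim
  rw [Metric.tendsto_atTop']
  intro ε hε
  have hRl : Tendsto (fun R : ℝ => 2 * C * R ^ (2 - p) * B') atTop (𝓝 0) := by
    have h1 := (tendsto_rpow_neg_atTop (show 0 < p - 2 by linarith)).const_mul (2 * C)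
    have h2 := h1.mul_const B'
    simpa using h2
  obtain ⟨R, hR, hR1⟩ := ((hRl.eventually_lt_const (show 0 < ε / 4 by positivity)).and
    (eventually_ge_atTop 1)).exists
  have hS : Tendsto (fun K => ∫ x in Icc (-R) R, ψ K x ∂(ν K)) atTop
      (𝓝 (∫ x in Icc (-R) R, ψ₀ x ∂ν₀)) := by
    rw [h.pdf_lim.setIntegral_eq _ measurableSet_Icc]
    have e : ∀ K, ∫ x in Icc (-R) R, ψ K x ∂(ν K) = ∫ x in Icc (-R) R, f K x * ψ K x := fun K =>
      (h.pdf K).setIntegral_eq (ψ K) measurableSet_Icc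
    rw [funext e]
    refine tendsto_integral_of_dominated_convergence (fun _ => M * (C * (1 + R ^ 2)))
      (fun K => ?_) (integrable_const _) (fun K => ?_) (Eventually.of_forall fun x => ?_)
    · exact ((h.pdf K).lip.continuous.measurable.mul (hm K)).aestronglyMeasurable
    · refine (ae_restrict_iff' measurableSet_Icc).2 (Eventually.of_forall fun x hx => ?_)
      rw [norm_mul, Real.norm_of_nonneg ((h.pdf K).pos x).le]
      refine mul_le_mul ((h.pdf K).le x) ((hb K x).trans ?_) (norm_nonneg _) M.2
      have : x ^ 2 ≤ R ^ 2 := sq_le_sq' hx.1 hx.2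
      gcongr
    · exact (h.tendsto_pdf_apply x).mul (hlim x)
  obtain ⟨N, hN⟩ := (Metric.tendsto_atTop'.1 hS) (ε / 4) (by positivity)
  refine ⟨N, fun K hK => ?_⟩
  have h1 := hN K hK
  rw [Real.dist_eq] at h1 ⊢
  rw [← integral_add_compl (measurableSet_Icc (a := -R) (b := R)) (hint K),
    ← integral_add_compl (measurableSet_Icc (a := -R) (b := R)) hint₀]
  have h2 := abs_setIntegral_compl_Icc_le hp.le hC (hb K) (h.moment K).1
    ((h.moment K).2.trans (le_max_left B (∫ x, |x| ^ p ∂ν₀))) hR1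
  have h3 := abs_setIntegral_compl_Icc_le hp.le hC hb₀ h.moment_lim
    (le_max_right B (∫ x, |x| ^ p ∂ν₀)) hR1
  rw [abs_lt] at *
  rw [abs_le] at h2 h3
  constructor <;> linarith [h1.1, h1.2, h2.1, h2.2, h3.1, h3.2]

/-- The centred gain at the value-at-risk. -/
noncomputable def _root_.NestedSA.centredGain (α : ℝ) (ν : Measure ℝ) (x : ℝ) : ℝ :=
  gain α (valueAtRisk α ν) x - objective α ν (valueAtRisk α ν)

lemma _root_.NestedSA.measurable_centredGain (α : ℝ) (ν : Measure ℝ) :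
    Measurable (centredGain α ν) := by
  unfold centredGain gain; fun_prop

lemma tendsto_objective (h : LossFamily α ν ν₀ f f₀ v M m p B) (hα : α ∈ Ioo (0 : ℝ) 1) :
    Tendsto (fun K => objective α (ν K) (valueAtRisk α (ν K))) atTop
      (𝓝 (objective α ν₀ (valueAtRisk α ν₀))) := by
  have h1 := (h.tendsto_mul_objective_sub hα).mul tendsto_one_div_atTop_nhds_zero_nat
  rw [mul_zero] at h1
  rw [← tendsto_sub_nhds_zero_iff]
  refine h1.congr' ((eventually_gt_atTop 0).mono fun K hK0 => ?_)
  have : (K : ℝ) ≠ 0 := by exact_mod_cast hK0.ne'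
  field_simp

lemma exists_abs_centredGain_le (h : LossFamily α ν ν₀ f f₀ v M m p B) (hα : α ∈ Ioo (0 : ℝ) 1) :
    ∃ D, 0 ≤ D ∧ ∀ K x, |centredGain α (ν K) x| ≤ D * (1 + |x|) := by
  have hk := inv_one_sub_pos hα
  obtain ⟨D₁, hD₁⟩ := (h.tendsto_valueAtRisk hα).abs.bddAbove_range
  obtain ⟨D₂, hD₂⟩ := (h.tendsto_objective hα).abs.bddAbove_range
  have h1 : ∀ K, |valueAtRisk α (ν K)| ≤ D₁ := fun K => hD₁ ⟨K, rfl⟩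
  have h2 : ∀ K, |objective α (ν K) (valueAtRisk α (ν K))| ≤ D₂ := fun K => hD₂ ⟨K, rfl⟩
  have h10 := (abs_nonneg _).trans (h1 0)
  have h20 := (abs_nonneg _).trans (h2 0)
  refine ⟨D₁ + (1 - α)⁻¹ * (1 + D₁) + D₂, by positivity, fun K x => ?_⟩
  have h3 : |max (x - valueAtRisk α (ν K)) 0| ≤ |x| + D₁ := by
    rw [abs_of_nonneg (le_max_right _ _)]
    refine max_le ?_ (by positivity)
    have := abs_le.1 (h1 K)
    linarith [le_abs_self x]
  have h4 : |centredGain α (ν K) x| ≤ D₁ + (1 - α)⁻¹ * (|x| + D₁) + D₂ := by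
    unfold centredGain gain
    refine (abs_sub _ _).trans (add_le_add ((abs_add_le _ _).trans (add_le_add (h1 K) ?_)) (h2 K))
    rw [abs_mul, abs_of_pos hk]
    exact mul_le_mul_of_nonneg_left h3 hk.le
  refine h4.trans ?_
  have := abs_nonneg x
  nlinarith [mul_nonneg hk.le this, mul_nonneg h10 this, mul_nonneg h20 this,
    mul_nonneg (mul_nonneg hk.le h10) this]

/-- The gain is an affine function of the excess with slope (1-α)⁻¹, hence the divisor (1-α)² under
the variance. -/
lemma tendsto_integral_centredGain_sq (h : LossFamily α ν ν₀ f f₀ v M m p B)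
    (hα : α ∈ Ioo (0 : ℝ) 1) :
    Tendsto (fun K => ∫ x, centredGain α (ν K) x ^ 2 ∂(ν K)) atTop
      (𝓝 (Var[fun x => max (x - valueAtRisk α ν₀) 0; ν₀] / (1 - α) ^ 2)) := by
  have hk := inv_one_sub_pos hα
  have hp0 := h.pdf_lim.prob
  obtain ⟨D, hD0, hD⟩ := h.exists_abs_centredGain_le hα
  have h1 := h.tendsto_integral (ψ := fun K x => centredGain α (ν K) x ^ 2)
    (ψ₀ := fun x => centredGain α ν₀ x ^ 2) (C := 2 * D ^ 2)
    (fun K => (measurable_centredGain α _).pow_const 2) ((measurable_centredGain α _).pow_const 2)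
    (fun K x => ?_) (fun x => ?_)
  · convert h1 using 2
    have e1 : (fun x => max (x - valueAtRisk α ν₀) 0) =
        fun x => (1 - α) * (gain α (valueAtRisk α ν₀) x - valueAtRisk α ν₀) := by
      funext x
      have : 1 - α ≠ 0 := by linarith [hα.2]
      unfold gain
      field_simp
      ring
    have hgm : AEStronglyMeasurable (gain α (valueAtRisk α ν₀)) ν₀ :=
      (integrable_gain h.pdf_lim.integrable_id α _).aestronglyMeasurable
    rw [e1, variance_const_mul, variance_sub_const hgm, mul_div_cancel_left₀ _
      (by have : 1 - α ≠ 0 := by linarith [hα.2]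
          positivity), variance_eq_integral hgm.aemeasurable,
      integral_gain h.pdf_lim.integrable_id]
    rfl
  · rw [abs_of_nonneg (sq_nonneg _), ← sq_abs]
    have h2 := pow_le_pow_left₀ (abs_nonneg _) (hD K x) 2
    refine h2.trans ?_
    rw [mul_pow, mul_comm 2 (D ^ 2), mul_assoc]
    refine mul_le_mul_of_nonneg_left ?_ (sq_nonneg _)
    nlinarith [sq_abs x, sq_nonneg (1 - |x|)]
  · have h2 : Tendsto (fun K => gain α (valueAtRisk α (ν K)) x) atTop
        (𝓝 (gain α (valueAtRisk α ν₀) x)) :=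
      ((continuous_gain α).tendsto (valueAtRisk α ν₀, x)).comp
        ((h.tendsto_valueAtRisk hα).prodMk_nhds tendsto_const_nhds)
    exact (h2.sub (h.tendsto_objective hα)).pow 2

lemma exists_integral_centredGain_rpow_le (h : LossFamily α ν ν₀ f f₀ v M m p B)
    (hα : α ∈ Ioo (0 : ℝ) 1) :
    ∃ D, ∀ K, Integrable (fun x => |centredGain α (ν K) x| ^ p) (ν K) ∧
      ∫ x, |centredGain α (ν K) x| ^ p ∂(ν K) ≤ D := by
  obtain ⟨D, hD0, hD⟩ := h.exists_abs_centredGain_le hα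
  have hp := h.two_lt
  refine ⟨D ^ p * 2 ^ p * (1 + B), fun K => ?_⟩
  have := (h.pdf K).prob
  obtain ⟨i1, i2⟩ := h.moment K
  have hb : ∀ x, |centredGain α (ν K) x| ^ p ≤ D ^ p * 2 ^ p * (1 + |x| ^ p) := fun x => by
    refine (Real.rpow_le_rpow (abs_nonneg _) (hD K x) (by linarith)).trans ?_
    rw [Real.mul_rpow hD0 (by positivity), mul_assoc]
    gcongr
    exact one_add_rpow_le (abs_nonneg x) (by linarith)
  have hm : Measurable fun x => |centredGain α (ν K) x| ^ p := by
    have := measurable_centredGain α (ν K)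
    fun_prop
  have i3 : Integrable (fun x => D ^ p * 2 ^ p * (1 + |x| ^ p)) (ν K) :=
    ((integrable_const _).fun_add i1).const_mul _
  have i4 : Integrable (fun x => |centredGain α (ν K) x| ^ p) (ν K) :=
    i3.mono' hm.aestronglyMeasurable (Eventually.of_forall fun x => by
      rw [Real.norm_of_nonneg (by positivity)]; exact hb x)
  refine ⟨i4, (integral_mono i4 i3 hb).trans ?_⟩
  rw [integral_const_mul, integral_add (integrable_const _) i1]
  simp only [integral_const, probReal_univ, smul_eq_mul, one_mul]
  gcongr

end LossFamily


/-! ### The central limit theorem for the linearized scheme -/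

lemma abs_add_rpow_le (x y : ℝ) {p : ℝ} (hp : 0 ≤ p) :
    |x + y| ^ p ≤ 2 ^ p * (|x| ^ p + |y| ^ p) := by
  have h1 : |x + y| ≤ 2 * max |x| |y| := by
    have := abs_add_le x y
    linarith [le_max_left |x| |y|, le_max_right |x| |y|]
  have hx : 0 ≤ |x| ^ p := by positivity
  have hy : 0 ≤ |y| ^ p := by positivity
  refine (Real.rpow_le_rpow (abs_nonneg _) h1 hp).trans ?_
  rw [Real.mul_rpow (by norm_num) (by positivity)]
  refine mul_le_mul_of_nonneg_left ?_ (by positivity)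
  rcases max_choice |x| |y| with h | h <;> rw [h] <;> linarith

section rates

variable {γ₁ β : ℝ}

lemma tendsto_sq_atTop : Tendsto (fun K : ℕ => K ^ 2) atTop atTop :=
  tendsto_pow_atTop (by norm_num)

lemma rate_sq (γ₁ β : ℝ) (K : ℕ) : rate γ₁ β (K ^ 2) = γ₁ * (K : ℝ) ^ (-(2 * β)) := by
  unfold rate
  push_cast
  rw [← Real.rpow_natCast, ← Real.rpow_mul (Nat.cast_nonneg K)]
  congr 2
  push_cast; ring

lemma tendsto_rpow_mul_sum_weight_sq (hγ₁ : 0 < γ₁) (hβ : β ∈ Ioc (1 / 2 : ℝ) 1) {a : ℝ}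
    (ha : (if β = 1 then γ₁⁻¹ else 0) < 2 * a) :
    Tendsto (fun K : ℕ => (K : ℝ) ^ (2 * β) *
      ∑ k ∈ Finset.range (K ^ 2), weight (rate γ₁ β) a (K ^ 2) k ^ 2) atTop
      (𝓝 (γ₁ / (2 * a - if β = 1 then γ₁⁻¹ else 0))) := by
  have h1 := (((stepSize_rate hγ₁ hβ).tendsto_sum_weight_sq (sub_pos.2 ha)).comp
    tendsto_sq_atTop).const_mul γ₁
  rw [mul_one_div] at h1
  refine h1.congr' ((eventually_gt_atTop 0).mono fun K hK => ?_)
  have hK' : (0 : ℝ) < K := by exact_mod_cast hK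
  simp only [Function.comp]
  rw [rate_sq, Real.rpow_neg hK'.le]
  have := (Real.rpow_pos_of_pos hK' (2 * β)).ne'
  field_simp

lemma tendsto_rpow_sub_one (hβ : β ≤ 1) :
    Tendsto (fun K : ℕ => (K : ℝ) ^ (β - 1)) atTop (𝓝 (if β = 1 then 1 else 0)) := by
  split_ifs with h
  · simp [h]
  · have h1 : 0 < 1 - β := by
      have := lt_of_le_of_ne hβ h
      linarith
    have := (tendsto_rpow_neg_atTop h1).comp (tendsto_natCast_atTop_atTop (R := ℝ))
    rw [neg_sub] at this
    exact this

/-- The covariance of the two components carries K^β · K⁻¹ times the sum of the weights, which is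
why it disappears for β < 1. -/
lemma tendsto_rpow_mul_sum_weight (hγ₁ : 0 < γ₁) (hβ : β ∈ Ioc (1 / 2 : ℝ) 1) {a : ℝ}
    (ha : 0 < a) :
    Tendsto (fun K : ℕ => (K : ℝ) ^ (β - 1) *
      ∑ k ∈ Finset.range (K ^ 2), weight (rate γ₁ β) a (K ^ 2) k) atTop
      (𝓝 ((if β = 1 then 1 else 0) * (1 / a))) := by
  exact (tendsto_rpow_sub_one hβ.2).mul
    (((stepSize_rate hγ₁ hβ).tendsto_sum_weight ha).comp tendsto_sq_atTop)

/-- Lyapunov condition: the sum of the p-th powers is o(γ^(p/2)), and γ^(p/2) at time K² is of order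
K^(-βp). -/
lemma tendsto_rpow_mul_sum_weight_rpow (hγ₁ : 0 < γ₁) (hβ : β ∈ Ioc (1 / 2 : ℝ) 1) {a p : ℝ}
    (hp : 2 < p) (ha : (if β = 1 then γ₁⁻¹ else 0) < 2 * a) :
    Tendsto (fun K : ℕ => (K : ℝ) ^ (β * p) *
      ∑ k ∈ Finset.range (K ^ 2), |weight (rate γ₁ β) a (K ^ 2) k| ^ p) atTop (𝓝 0) := by
  have hγ := stepSize_rate hγ₁ hβ
  have hB : Tendsto (fun n => rate γ₁ β (n + 1) ^ (p - 1 - p / 2)) atTop (𝓝 0) := by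
    have := hγ.tendsto_succ.rpow_const (p := p - 1 - p / 2) (Or.inr (by linarith))
    rwa [Real.zero_rpow (by linarith)] at this
  have h1 := ((hγ.tendsto_sum_weight_rpow (a := a) (j := p) (q := p / 2) (by nlinarith) hB).comp
    tendsto_sq_atTop).const_mul (γ₁ ^ (p / 2))
  rw [zero_div, mul_zero] at h1
  refine h1.congr' ((eventually_gt_atTop 0).mono fun K hK => ?_)
  have hK' : (0 : ℝ) < K := by exact_mod_cast hK
  simp only [Function.comp]
  rw [rate_sq, Real.mul_rpow hγ₁.le (by positivity), ← Real.rpow_mul hK'.le,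
    show -(2 * β) * (p / 2) = -(β * p) by ring, Real.rpow_neg hK'.le]
  have h2 := (Real.rpow_pos_of_pos hK' (β * p)).ne'
  have h3 := (Real.rpow_pos_of_pos hγ₁ (p / 2)).ne'
  field_simp

lemma tendsto_sqrt_mul_rate (hγ₁ : 0 < γ₁) (hβ : β ∈ Ioc (1 / 2 : ℝ) 1) :
    Tendsto (fun n : ℕ => √(n + 1 : ℝ) * rate γ₁ β n) atTop (𝓝 0) := by
  have h1 : Tendsto (fun n : ℕ => (n : ℝ) ^ (-(β - 1 / 2))) atTop (𝓝 0) :=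
    (tendsto_rpow_neg_atTop (by linarith [hβ.1])).comp tendsto_natCast_atTop_atTop
  have h2 := h1.const_mul (√2 * γ₁)
  rw [mul_zero] at h2
  refine squeeze_zero' (Eventually.of_forall fun n => ?_) ?_ h2
  · unfold rate; positivity
  · filter_upwards [eventually_ge_atTop 1] with n hn
    have hn' : (1 : ℝ) ≤ n := by exact_mod_cast hn
    have hn0 : (0 : ℝ) < n := by linarith
    have e : (n : ℝ) ^ (-(β - 1 / 2)) = √n * (n : ℝ) ^ (-β) := by
      rw [Real.sqrt_eq_rpow, ← Real.rpow_add hn0]; congr 1; ring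
    rw [e]
    have h3 : √(n + 1 : ℝ) ≤ √2 * √n := by
      rw [← Real.sqrt_mul (by norm_num)]
      exact Real.sqrt_le_sqrt (by linarith)
    unfold rate
    calc √(n + 1 : ℝ) * (γ₁ * (n : ℝ) ^ (-β)) ≤ √2 * √n * (γ₁ * (n : ℝ) ^ (-β)) := by gcongr
      _ = _ := by ring

end rates

namespace LossFamily

variable {Ω : Type*} [mΩ : MeasurableSpace Ω] {P : Measure Ω} [IsProbabilityMeasure P]
  {α : ℝ} {ν : ℕ → Measure ℝ} {ν₀ : Measure ℝ} {f : ℕ → ℝ → ℝ} {f₀ v : ℝ → ℝ}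
  {M : ℝ≥0} {m p B : ℝ}

/-- Central limit theorem for the two leading terms. Every linear combination is a sum of K²
independent centred functions of the innovations; its variance is computed from the moments of `H₁`
and of the centred gain together with the sums of weights, and its Lyapunov sum tends to 0. -/
theorem tendsto_integral_cexp (h : LossFamily α ν ν₀ f f₀ v M m p B) (hα : α ∈ Ioo (0 : ℝ) 1)
    {γ₁ β a : ℝ} (hγ₁ : 0 < γ₁) (hβ : β ∈ Ioc (1 / 2 : ℝ) 1) (ha : 0 < a)
    (hκa : (if β = 1 then γ₁⁻¹ else 0) < 2 * a) {X : ℕ → ℕ → Ω → ℝ}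
    (hX : ∀ K n, Measurable (X K n))
    (hlaw : ∀ᶠ K in atTop, (∀ n, P.map (X K n) = ν K) ∧ iIndepFun (X K) P) (t₁ t₂ : ℝ) :
    Tendsto (fun K : ℕ => ∫ ω, Complex.exp ((t₁ * ((K : ℝ) ^ β *
        linPart α (rate γ₁ β) a (valueAtRisk α (ν K)) (X K) (K ^ 2) ω) + t₂ * (1 / (K : ℝ) *
          ∑ k ∈ Finset.range (K ^ 2), centredGain α (ν K) (X K k ω)) : ℝ) * Complex.I) ∂P) atTop
      (𝓝 (Real.exp (-((t₁ ^ 2 * (α / (1 - α)) * (γ₁ / (2 * a - if β = 1 then γ₁⁻¹ else 0)) +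
        2 * t₁ * t₂ * (α * (1 - α)⁻¹ * (objective α ν₀ (valueAtRisk α ν₀) - valueAtRisk α ν₀)) *
          ((if β = 1 then 1 else 0) * (1 / a)) +
        t₂ ^ 2 * (Var[fun x => max (x - valueAtRisk α ν₀) 0; ν₀] / (1 - α) ^ 2)) / 2)) : ℝ)) := by
  have hκ := inv_one_sub_pos hα
  have hp := h.two_lt
  set θ : ℕ → ℝ := fun K => valueAtRisk α (ν K) with hθ
  set V : ℕ → ℝ := fun K => objective α (ν K) (θ K) with hV
  set wt : ℕ → ℕ → ℝ := fun K k => weight (rate γ₁ β) a (K ^ 2) k with hwt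
  set c : ℕ → ℝ → ℝ := fun K => centredGain α (ν K) with hc
  set σ : ℕ → ℝ := fun K => ∫ x, c K x ^ 2 ∂(ν K) with hσ
  -- Contribution of the k-th innovation; the minus sign is the one in `linPart`.
  set u : ℕ → ℕ → ℝ → ℝ := fun K k x =>
    (-t₁ * (K : ℝ) ^ β * wt K k) * H₁ α (θ K) x + (t₂ / K) * c K x with hu
  obtain ⟨D, hD⟩ := h.exists_integral_centredGain_rpow_le hα
  have hcm : ∀ K, Measurable (c K) := fun K => measurable_centredGain α (ν K)
  have hHm : ∀ K, Measurable (H₁ α (θ K)) := fun K => measurable_H₁_right α _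
  have hum : ∀ K k, Measurable (u K k) := fun K k =>
    ((hHm K).const_mul _).add ((hcm K).const_mul _)
  have hcdf : ∀ K, (ν K).real (Iic (θ K)) = α := fun K => (h.pdf K).cdf_valueAtRisk hα
  have hsum : ∀ K ω, ∑ k ∈ Finset.range (K ^ 2), u K k (X K k ω) =
      t₁ * ((K : ℝ) ^ β * linPart α (rate γ₁ β) a (θ K) (X K) (K ^ 2) ω) +
        t₂ * (1 / (K : ℝ) * ∑ k ∈ Finset.range (K ^ 2), c K (X K k ω)) := by
    intro K ω
    simp only [hu, linPart, Finset.sum_add_distrib, ← Finset.mul_sum, mul_assoc]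
    ring
  have hcL : ∀ K, MemLp (c K) 2 (ν K) := fun K => by
    have := (h.pdf K).prob
    exact memLp_of_integrable_rpow (hcm K) hp.le (hD K).1
  have hHL : ∀ K, MemLp (H₁ α (θ K)) 2 (ν K) := fun K => by
    have := (h.pdf K).prob
    exact MemLp.of_bound (hHm K).aestronglyMeasurable (1 - α)⁻¹
      (Eventually.of_forall fun x => abs_H₁_le hα _ x)
  have hu0 : ∀ K k, ∫ x, u K k x ∂(ν K) = 0 := by
    intro K k
    have := (h.pdf K).prob
    have i1 := (hHL K).integrable (q := 2) (by norm_num)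
    have i2 := (hcL K).integrable (q := 2) (by norm_num)
    simp only [hu]
    rw [integral_add (i1.const_mul _) (i2.const_mul _), integral_const_mul, integral_const_mul,
      (h.pdf K).integral_H₁ hα, hcdf]
    have : ∫ x, c K x ∂(ν K) = 0 := by
      simp only [hc, centredGain]
      rw [integral_sub (integrable_gain (h.pdf K).integrable_id _ _) (integrable_const _),
        integral_gain (h.pdf K).integrable_id]
      simp
    rw [this]; ring
  have hu2 : ∀ K k, ∫ x, u K k x ^ 2 ∂(ν K) =
      t₁ ^ 2 * (α / (1 - α)) * ((K : ℝ) ^ (2 * β) * wt K k ^ 2) +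
        2 * t₁ * t₂ * (α * (1 - α)⁻¹ * (V K - θ K)) * ((K : ℝ) ^ β / K * wt K k) +
        (t₂ / K) ^ 2 * σ K := by
    intro K k
    have := (h.pdf K).prob
    have e : ∀ x, u K k x ^ 2 = (-t₁ * (K : ℝ) ^ β * wt K k) ^ 2 * H₁ α (θ K) x ^ 2 +
        2 * (-t₁ * (K : ℝ) ^ β * wt K k) * (t₂ / K) * (H₁ α (θ K) x * c K x) +
        (t₂ / K) ^ 2 * c K x ^ 2 := fun x => by simp only [hu]; ring
    have i1 := (hHL K).integrable_sq
    have i2 := (hcL K).integrable_sq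
    have i3 : Integrable (fun x => H₁ α (θ K) x * c K x) (ν K) := (hHL K).integrable_mul (hcL K)
    have e2 : ((K : ℝ) ^ β) ^ 2 = (K : ℝ) ^ (2 * β) := by
      rw [← Real.rpow_natCast, ← Real.rpow_mul (Nat.cast_nonneg K)]; congr 1; push_cast; ring
    simp_rw [e]
    rw [integral_add ((i1.const_mul _).fun_add (i3.const_mul _)) (i2.const_mul _),
      integral_add (i1.const_mul _) (i3.const_mul _), integral_const_mul, integral_const_mul,
      integral_const_mul, (h.pdf K).integral_H₁_sq hα (hcdf K)]
    have e3 : ∫ x, H₁ α (θ K) x * c K x ∂(ν K) = -(α * (1 - α)⁻¹ * (V K - θ K)) :=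
      (h.pdf K).integral_H₁_mul_gain hα (hcdf K)
    rw [e3, ← e2]
    ring
  have hup : ∀ K k, Integrable (fun x => |u K k x| ^ p) (ν K) ∧ ∫ x, |u K k x| ^ p ∂(ν K) ≤
      2 ^ p * (|t₁| ^ p * (1 - α)⁻¹ ^ p * ((K : ℝ) ^ (β * p) * |wt K k| ^ p) +
        |t₂| ^ p * D * ((K : ℝ) ^ p)⁻¹) := by
    intro K k
    have := (h.pdf K).prob
    have hb : ∀ x, |u K k x| ^ p ≤
        2 ^ p * (|t₁| ^ p * (1 - α)⁻¹ ^ p * ((K : ℝ) ^ (β * p) * |wt K k| ^ p) +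
          |t₂| ^ p * ((K : ℝ) ^ p)⁻¹ * |c K x| ^ p) := by
      intro x
      refine (abs_add_rpow_le _ _ (by linarith)).trans ?_
      refine mul_le_mul_of_nonneg_left (add_le_add ?_ (le_of_eq ?_)) (by positivity)
      · rw [abs_mul, abs_mul, abs_mul, abs_neg, abs_of_nonneg (show 0 ≤ (K : ℝ) ^ β by positivity),
          Real.mul_rpow (by positivity) (by positivity), Real.mul_rpow (by positivity)
          (by positivity), Real.mul_rpow (by positivity) (by positivity),
          ← Real.rpow_mul (Nat.cast_nonneg K)]
        have h1 : |H₁ α (θ K) x| ^ p ≤ (1 - α)⁻¹ ^ p :=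
          Real.rpow_le_rpow (abs_nonneg _) (abs_H₁_le hα _ x) (by linarith)
        calc |t₁| ^ p * (K : ℝ) ^ (β * p) * |wt K k| ^ p * |H₁ α (θ K) x| ^ p
            ≤ |t₁| ^ p * (K : ℝ) ^ (β * p) * |wt K k| ^ p * (1 - α)⁻¹ ^ p := by gcongr
          _ = _ := by ring
      · rw [abs_mul, abs_div, Nat.abs_cast, Real.mul_rpow (by positivity) (by positivity),
          Real.div_rpow (by positivity) (by positivity)]
        ring
    have i1 : Integrable (fun x =>
        2 ^ p * (|t₁| ^ p * (1 - α)⁻¹ ^ p * ((K : ℝ) ^ (β * p) * |wt K k| ^ p) +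
          |t₂| ^ p * ((K : ℝ) ^ p)⁻¹ * |c K x| ^ p)) (ν K) :=
      ((integrable_const _).fun_add ((hD K).1.const_mul _)).const_mul _
    have hm1 : Measurable fun x => |u K k x| ^ p := by have := hum K k; fun_prop
    have i2 : Integrable (fun x => |u K k x| ^ p) (ν K) :=
      i1.mono' hm1.aestronglyMeasurable (Eventually.of_forall fun x => by
        rw [Real.norm_of_nonneg (by positivity)]; exact hb x)
    refine ⟨i2, (integral_mono i2 i1 hb).trans ?_⟩
    rw [integral_const_mul, integral_add (integrable_const _) ((hD K).1.const_mul _),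
      integral_const]
    simp only [probReal_univ, smul_eq_mul, one_mul]
    rw [integral_const_mul]
    have h1 : |t₂| ^ p * ((K : ℝ) ^ p)⁻¹ * ∫ x, |c K x| ^ p ∂(ν K) ≤
        |t₂| ^ p * D * ((K : ℝ) ^ p)⁻¹ := by
      rw [mul_right_comm]
      exact mul_le_mul_of_nonneg_right (mul_le_mul_of_nonneg_left (hD K).2 (by positivity))
        (by positivity)
    exact mul_le_mul_of_nonneg_left (add_le_add le_rfl h1) (by positivity)
  set S : ℕ → ℝ := fun K => t₁ ^ 2 * (α / (1 - α)) *
      ((K : ℝ) ^ (2 * β) * ∑ k ∈ Finset.range (K ^ 2), wt K k ^ 2) +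
    2 * t₁ * t₂ * (α * (1 - α)⁻¹ * (V K - θ K)) *
      ((K : ℝ) ^ (β - 1) * ∑ k ∈ Finset.range (K ^ 2), wt K k) + t₂ ^ 2 * σ K with hS
  have hSl := (((tendsto_rpow_mul_sum_weight_sq hγ₁ hβ hκa).const_mul
      (t₁ ^ 2 * (α / (1 - α)))).add
    (((((h.tendsto_objective hα).sub (h.tendsto_valueAtRisk hα)).const_mul
      (α * (1 - α)⁻¹)).const_mul (2 * t₁ * t₂)).mul (tendsto_rpow_mul_sum_weight hγ₁ hβ ha))).add
    ((h.tendsto_integral_centredGain_sq hα).const_mul (t₂ ^ 2))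
  -- Summing K² terms of order K^(-p) for the gain leaves K^(-(p-2)), whence the need for p > 2.
  have hE : Tendsto (fun K : ℕ => 5 * (2 ^ p * (|t₁| ^ p * (1 - α)⁻¹ ^ p *
      ((K : ℝ) ^ (β * p) * ∑ k ∈ Finset.range (K ^ 2), |wt K k| ^ p) +
        |t₂| ^ p * D * (K : ℝ) ^ (-(p - 2))))) atTop (𝓝 0) := by
    have h1 := (tendsto_rpow_neg_atTop (show 0 < p - 2 by linarith)).comp
      (tendsto_natCast_atTop_atTop (R := ℝ))
    have h2 := ((((tendsto_rpow_mul_sum_weight_rpow hγ₁ hβ hp hκa).const_mul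
      (|t₁| ^ p * (1 - α)⁻¹ ^ p)).add (h1.const_mul (|t₂| ^ p * D))).const_mul (2 ^ p)).const_mul 5
    simpa using h2
  have hexp : Tendsto (fun K => ((Real.exp (-(S K / 2)) : ℝ) : ℂ)) atTop (𝓝 _) :=
    (Complex.continuous_ofReal.tendsto _).comp
      ((Real.continuous_exp.tendsto _).comp ((hSl.div_const 2).neg))
  rw [← tendsto_sub_nhds_zero_iff] at hexp
  rw [← tendsto_sub_nhds_zero_iff]
  have hdiff : Tendsto (fun K : ℕ => ∫ ω, Complex.exp ((t₁ * ((K : ℝ) ^ β *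
        linPart α (rate γ₁ β) a (θ K) (X K) (K ^ 2) ω) + t₂ * (1 / (K : ℝ) *
          ∑ k ∈ Finset.range (K ^ 2), c K (X K k ω)) : ℝ) * Complex.I) ∂P -
      ((Real.exp (-(S K / 2)) : ℝ) : ℂ)) atTop (𝓝 0) := by
    refine squeeze_zero_norm' ?_ hE
    filter_upwards [hlaw, eventually_gt_atTop 0] with K ⟨hK, hKi⟩ hK0
    have hK' : (0 : ℝ) < K := by exact_mod_cast hK0
    have hmap : ∀ k (g : ℝ → ℝ), Measurable g → ∫ ω, g (X K k ω) ∂P = ∫ x, g x ∂(ν K) :=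
      fun k g hg => by
        rw [← hK k, integral_map (hX K k).aemeasurable hg.aestronglyMeasurable]
    have hup' : ∀ k, Measurable fun x => |u K k x| ^ p := fun k => by
      have := hum K k; fun_prop
    have key := norm_integral_cexp_sum_sub_le (P := P) (U := fun k ω => u K k (X K k ω))
      (fun k => (hum K k).comp (hX K k)) (hKi.comp (fun k => u K k) fun k => hum K k)
      ⟨hp.le, h.le_three⟩ (fun k => by
        have h1 := (hup K k).1
        rw [← hK k, integrable_map_measure (hup' k).aestronglyMeasurable
          (hX K k).aemeasurable] at h1
        exact h1) (fun k => by rw [hmap k _ (hum K k), hu0]) (K ^ 2)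
    have e1 : ∑ k ∈ Finset.range (K ^ 2), ∫ ω, u K k (X K k ω) ^ 2 ∂P = S K := by
      have e2 : ∀ k, ∫ ω, u K k (X K k ω) ^ 2 ∂P = _ := fun k =>
        (hmap k (fun x => u K k x ^ 2) ((hum K k).pow_const 2)).trans (hu2 K k)
      simp_rw [e2]
      rw [Finset.sum_add_distrib, Finset.sum_add_distrib, ← Finset.mul_sum, ← Finset.mul_sum,
        ← Finset.mul_sum, ← Finset.mul_sum, Finset.sum_const, Finset.card_range]
      simp only [nsmul_eq_mul, hS]
      rw [Real.rpow_sub_one hK'.ne']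
      push_cast
      field_simp
    have e3 : ∑ k ∈ Finset.range (K ^ 2), ∫ ω, |u K k (X K k ω)| ^ p ∂P ≤
        2 ^ p * (|t₁| ^ p * (1 - α)⁻¹ ^ p *
      ((K : ℝ) ^ (β * p) * ∑ k ∈ Finset.range (K ^ 2), |wt K k| ^ p) +
        |t₂| ^ p * D * (K : ℝ) ^ (-(p - 2))) := by
      refine (Finset.sum_le_sum fun k _ =>
        ((hmap k _ (hup' k)).le.trans (hup K k).2)).trans (le_of_eq ?_)
      rw [← Finset.mul_sum, Finset.sum_add_distrib, ← Finset.mul_sum, ← Finset.mul_sum,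
        Finset.sum_const, Finset.card_range, neg_sub, Real.rpow_sub hK', Real.rpow_two]
      simp only [nsmul_eq_mul]
      push_cast
      ring
    simp_rw [hsum, e1] at key
    exact key.trans (mul_le_mul_of_nonneg_left e3 (by norm_num))
  have := hdiff.add hexp
  simp only [sub_add_sub_cancel, add_zero] at this
  exact this

end LossFamily


/-! ### Convergence in distribution of the scheme -/

section

variable {Ω : Type*} [mΩ : MeasurableSpace Ω] {P : Measure Ω} [IsProbabilityMeasure P]

lemma tendstoInMeasure_euclidean_two {A B : ℕ → Ω → ℝ}
    (hA : ∀ δ > 0, ∀ η > 0, ∀ᶠ K in atTop, P.real {ω | δ < |A K ω|} ≤ η)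
    (hB : ∀ δ > 0, ∀ η > 0, ∀ᶠ K in atTop, P.real {ω | δ < |B K ω|} ≤ η) :
    TendstoInMeasure P (fun K ω => (!₂[A K ω, B K ω] : EuclideanSpace ℝ (Fin 2))) atTop 0 := by
  rw [tendstoInMeasure_iff_measureReal_norm]
  intro e he
  rw [Metric.tendsto_nhds]
  intro η hη
  filter_upwards [hA (e / 4) (by positivity) (η / 4) (by positivity),
    hB (e / 4) (by positivity) (η / 4) (by positivity)] with K h1 h2
  rw [Real.dist_eq, sub_zero, abs_of_nonneg measureReal_nonneg]
  have h3 : {ω | e ≤ ‖(!₂[A K ω, B K ω] : EuclideanSpace ℝ (Fin 2)) -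
      (0 : Ω → EuclideanSpace ℝ (Fin 2)) ω‖} ⊆
      {ω | e / 4 < |A K ω|} ∪ {ω | e / 4 < |B K ω|} := by
    intro ω hω
    by_contra hc
    simp only [mem_union, mem_ofPred_eq, not_or, not_lt] at hc hω
    have h4 : ‖(!₂[A K ω, B K ω] : EuclideanSpace ℝ (Fin 2))‖ ≤ |A K ω| + |B K ω| := by
      rw [EuclideanSpace.norm_eq, Real.sqrt_le_left (by positivity)]
      simp only [Fin.sum_univ_two, Real.norm_eq_abs]
      simp
      nlinarith [abs_nonneg (A K ω), abs_nonneg (B K ω), sq_abs (A K ω), sq_abs (B K ω)]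
    simp only [Pi.zero_apply, sub_zero] at hω
    linarith [hc.1, hc.2]
  have h5 := (measureReal_mono (μ := P) h3).trans (measureReal_union_le _ _)
  linarith

lemma eventually_measureReal_add_le {A : ℕ → Ω → ℝ} {b : ℕ → ℝ}
    (hA : ∀ δ > 0, ∀ η > 0, ∀ᶠ K in atTop, P.real {ω | δ < |A K ω|} ≤ η)
    (hb : Tendsto b atTop (𝓝 0)) {δ η : ℝ} (hδ : 0 < δ) (hη : 0 < η) :
    ∀ᶠ K in atTop, P.real {ω | δ < |A K ω + b K|} ≤ η := by
  have h1 := hb.abs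
  rw [abs_zero] at h1
  filter_upwards [hA (δ / 2) (by positivity) η hη, h1.eventually_lt_const (half_pos hδ)] with K h2 h3
  refine (measureReal_mono fun ω hω => ?_).trans h2
  simp only [mem_ofPred_eq] at hω ⊢
  linarith [abs_add_le (A K ω) (b K)]

namespace LossFamily

variable {α : ℝ} {ν : ℕ → Measure ℝ} {ν₀ : Measure ℝ} {f : ℕ → ℝ → ℝ} {f₀ v : ℝ → ℝ}
  {M : ℝ≥0} {m p B : ℝ}

section errors

variable {γ₁ β a : ℝ} {ξ X : ℕ → ℕ → Ω → ℝ}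

lemma exists_eventually_start_le (h : LossFamily α ν ν₀ f f₀ v M m p B) (hα : α ∈ Ioo (0 : ℝ) 1)
    (hinit : ∃ C, ∀ᶠ K in atTop, MemLp (ξ K 0) 2 P ∧ ∫ ω, ξ K 0 ω ^ 2 ∂P ≤ C) :
    ∃ C₀, ∀ᶠ K in atTop, MemLp (fun ω => ξ K 0 ω - valueAtRisk α (ν K)) 2 P ∧
      ∫ ω, (ξ K 0 ω - valueAtRisk α (ν K)) ^ 2 ∂P ≤ C₀ := by
  obtain ⟨C, hC⟩ := hinit
  obtain ⟨D, hD⟩ := (h.tendsto_valueAtRisk hα).abs.bddAbove_range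
  refine ⟨2 * C + 2 * D ^ 2, hC.mono fun K ⟨h1, h2⟩ => ?_⟩
  have h3 : MemLp (fun ω => ξ K 0 ω - valueAtRisk α (ν K)) 2 P := h1.sub (memLp_const _)
  refine ⟨h3, ?_⟩
  have h4 : valueAtRisk α (ν K) ^ 2 ≤ D ^ 2 := by
    rw [← sq_abs]; exact pow_le_pow_left₀ (abs_nonneg _) (hD ⟨K, rfl⟩) 2
  refine (integral_mono h3.integrable_sq (((h1.integrable_sq).const_mul 2).fun_add
    (integrable_const (2 * D ^ 2))) fun ω => ?_).trans ?_
  · simp only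
    nlinarith [sq_nonneg (ξ K 0 ω + valueAtRisk α (ν K))]
  · rw [integral_add (h1.integrable_sq.const_mul 2) (integrable_const _), integral_const_mul]
    simp only [integral_const, probReal_univ, smul_eq_mul, one_mul]
    linarith

/-- The slopes at the moving quantiles converge, so the fixed slope a used in the weights is
eventually admissible for each ε₀. -/
lemma eventually_abs_sub_le (h : LossFamily α ν ν₀ f f₀ v M m p B) (hα : α ∈ Ioo (0 : ℝ) 1)
    {ε₀ : ℝ} (hε : 0 < ε₀) : ∀ᶠ K in atTop, |(1 - α)⁻¹ * f K (valueAtRisk α (ν K)) -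
      (1 - α)⁻¹ * f₀ (valueAtRisk α ν₀)| ≤ ε₀ := by
  have h1 := (((h.tendsto_pdf_valueAtRisk hα).const_mul (1 - α)⁻¹).sub_const
    ((1 - α)⁻¹ * f₀ (valueAtRisk α ν₀))).abs
  rw [sub_self, abs_zero] at h1
  exact (h1.eventually_lt_const hε).mono fun K hK => hK.le

lemma eventually_linPart_error_le (h : LossFamily α ν ν₀ f f₀ v M m p B) (hα : α ∈ Ioo (0 : ℝ) 1)
    (hγ₁ : 0 < γ₁) (hβ : β ∈ Ioc (1 / 2 : ℝ) 1) (ha : a = (1 - α)⁻¹ * f₀ (valueAtRisk α ν₀))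
    (hκa : (if β = 1 then γ₁⁻¹ else 0) < 2 * a)
    (hrun : ∀ᶠ K in atTop, ∃ 𝓕 : Filtration ℕ mΩ, IsRun P α (rate γ₁ β) (ν K) 𝓕 (ξ K) (X K))
    (hinit : ∃ C, ∀ᶠ K in atTop, MemLp (ξ K 0) 2 P ∧ ∫ ω, ξ K 0 ω ^ 2 ∂P ≤ C)
    {δ η : ℝ} (hδ : 0 < δ) (hη : 0 < η) :
    ∀ᶠ K : ℕ in atTop, P.real {ω | δ < |(K : ℝ) ^ β * (ξ K (K ^ 2) ω - valueAtRisk α (ν K) -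
      linPart α (rate γ₁ β) a (valueAtRisk α (ν K)) (X K) (K ^ 2) ω)|} ≤ η := by
  have hk := inv_one_sub_pos hα
  have ha0 : 0 < a := by rw [ha]; exact mul_pos hk (h.pdf_lim.pos _)
  obtain ⟨C₀, hC₀⟩ := h.exists_eventually_start_le hα hinit
  -- At time K² one has √γ = √γ₁·K^(-β), so dividing δ by √γ₁ gives the threshold after scaling by
  -- K^β.
  obtain ⟨ε₀, hε₀, N₂, hN₂⟩ := exists_forall_measureReal_sub_linPart_le P hα
    (stepSize_rate hγ₁ hβ) M h.pos C₀ ha0 hκa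
    (show 0 < δ / γ₁ ^ (1 / 2 : ℝ) by positivity) hη
  filter_upwards [h.eventually_quantileLaw hα, hrun, hC₀, h.eventually_abs_sub_le hα hε₀,
    tendsto_sq_atTop.eventually_ge_atTop N₂, eventually_gt_atTop 0]
    with K hq ⟨𝓕, hr⟩ ⟨h1, h2⟩ h3 h4 hK
  rw [← ha] at h3
  refine (measureReal_mono fun ω hω => ?_).trans
    (hN₂ (ν K) (f K) (valueAtRisk α (ν K)) 𝓕 (ξ K) (X K) hq hr h1 h2 h3 (K ^ 2) h4)
  have hK' : (0 : ℝ) < K := by exact_mod_cast hK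
  simp only [mem_ofPred_eq] at hω ⊢
  rw [rate_sq, Real.mul_rpow hγ₁.le (by positivity), ← Real.rpow_mul hK'.le,
    show -(2 * β) * (1 / 2) = -β by ring, Real.rpow_neg hK'.le, ← mul_assoc,
    div_mul_cancel₀ _ (by positivity)]
  rw [abs_mul, abs_of_pos (by positivity)] at hω
  rwa [← div_eq_mul_inv, div_lt_iff₀' (by positivity)]

lemma eventually_gain_error_le (h : LossFamily α ν ν₀ f f₀ v M m p B) (hα : α ∈ Ioo (0 : ℝ) 1)
    (hγ₁ : 0 < γ₁) (hβ : β ∈ Ioc (1 / 2 : ℝ) 1) (ha : a = (1 - α)⁻¹ * f₀ (valueAtRisk α ν₀))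
    (hκa : (if β = 1 then γ₁⁻¹ else 0) < 2 * a)
    (hrun : ∀ᶠ K in atTop, ∃ 𝓕 : Filtration ℕ mΩ, IsRun P α (rate γ₁ β) (ν K) 𝓕 (ξ K) (X K))
    (hinit : ∃ C, ∀ᶠ K in atTop, MemLp (ξ K 0) 2 P ∧ ∫ ω, ξ K 0 ω ^ 2 ∂P ≤ C)
    {δ η : ℝ} (hδ : 0 < δ) (hη : 0 < η) :
    ∀ᶠ K : ℕ in atTop, P.real {ω | δ < |1 / (K : ℝ) * ∑ k ∈ Finset.range (K ^ 2),
      (gain α (ξ K k ω) (X K k ω) - gain α (valueAtRisk α (ν K)) (X K k ω))|} ≤ η := by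
  have hk := inv_one_sub_pos hα
  have ha0 : 0 < a := by rw [ha]; exact mul_pos hk (h.pdf_lim.pos _)
  obtain ⟨C₀, hC₀⟩ := h.exists_eventually_start_le hα hinit
  obtain ⟨ε₀, hε₀, N₂, hN₂⟩ := exists_forall_measureReal_sum_gain_le P hα
    (stepSize_rate hγ₁ hβ) (tendsto_sqrt_mul_rate hγ₁ hβ) M h.pos C₀ ha0 hκa hδ hη
  filter_upwards [h.eventually_quantileLaw hα, hrun, hC₀, h.eventually_abs_sub_le hα hε₀,
    tendsto_sq_atTop.eventually_ge_atTop N₂, eventually_gt_atTop 0]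
    with K hq ⟨𝓕, hr⟩ ⟨h1, h2⟩ h3 h4 hK
  rw [← ha] at h3
  refine (measureReal_mono fun ω hω => ?_).trans
    (hN₂ (ν K) (f K) (valueAtRisk α (ν K)) 𝓕 (ξ K) (X K) hq hr h1 h2 h3 (K ^ 2) h4)
  have hK' : (0 : ℝ) < K := by exact_mod_cast hK
  simp only [mem_ofPred_eq] at hω ⊢
  rw [abs_mul, abs_of_pos (by positivity), one_div, ← div_eq_inv_mul, lt_div_iff₀ hK'] at hω
  push_cast
  rwa [Real.sqrt_sq hK'.le]

end errors

lemma quadForm_limitCov (h : LossFamily α ν ν₀ f f₀ v M m p B) (hα : α ∈ Ioo (0 : ℝ) 1)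
    {γ₁ β a : ℝ} (hγ₁ : 0 < γ₁) (ha : a = (1 - α)⁻¹ * f₀ (valueAtRisk α ν₀))
    (hκa : (if β = 1 then γ₁⁻¹ else 0) < 2 * a) (t : Fin 2 → ℝ) :
    t ⬝ᵥ (limitCov α γ₁ β ν₀ f₀).mulVec t =
      (t 0) ^ 2 * (α / (1 - α)) * (γ₁ / (2 * a - if β = 1 then γ₁⁻¹ else 0)) +
        2 * t 0 * t 1 * (α * (1 - α)⁻¹ * (objective α ν₀ (valueAtRisk α ν₀) - valueAtRisk α ν₀)) *
          ((if β = 1 then 1 else 0) * (1 / a)) +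
        (t 1) ^ 2 * (Var[fun x => max (x - valueAtRisk α ν₀) 0; ν₀] / (1 - α) ^ 2) := by
  have h1 : 1 - α ≠ 0 := by linarith [hα.2]
  have hf := (h.pdf_lim.pos (valueAtRisk α ν₀)).ne'
  have e1 : 2 * f₀ (valueAtRisk α ν₀) - γ₁⁻¹ * (1 - α) * (if β = 1 then 1 else 0) =
      (1 - α) * (2 * a - if β = 1 then γ₁⁻¹ else 0) := by
    rw [ha]; split_ifs <;> field_simp <;> ring
  have h2 : 2 * a - (if β = 1 then γ₁⁻¹ else 0) ≠ 0 := (sub_pos.2 hκa).ne'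
  simp only [limitCov, dotProduct, Matrix.mulVec, Fin.sum_univ_two, Matrix.of_apply,
    Matrix.cons_val_zero, Matrix.cons_val_one, Matrix.cons_val_fin_one]
  rw [e1, h.pdf_lim.expectedShortfall_eq hα]
  generalize 2 * a - (if β = 1 then γ₁⁻¹ else 0) = s at h2
  rw [ha]
  generalize (if β = 1 then (1 : ℝ) else 0) = o
  field_simp
  ring

/-- The limits of the characteristic functions have modulus at most 1, which forces the quadratic
form to be nonnegative. The formula for the characteristic function of `multivariateGaussian`
requires this. -/
theorem posSemidef_limitCov (h : LossFamily α ν ν₀ f f₀ v M m p B) (hα : α ∈ Ioo (0 : ℝ) 1)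
    {γ₁ β a : ℝ} (hγ₁ : 0 < γ₁) (hβ : β ∈ Ioc (1 / 2 : ℝ) 1)
    (ha : a = (1 - α)⁻¹ * f₀ (valueAtRisk α ν₀))
    (hκa : (if β = 1 then γ₁⁻¹ else 0) < 2 * a) {X : ℕ → ℕ → Ω → ℝ}
    (hX : ∀ K n, Measurable (X K n))
    (hlaw : ∀ᶠ K in atTop, (∀ n, P.map (X K n) = ν K) ∧ iIndepFun (X K) P) :
    (limitCov α γ₁ β ν₀ f₀).PosSemidef := by
  have ha0 : 0 < a := by rw [ha]; exact mul_pos (inv_one_sub_pos hα) (h.pdf_lim.pos _)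
  refine Matrix.PosSemidef.of_dotProduct_mulVec_nonneg ?_ fun t => ?_
  · ext i j
    fin_cases i <;> fin_cases j <;> simp [limitCov]
  · rw [star_trivial]
    have h1 := h.tendsto_integral_cexp hα hγ₁ hβ ha0 hκa hX hlaw (t 0) (t 1)
    rw [← h.quadForm_limitCov hα hγ₁ ha hκa t] at h1
    have h2 := le_of_tendsto h1.norm (Eventually.of_forall fun K =>
      (norm_integral_le_of_norm_le_const (μ := P) (C := 1) (Eventually.of_forall fun ω => by
        rw [Complex.norm_exp_ofReal_mul_I])))
    rw [Complex.norm_real, Real.norm_of_nonneg (Real.exp_pos _).le, probReal_univ, mul_one,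
      Real.exp_le_one_iff] at h2
    linarith

theorem tendstoInDistribution_nsa (h : LossFamily α ν ν₀ f f₀ v M m p B) (hα : α ∈ Ioo (0 : ℝ) 1)
    {γ₁ β : ℝ} (hγ₁ : 0 < γ₁) (hβ : β ∈ Ioc (1 / 2 : ℝ) 1)
    (hκa : (if β = 1 then γ₁⁻¹ else 0) < 2 * ((1 - α)⁻¹ * f₀ (valueAtRisk α ν₀)))
    {ξ₀ : ℕ → Ω → ℝ} {X : ℕ → ℕ → Ω → ℝ} (hξ : ∀ K, Measurable (ξ₀ K))
    (hX : ∀ K n, Measurable (X K n))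
    (hlaw : ∀ᶠ K in atTop, (∀ n, P.map (X K n) = ν K) ∧ iIndepFun (X K) P)
    (hind : ∀ᶠ K in atTop, IndepFun (ξ₀ K) (fun ω n => X K n ω) P)
    (hinit : ∃ C, ∀ᶠ K in atTop, MemLp (ξ₀ K) 2 P ∧ ∫ ω, ξ₀ K ω ^ 2 ∂P ≤ C) :
    TendstoInDistribution (fun (K : ℕ) ω =>
        (!₂[(K : ℝ) ^ β * ((nsa α γ₁ β (ξ₀ K ω) (fun n => X K n ω) (K ^ 2)).1 - valueAtRisk α ν₀),
          (K : ℝ) * ((nsa α γ₁ β (ξ₀ K ω) (fun n => X K n ω) (K ^ 2)).2 -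
            expectedShortfall α ν₀)] : EuclideanSpace ℝ (Fin 2)))
      atTop id (fun _ => P)
      (multivariateGaussian (limitMean α β ν₀ f₀ v) (limitCov α γ₁ β ν₀ f₀)) := by
  set a := (1 - α)⁻¹ * f₀ (valueAtRisk α ν₀) with ha
  have ha0 : 0 < a := mul_pos (inv_one_sub_pos hα) (h.pdf_lim.pos _)
  set θ : ℕ → ℝ := fun K => valueAtRisk α (ν K) with hθ
  set ξ : ℕ → ℕ → Ω → ℝ := fun K n ω => (nsa α γ₁ β (ξ₀ K ω) (fun n => X K n ω) n).1 with hξd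
  set L : ℕ → Ω → ℝ := fun K ω =>
    (K : ℝ) ^ β * linPart α (rate γ₁ β) a (θ K) (X K) (K ^ 2) ω with hL
  set T : ℕ → Ω → ℝ := fun K ω =>
    1 / (K : ℝ) * ∑ k ∈ Finset.range (K ^ 2), centredGain α (ν K) (X K k ω) with hT
  set b := limitMean α β ν₀ f₀ v with hb
  have hrun : ∀ᶠ K in atTop, ∃ 𝓕 : Filtration ℕ mΩ,
      IsRun P α (rate γ₁ β) (ν K) 𝓕 (ξ K) (X K) := by
    filter_upwards [hlaw, hind] with K h1 h2
    exact ⟨_, isRun_nsa (hξ K) (hX K) h1.1 h1.2 h2 α γ₁ β⟩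
  have hLm : ∀ K, Measurable (L K) := fun K => by
    have h1 : ∀ k, Measurable fun ω => H₁ α (θ K) (X K k ω) := fun k =>
      (measurable_H₁_right α _).comp (hX K k)
    simp only [hL, linPart]
    fun_prop
  have hTm : ∀ K, Measurable (T K) := fun K => by
    have h1 : ∀ k, Measurable fun ω => centredGain α (ν K) (X K k ω) := fun k =>
      (measurable_centredGain α _).comp (hX K k)
    simp only [hT]
    fun_prop
  have hnm : ∀ K, Measurable fun ω => nsa α γ₁ β (ξ₀ K ω) (fun n => X K n ω) (K ^ 2) := fun K =>
    measurable_nsa (hξ K) (hX K) α γ₁ β _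
  have hLTm : ∀ K, Measurable fun ω => (!₂[L K ω + b 0, T K ω + b 1] : EuclideanSpace ℝ (Fin 2)) :=
    fun K => by
      have h1 := hLm K
      have h2 := hTm K
      refine (WithLp.measurable_toLp 2 (Fin 2 → ℝ)).comp (measurable_pi_lambda _ fun i => ?_)
      fin_cases i
      · simpa using h1.add_const _
      · simpa using h2.add_const _
  -- Slutsky: the leading terms, shifted by the limit mean, converge by characteristic functions,
  -- and the scheme differs from them by a vector tending to 0 in probability.
  refine tendstoInDistribution_of_tendstoInMeasure_sub
    (X := fun K ω => !₂[L K ω + b 0, T K ω + b 1]) _ _ ⟨fun K => (hLTm K).aemeasurable,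
      aemeasurable_id, ?_⟩ ?_ fun K => ?_
  · refine ProbabilityMeasure.tendsto_iff_tendsto_charFun.2 fun t => ?_
    have h1 := h.tendsto_integral_cexp hα hγ₁ hβ ha0 hκa hX hlaw (t 0) (t 1)
    rw [← h.quadForm_limitCov hα hγ₁ ha hκa (fun i => t i)] at h1
    have h2 := h1.mul_const (Complex.exp ((t 0 * b 0 + t 1 * b 1 : ℝ) * Complex.I))
    have e1 : charFun (Measure.map id (multivariateGaussian (limitMean α β ν₀ f₀ v)
        (limitCov α γ₁ β ν₀ f₀))) t =
        ((Real.exp (-((fun i => t i) ⬝ᵥ (limitCov α γ₁ β ν₀ f₀).mulVec (fun i => t i) / 2)) : ℝ) : ℂ) *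
          Complex.exp ((t 0 * b 0 + t 1 * b 1 : ℝ) * Complex.I) := by
      rw [Measure.map_id, charFun_multivariateGaussian
        (h.posSemidef_limitCov hα hγ₁ hβ ha hκa hX hlaw), Complex.ofReal_exp, ← Complex.exp_add]
      congr 1
      rw [PiLp.inner_apply]
      simp only [Fin.sum_univ_two]
      simp [hb]
      ring
    change Tendsto _ _ (𝓝 (charFun (Measure.map id (multivariateGaussian (limitMean α β ν₀ f₀ v)
        (limitCov α γ₁ β ν₀ f₀))) t))
    rw [e1]
    refine h2.congr fun K => ?_
    change _ = charFun (P.map fun ω => (!₂[L K ω + b 0, T K ω + b 1] : EuclideanSpace ℝ (Fin 2))) t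
    rw [charFun_apply, integral_map (hLTm K).aemeasurable (by fun_prop), ← integral_mul_const]
    congr 1
    funext ω
    rw [← Complex.exp_add, PiLp.inner_apply]
    simp only [Fin.sum_univ_two]
    congr 1
    simp [hL, hT]
    ring
  -- Each component of the difference is a random replacement error plus a deterministic bias minus
  -- its limit.
  · set A : ℕ → Ω → ℝ := fun K ω => (K : ℝ) ^ β * (ξ K (K ^ 2) ω - θ K -
      linPart α (rate γ₁ β) a (θ K) (X K) (K ^ 2) ω) + ((K : ℝ) ^ β *
        (θ K - valueAtRisk α ν₀) - b 0) with hA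
    set D : ℕ → Ω → ℝ := fun K ω => 1 / (K : ℝ) * ∑ k ∈ Finset.range (K ^ 2),
      (gain α (ξ K k ω) (X K k ω) - gain α (θ K) (X K k ω)) + ((K : ℝ) *
        (objective α (ν K) (θ K) - objective α ν₀ (valueAtRisk α ν₀)) - b 1) with hD
    have hA' : ∀ δ > 0, ∀ η > 0, ∀ᶠ K in atTop, P.real {ω | δ < |A K ω|} ≤ η := by
      intro δ hδ η hη
      refine eventually_measureReal_add_le (fun δ hδ η hη =>
        h.eventually_linPart_error_le hα hγ₁ hβ ha hκa hrun hinit hδ hη) ?_ hδ hη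
      have h2 := ((h.tendsto_mul_valueAtRisk_sub hα).mul (tendsto_rpow_sub_one hβ.2)).sub_const (b 0)
      have e : -(v (valueAtRisk α ν₀) / f₀ (valueAtRisk α ν₀)) * (if β = 1 then 1 else 0) - b 0 =
          0 := by simp [hb, limitMean]
      rw [e] at h2
      refine h2.congr' ((eventually_gt_atTop 0).mono fun K hK => ?_)
      have hK' : (K : ℝ) ≠ 0 := by exact_mod_cast hK.ne'
      rw [Real.rpow_sub_one hK']
      simp only [hθ]
      field_simp
    have hD' : ∀ δ > 0, ∀ η > 0, ∀ᶠ K in atTop, P.real {ω | δ < |D K ω|} ≤ η := by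
      intro δ hδ η hη
      refine eventually_measureReal_add_le (fun δ hδ η hη =>
        h.eventually_gain_error_le hα hγ₁ hβ ha hκa hrun hinit hδ hη) ?_ hδ hη
      have h2 := (h.tendsto_mul_objective_sub hα).sub_const (b 1)
      have e : (-∫ x in Ioi (valueAtRisk α ν₀), v x / (1 - α)) - b 1 = 0 := by
        simp [hb, limitMean]
      rw [e] at h2
      exact h2
    refine (tendstoInMeasure_euclidean_two hA' hD').congr' ?_ EventuallyEq.rfl
    filter_upwards [eventually_gt_atTop 0] with K hK
    refine Eventually.of_forall fun ω => ?_
    have hK' : (K : ℝ) ≠ 0 := by exact_mod_cast hK.ne'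
    have h1 := natCast_mul_nsa_snd α γ₁ β (ξ₀ K ω) (fun n => X K n ω) (K ^ 2)
    push_cast at h1
    have h2 : (nsa α γ₁ β (ξ₀ K ω) (fun n => X K n ω) (K ^ 2)).2 =
        (∑ k ∈ Finset.range (K ^ 2), gain α (ξ K k ω) (X K k ω)) / (K : ℝ) ^ 2 := by
      rw [← h1]; field_simp
    ext i
    fin_cases i
    · simp [hA, hL, hξd]
      ring
    · have e2 : D K ω = (K : ℝ) * ((nsa α γ₁ β (ξ₀ K ω) (fun n => X K n ω) (K ^ 2)).2 -
          expectedShortfall α ν₀) - (T K ω + b 1) := by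
        rw [h2, h.pdf_lim.expectedShortfall_eq hα]
        simp only [hD, hT, centredGain, Finset.sum_sub_distrib, Finset.sum_const, Finset.card_range,
          nsmul_eq_mul, hθ]
        push_cast
        field_simp
        ring
      simpa using e2
  · have h1 := (hnm K).fst
    have h2 := (hnm K).snd
    refine ((WithLp.measurable_toLp 2 (Fin 2 → ℝ)).comp
      (measurable_pi_lambda _ fun i => ?_)).aemeasurable
    fin_cases i
    · simpa using (h1.sub_const _).const_mul _
    · simpa using (h2.sub_const _).const_mul _

end LossFamily

end


/-! ### The parameters -/

/-- The inverse square of 1/K is an integer, so the ceiling is exact. -/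
lemma numIter_one_div (K : ℕ) : numIter (1 / (K : ℝ)) = K ^ 2 := by
  unfold numIter
  rw [one_div, zpow_neg, inv_zpow, inv_inv]
  exact_mod_cast Nat.ceil_natCast (R := ℝ) (K ^ 2)

lemma numIter_biasParam (β ε : ℝ) : numIter (biasParam β ε) = innerSize β ε ^ 2 :=
  numIter_one_div _

lemma innerSize_pos (β : ℝ) {ε : ℝ} (hε : 0 < ε) : 0 < innerSize β ε :=
  Nat.ceil_pos.2 (Real.rpow_pos_of_pos hε _)

lemma biasParam_mem (β : ℝ) {ε : ℝ} (hε : 0 < ε) : biasParam β ε ∈ biasSet :=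
  ⟨_, innerSize_pos β hε, rfl⟩

section

variable {β : ℝ}

lemma tendsto_rpow_neg_one_div (hβ : 0 < β) :
    Tendsto (fun ε : ℝ => ε ^ (-(1 / β))) (𝓝[>] 0) atTop :=
  tendsto_rpow_neg_nhdsGT_zero (by simpa using hβ)

lemma tendsto_innerSize (hβ : 0 < β) : Tendsto (innerSize β) (𝓝[>] 0) atTop :=
  tendsto_nat_ceil_atTop.comp (tendsto_rpow_neg_one_div hβ)

lemma tendsto_innerSize_div (hβ : 0 < β) :
    Tendsto (fun ε => (innerSize β ε : ℝ) / ε ^ (-(1 / β))) (𝓝[>] 0) (𝓝 1) :=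
  tendsto_nat_ceil_div_atTop.comp (tendsto_rpow_neg_one_div hβ)

lemma tendsto_div_innerSize (hβ : 0 < β) :
    Tendsto (fun ε => ε ^ (-(1 / β)) / (innerSize β ε : ℝ)) (𝓝[>] 0) (𝓝 1) := by
  have := (tendsto_innerSize_div hβ).inv₀ one_ne_zero
  rw [inv_one] at this
  exact this.congr fun ε => inv_div _ _

lemma biasParam_isEquivalent (hβ : 0 < β) :
    (fun ε => biasParam β ε) ~[𝓝[>] 0] fun ε => ε ^ (1 / β) := by
  rw [isEquivalent_iff_tendsto_one]
  · refine (tendsto_div_innerSize hβ).congr' ?_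
    filter_upwards [self_mem_nhdsWithin] with ε hε
    have hε' : 0 < ε := hε
    have := (Real.rpow_pos_of_pos hε' (1 / β)).ne'
    simp only [Pi.div_apply, biasParam]
    rw [Real.rpow_neg hε'.le]
    field_simp
  · filter_upwards [self_mem_nhdsWithin] with ε hε
    exact (Real.rpow_pos_of_pos hε _).ne'

lemma numIter_isEquivalent (hβ : 0 < β) :
    (fun ε => (numIter (biasParam β ε) : ℝ)) ~[𝓝[>] 0] fun ε => ε ^ (-(2 / β)) := by
  rw [isEquivalent_iff_tendsto_one]
  · have h1 := (tendsto_innerSize_div hβ).pow 2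
    rw [one_pow] at h1
    refine h1.congr' ?_
    filter_upwards [self_mem_nhdsWithin] with ε hε
    have hε' : 0 < ε := hε
    simp only [Pi.div_apply]
    rw [numIter_biasParam, div_pow, ← Real.rpow_natCast (ε ^ _), ← Real.rpow_mul hε'.le]
    push_cast
    congr 2
    ring
  · filter_upwards [self_mem_nhdsWithin] with ε hε
    exact (Real.rpow_pos_of_pos hε _).ne'

lemma innerSize_le {ε : ℝ} (hβ : 0 < β) (hε : ε ∈ Ioo (0 : ℝ) 1) :
    (innerSize β ε : ℝ) ≤ 2 * ε ^ (-(1 / β)) := by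
  have h1 : 1 ≤ ε ^ (-(1 / β)) := by
    rw [Real.rpow_neg hε.1.le]
    exact (one_le_inv₀ (Real.rpow_pos_of_pos hε.1 _)).2
      (Real.rpow_le_one hε.1.le hε.2.le (by positivity))
  have h2 := (Nat.ceil_lt_add_one (show 0 ≤ ε ^ (-(1 / β)) by linarith)).le
  unfold innerSize
  linarith

/-- For ε < 1 the power ε^(-1/β) decreases in β. -/
lemma innerSize_one_le {ε : ℝ} (hβ : β ∈ Ioc (1 / 2 : ℝ) 1) (hε : ε ∈ Ioo (0 : ℝ) 1) :
    innerSize 1 ε ≤ innerSize β ε := by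
  refine Nat.ceil_mono (Real.rpow_le_rpow_of_exponent_ge hε.1 hε.2.le ?_)
  have h0 : 0 < β := by linarith [hβ.1]
  rw [neg_le_neg_iff, div_one, one_le_div h0]
  exact hβ.2

end

/-! ### The cost -/

namespace Timed

variable {A D : Type}

@[simp] lemma bind_val (m : Timed A) (g : A → Timed D) : (m >>= g).val = (g m.val).val := rfl

@[simp] lemma bind_time (m : Timed A) (g : A → Timed D) :
    (m >>= g).time = m.time + (g m.val).time := rfl

@[simp] lemma pure_val (a : A) : (pure a : Timed A).val = a := rfl

@[simp] lemma pure_time (a : A) : (pure a : Timed A).time = 0 := rfl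

end Timed

@[simp] lemma charge_val {A : Type} (c : ℝ≥0) (a : A) : (charge c a).val = a := rfl

@[simp] lemma charge_time {A : Type} (c : ℝ≥0) (a : A) : (charge c a).time = c := rfl

section

variable {d q : ℕ} (c : UnitCosts) (φ : (Fin d → ℝ) × (Fin q → ℝ) → ℝ)

lemma runSum_val (y : Fin d → ℝ) (z : ℕ → Fin q → ℝ) (K : ℕ) :
    (runSum c φ y z K).val = ∑ k ∈ Finset.range K, φ (y, z k) := by
  induction K with
  | zero => rfl
  | succ K ih => simp [runSum, Finset.sum_range_succ, ih]

lemma runSum_time (y : Fin d → ℝ) (z : ℕ → Fin q → ℝ) (K : ℕ) :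
    (runSum c φ y z K).time = K * (c.drawZ + c.evalφ + c.op) := by
  induction K with
  | zero => simp [runSum]
  | succ K ih =>
    simp [runSum, ih]
    ring

lemma runLoss_val (y : Fin d → ℝ) (z : ℕ → Fin q → ℝ) (K : ℕ) :
    (runLoss c φ K y z).val = innerMean φ K y fun k => z k := by
  simp [runLoss, runSum_val, innerMean, Finset.sum_range]

lemma runLoss_time (y : Fin d → ℝ) (z : ℕ → Fin q → ℝ) (K : ℕ) :
    (runLoss c φ K y z).time = c.drawY + K * (c.drawZ + c.evalφ + c.op) + 2 * c.op := by
  simp [runLoss, runSum_time]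
  ring

variable (α γ₁ β : ℝ) (K : ℕ) (x₀ : ℝ) (y : ℕ → Fin d → ℝ) (z : ℕ → ℕ → Fin q → ℝ)

lemma runIter_val (n : ℕ) : (runIter c φ α γ₁ β K x₀ y z n).val =
    nsa α γ₁ β x₀ (fun n => innerMean φ K (y n) fun k => z n k) n := by
  induction n with
  | zero => rfl
  | succ n ih => simp [runIter, ih, nsa, runLoss_val]

/-- The 23 operations are 2 for the sample and 1 + 3 + 5 + 7 + 2 + 3 for the update. -/
lemma runIter_time (n : ℕ) : (runIter c φ α γ₁ β K x₀ y z n).time =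
    c.drawInit + n * (c.drawY + K * (c.drawZ + c.evalφ + c.op) + 23 * c.op) := by
  induction n with
  | zero => simp [runIter]
  | succ n ih =>
    simp [runIter, ih, runLoss_time]
    ring

lemma runNSA_val (ε : ℝ) : (runNSA c φ α γ₁ β ε x₀ y z).val =
    nsa α γ₁ β x₀ (fun n => innerMean φ (innerSize β ε) (y n) fun k => z n k)
      (numIter (biasParam β ε)) := by
  simp [runNSA, runIter_val, biasParam]

lemma runNSA_time (ε : ℝ) : (runNSA c φ α γ₁ β ε x₀ y z).time =
    7 * c.op + c.drawInit + (innerSize β ε : ℝ≥0) ^ 2 *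
      (c.drawY + innerSize β ε * (c.drawZ + c.evalφ + c.op) + 23 * c.op) := by
  have h := numIter_one_div (innerSize β ε)
  simp only [runNSA, Timed.bind_time, charge_time, charge_val, runIter_time, h]
  push_cast
  ring

/-- All powers of K ≥ 1 are raised to K³, and K ≤ 2ε^(-1/β) gives the 8. The operations number 31 =
7 + 23 + 1, and the final + 1 keeps the constant positive even when every unit cost is 0. -/
lemma runNSA_time_le {β : ℝ} (hβ : 0 < β) {ε : ℝ} (hε : ε ∈ Ioo (0 : ℝ) 1) :
    ((runNSA c φ α γ₁ β ε x₀ y z).time : ℝ) ≤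
      (8 * (c.drawInit + c.drawY + c.drawZ + c.evalφ + 31 * c.op) + 1) * ε ^ (-(3 / β)) := by
  rw [runNSA_time]
  push_cast
  have h1 := innerSize_le hβ hε
  have h2 : (1 : ℝ) ≤ innerSize β ε := by exact_mod_cast innerSize_pos β hε.1
  set k : ℝ := ((innerSize β ε : ℕ) : ℝ) with hk
  set x := ε ^ (-(1 / β)) with hx
  have h3 : ε ^ (-(3 / β)) = x ^ 3 := by
    rw [hx, ← Real.rpow_natCast, ← Real.rpow_mul hε.1.le]
    congr 1
    push_cast
    ring
  have h4 : k ^ 3 ≤ 8 * x ^ 3 := by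
    calc k ^ 3 ≤ (2 * x) ^ 3 := pow_le_pow_left₀ (by linarith) h1 3
      _ = _ := by ring
  have h5 : 1 ≤ k ^ 3 := one_le_pow₀ h2
  have h6 : k ^ 2 ≤ k ^ 3 := pow_le_pow_right₀ h2 (by norm_num)
  have p1 := c.op.2
  have p2 := c.drawInit.2
  have p3 := c.drawY.2
  have p4 := c.drawZ.2
  have p5 := c.evalφ.2
  have hx3 : 0 ≤ x ^ 3 := by linarith
  simp only [NNReal.val_eq_coe] at p1 p2 p3 p4 p5
  rw [h3]
  calc 7 * (c.op : ℝ) + c.drawInit + k ^ 2 * (c.drawY + k * (c.drawZ + c.evalφ + c.op) + 23 * c.op)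
      = (7 * c.op + c.drawInit) * 1 + (c.drawY + 23 * c.op) * k ^ 2 +
        (c.drawZ + c.evalφ + c.op) * k ^ 3 := by ring
    _ ≤ (7 * c.op + c.drawInit) * k ^ 3 + (c.drawY + 23 * c.op) * k ^ 3 +
        (c.drawZ + c.evalφ + c.op) * k ^ 3 := by gcongr
    _ = (c.drawInit + c.drawY + c.drawZ + c.evalφ + 31 * c.op) * k ^ 3 := by ring
    _ ≤ (c.drawInit + c.drawY + c.drawZ + c.evalφ + 31 * c.op) * (8 * x ^ 3) := by gcongr
    _ ≤ _ := by linarith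

lemma runNSA_time_mono (γ₂ β' : ℝ) {ε : ℝ} (h : innerSize β ε ≤ innerSize β' ε) :
    (runNSA c φ α γ₁ β ε x₀ y z).time ≤ (runNSA c φ α γ₂ β' ε x₀ y z).time := by
  rw [runNSA_time, runNSA_time]
  have h' : (innerSize β ε : ℝ≥0) ≤ innerSize β' ε := by exact_mod_cast h
  gcongr

end

/-! ### The assumptions of the theorem -/

section

variable {Ω : Type*} [mΩ : MeasurableSpace Ω] {P : Measure Ω} [IsProbabilityMeasure P]

/-- The exponential factor is at least 1, so second moments are bounded by the assumed supremum. -/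
lemma InitAssumption.exists_integral_sq_le {α : ℝ} (hα : α ∈ Ioo (0 : ℝ) 1) {f : ℝ → ℝ → ℝ}
    {ξ₀ : ℝ → Ω → ℝ} (h : InitAssumption P α f ξ₀) (hξ : ∀ b, Measurable (ξ₀ b)) :
    ∃ C, ∀ b ∈ biasSet, MemLp (ξ₀ b) 2 P ∧ ∫ ω, ξ₀ b ω ^ 2 ∂P ≤ C := by
  set S := (⨆ b ∈ biasSet, ∫⁻ ω, ENNReal.ofReal (|ξ₀ b ω| ^ 2 *
    Real.exp (4 / (1 - α) * max 1 (α / (1 - α)) * supDensity f * |ξ₀ b ω|)) ∂P) with hS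
  have hS' : S < ∞ := h
  have h1 : 0 < 1 - α := by linarith [hα.2]
  have hd : 0 ≤ supDensity f := Real.iSup_nonneg fun _ => abs_nonneg _
  refine ⟨S.toReal, fun b hb => ?_⟩
  have h2 : ∫⁻ ω, ENNReal.ofReal (ξ₀ b ω ^ 2) ∂P ≤ S := by
    refine le_trans (lintegral_mono fun ω => ENNReal.ofReal_le_ofReal ?_)
      (le_iSup₂ (f := fun b (_ : b ∈ biasSet) => ∫⁻ ω, ENNReal.ofReal (|ξ₀ b ω| ^ 2 *
        Real.exp (4 / (1 - α) * max 1 (α / (1 - α)) * supDensity f * |ξ₀ b ω|)) ∂P) b hb)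
    rw [sq_abs]
    exact le_mul_of_one_le_right (sq_nonneg _) (Real.one_le_exp (by positivity))
  have hm : Measurable fun ω => ξ₀ b ω ^ 2 := (hξ b).pow_const 2
  have h3 : Integrable (fun ω => ξ₀ b ω ^ 2) P := by
    refine ⟨hm.aestronglyMeasurable, ?_⟩
    rw [hasFiniteIntegral_iff_ofReal (Eventually.of_forall fun ω => sq_nonneg _)]
    exact h2.trans_lt hS'
  refine ⟨(memLp_two_iff_integrable_sq (hξ b).aestronglyMeasurable).2 h3, ?_⟩
  rw [integral_eq_lintegral_of_nonneg_ae (Eventually.of_forall fun ω => sq_nonneg _)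
    hm.aestronglyMeasurable]
  exact ENNReal.toReal_mono hS'.ne h2

/-- The infimum is at most the term h = 0, whose minimum is at most 3/8 of V_0'' at the quantile. -/
lemma lambdaConst_le {α : ℝ} (hα : α ∈ Ioo (0 : ℝ) 1) {ν : ℝ → Measure ℝ} {f : ℝ → ℝ → ℝ}
    {M : ℝ≥0} (h : ∀ b ∈ insert 0 biasSet, PdfLaw (ν b) (f b) M) :
    lambdaConst α ν ≤ 3 / 8 * ((1 - α)⁻¹ * f 0 (valueAtRisk α (ν 0))) := by
  have hκ := inv_one_sub_pos hα
  have h0 := h 0 (mem_insert _ _)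
  unfold lambdaConst
  -- A real infimum needs a lower bound: every term is nonnegative.
  refine (ciInf_le ⟨0, ?_⟩ (⟨0, mem_insert _ _⟩ : (insert 0 biasSet : Set ℝ))).trans ?_
  · rintro _ ⟨b, rfl⟩
    have hb := h b b.2
    simp only [hb.deriv_deriv_objective hα]
    have h1 : 0 ≤ supNorm fun x => (1 - α)⁻¹ * f b x := Real.iSup_nonneg fun _ => abs_nonneg _
    have h2 := (hb.pos (leastArgmin (objective α (ν b)))).le
    positivity
  · simp only [h0.deriv_deriv_objective hα, h0.leastArgmin_objective hα]
    exact min_le_left _ _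

lemma _root_.MeasureTheory.TendstoInDistribution.congr_eventually {ι E Ω' : Type*}
    {mE : MeasurableSpace E}
    [MeasurableSpace Ω']
    [TopologicalSpace E] [OpensMeasurableSpace E] {l : Filter ι} {μ : Measure Ω'}
    [IsProbabilityMeasure μ] {X Y : ι → Ω → E} {Z : Ω' → E}
    (h : TendstoInDistribution X l Z (fun _ => P) μ) (hXY : ∀ᶠ i in l, X i = Y i)
    (hY : ∀ i, AEMeasurable (Y i) P) : TendstoInDistribution Y l Z (fun _ => P) μ where
  forall_aemeasurable := hY
  aemeasurable_limit := h.aemeasurable_limit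
  tendsto := h.tendsto.congr' (hXY.mono fun i hi => Subtype.ext (by simp only [hi]))

lemma _root_.MeasureTheory.TendstoInDistribution.scale_euclidean_two {ι Ω' : Type*}
    [MeasurableSpace Ω'] {l : Filter ι}
    [l.IsCountablyGenerated] {μ : Measure Ω'} [IsProbabilityMeasure μ]
    {X : ι → Ω → EuclideanSpace ℝ (Fin 2)} {Z : Ω' → EuclideanSpace ℝ (Fin 2)}
    (h : TendstoInDistribution X l Z (fun _ => P) μ) {c₁ c₂ : ι → ℝ} (h₁ : Tendsto c₁ l (𝓝 1))
    (h₂ : Tendsto c₂ l (𝓝 1)) :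
    TendstoInDistribution (fun i ω => (!₂[c₁ i * X i ω 0, c₂ i * X i ω 1] :
      EuclideanSpace ℝ (Fin 2))) l Z (fun _ => P) μ := by
  have hc : TendstoInMeasure P (fun i (_ : Ω) => (c₁ i, c₂ i)) l fun _ => ((1 : ℝ), (1 : ℝ)) := by
    rw [tendstoInMeasure_iff_measureReal_norm]
    intro e he
    have h3 := tendsto_iff_norm_sub_tendsto_zero.1 (h₁.prodMk_nhds h₂)
    refine tendsto_const_nhds.congr' ((h3.eventually_lt_const he).mono fun i hi => ?_)
    have : {_x : Ω | e ≤ ‖(c₁ i, c₂ i) - ((1 : ℝ), (1 : ℝ))‖} = ∅ := by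
      ext ω; simpa using hi
    change 0 = P.real {_x : Ω | e ≤ ‖(c₁ i, c₂ i) - ((1 : ℝ), (1 : ℝ))‖}
    rw [this, measureReal_empty]
  have h4 := h.continuous_comp_prodMk_of_tendstoInMeasure_const
    (g := fun x : EuclideanSpace ℝ (Fin 2) × (ℝ × ℝ) =>
      (!₂[x.2.1 * x.1 0, x.2.2 * x.1 1] : EuclideanSpace ℝ (Fin 2))) ?_ hc
    (fun i => aemeasurable_const)
  · refine h4.congr (fun i => EventuallyEq.rfl) (Eventually.of_forall fun ω => ?_)
    ext i
    fin_cases i <;> simp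
  · refine (PiLp.continuous_toLp 2 _).comp (continuous_pi fun i => ?_)
    fin_cases i
    · simp; fun_prop
    · simp; fun_prop

end


lemma _root_.MeasureTheory.TendstoInDistribution.comp_tendsto {Ω Ω' : Type*}
    [MeasurableSpace Ω] {P : Measure Ω}
    [IsProbabilityMeasure P] {ι κ E : Type*} {mE : MeasurableSpace E}
    [MeasurableSpace Ω'] [TopologicalSpace E] [OpensMeasurableSpace E] {l : Filter ι}
    {l' : Filter κ} {μ : Measure Ω'} [IsProbabilityMeasure μ] {X : ι → Ω → E} {Z : Ω' → E}
    (h : TendstoInDistribution X l Z (fun _ => P) μ) {u : κ → ι} (hu : Tendsto u l' l) :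
    TendstoInDistribution (fun k => X (u k)) l' Z (fun _ => P) μ where
  forall_aemeasurable k := h.forall_aemeasurable (u k)
  aemeasurable_limit := h.aemeasurable_limit
  tendsto := h.tendsto.comp hu

lemma integrable_abs_rpow_of_le {Ω : Type*} [MeasurableSpace Ω] {P : Measure Ω}
    [IsFiniteMeasure P] {g : Ω → ℝ} (hg : Measurable g) {p r : ℝ} (hp : 0 ≤ p) (hpr : p ≤ r)
    (h : Integrable (fun ω => |g ω| ^ r) P) : Integrable (fun ω => |g ω| ^ p) P := by
  refine ((integrable_const (1 : ℝ)).add h).mono'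
    (hg.abs.pow_const p).aestronglyMeasurable (Eventually.of_forall fun ω => ?_)
  have h0 := abs_nonneg (g ω)
  rw [Real.norm_of_nonneg (Real.rpow_nonneg h0 _), Pi.add_apply]
  rcases le_total |g ω| 1 with h1 | h1
  · linarith [Real.rpow_le_one h0 h1 hp, Real.rpow_nonneg h0 r]
  · linarith [Real.rpow_le_rpow_of_exponent_le h1 hpr]

theorem tendstoInDistribution_nsa_innerSize {Ω : Type*} [MeasurableSpace Ω] {P : Measure Ω}
    [IsProbabilityMeasure P] {d q : ℕ} {Y : Ω → Fin d → ℝ} {Z : Ω → Fin q → ℝ}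
    {φ : (Fin d → ℝ) × (Fin q → ℝ) → ℝ} (hY : Measurable Y) (hZ : Measurable Z)
    (hYZ : IndepFun Y Z P) (hφ : Measurable φ) {δ : ℝ} (hδ : 0 < δ)
    (hmoment : Integrable (fun ω => |φ (Y ω, Z ω)| ^ (2 + δ)) P)
    {α : ℝ} (hα : α ∈ Ioo (0 : ℝ) 1) {f : ℝ → ℝ → ℝ} {v : ℝ → ℝ} {w : ℝ → ℝ → ℝ}
    (hloss : LossAssumptions α (lossLaw P Y Z φ) f v w) {ξ₀ : ℝ → Ω → ℝ} {X : ℝ → ℕ → Ω → ℝ}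
    (hξ₀ : ∀ h, Measurable (ξ₀ h)) (hX : ∀ h n, Measurable (X h n))
    (hXlaw : ∀ h ∈ biasSet, ∀ n, P.map (X h n) = lossLaw P Y Z φ h)
    (hXindep : ∀ h ∈ biasSet, iIndepFun (X h) P)
    (hξ₀X : ∀ h ∈ biasSet, IndepFun (ξ₀ h) (fun ω n => X h n ω) P)
    (hinit : InitAssumption P α f ξ₀) {γ₁ β : ℝ} (hγ₁ : 0 < γ₁) (hβ : β ∈ Ioc (1 / 2 : ℝ) 1)
    (hβ1 : β = 1 → 1 < lambdaConst α (lossLaw P Y Z φ) * γ₁) :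
    TendstoInDistribution
      (fun (ε : ℝ) (ω : Ω) =>
        let h := biasParam β ε
        let s := nsa α γ₁ β (ξ₀ h ω) (fun n => X h n ω) (numIter h)
        (!₂[ε⁻¹ * (s.1 - valueAtRisk α (lossLaw P Y Z φ 0)),
          ε ^ (-(1 / β)) * (s.2 - expectedShortfall α (lossLaw P Y Z φ 0))] :
            EuclideanSpace ℝ (Fin 2)))
      (𝓝[>] 0) id (fun _ => P)
      (multivariateGaussian (limitMean α β (lossLaw P Y Z φ 0) (f 0) v)
        (limitCov α γ₁ β (lossLaw P Y Z φ 0) (f 0))) := by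
  have hβ0 : 0 < β := by linarith [hβ.1]
  -- The exponent is capped at 3, the largest one allowed by the Taylor estimate.
  have hp2 : 2 < 2 + min δ 1 := by simp [hδ]
  have hp3 : 2 + min δ 1 ≤ 3 := by linarith [min_le_right δ 1]
  have hint : Integrable (fun ω => |φ (Y ω, Z ω)| ^ (2 + min δ 1)) P :=
    integrable_abs_rpow_of_le (hφ.comp (hY.prodMk hZ)) (by linarith)
      (by linarith [min_le_left δ 1]) hmoment
  have hprob : ∀ b, IsProbabilityMeasure (lossLaw P Y Z φ b) :=
    isProbabilityMeasure_lossLaw hY hZ hφ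
  have hmom := fun b hb =>
    lossLaw_moment hY hZ hYZ hφ (by linarith : 1 ≤ 2 + min δ 1) hint (h := b) hb
  obtain ⟨M, m, hF⟩ := hloss.exists_lossFamily hα hprob hp2 hp3 hmom
  obtain ⟨M', hM'⟩ := hloss.exists_pdfLaw hprob
    (fun b hb => integrable_id_of_rpow hp2.le (hmom b hb).1)
  obtain ⟨C, hC⟩ := hinit.exists_integral_sq_le hα hξ₀
  have hmem : ∀ᶠ K : ℕ in atTop, (1 / (K : ℝ)) ∈ biasSet :=
    (eventually_gt_atTop 0).mono fun K hK => ⟨K, hK, rfl⟩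
  have ha : 0 < (1 - α)⁻¹ * f 0 (valueAtRisk α (lossLaw P Y Z φ 0)) :=
    mul_pos (inv_one_sub_pos hα) ((hM' 0 (mem_insert _ _)).pos _)
  -- For β = 1, λγ₁ > 1 gives 1/γ₁ < λ ≤ 3a/8 < 2a; otherwise the left side is 0 < 2a.
  have hκa : (if β = 1 then γ₁⁻¹ else 0) <
      2 * ((1 - α)⁻¹ * f 0 (valueAtRisk α (lossLaw P Y Z φ 0))) := by
    split_ifs with h1
    · have h2 := lambdaConst_le hα hM'
      have h3 : γ₁⁻¹ < lambdaConst α (lossLaw P Y Z φ) := by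
        rw [inv_lt_iff_one_lt_mul₀ hγ₁]
        exact hβ1 h1
      linarith
    · linarith
  have main := hF.tendstoInDistribution_nsa (P := P) (ξ₀ := fun K => ξ₀ (1 / K))
    (X := fun K => X (1 / K)) hα hγ₁ hβ hκa (fun K => hξ₀ _) (fun K n => hX _ n)
    (hmem.mono fun K hK => ⟨hXlaw _ hK, hXindep _ hK⟩) (hmem.mono fun K hK => hξ₀X _ hK)
    ⟨C, hmem.mono fun K hK => hC _ hK⟩
  -- Raising ε^(-1/β)/K to the power β converts the normalisation K^β into ε⁻¹; the ratio tends to 1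
  -- as the rounding becomes negligible.
  have h1 : Tendsto (fun ε : ℝ => (ε ^ (-(1 / β)) / (innerSize β ε : ℝ)) ^ β) (𝓝[>] 0) (𝓝 1) := by
    have := (tendsto_div_innerSize hβ0).rpow_const (p := β) (Or.inl one_ne_zero)
    rwa [Real.one_rpow] at this
  refine ((main.comp_tendsto (tendsto_innerSize hβ0)).scale_euclidean_two h1
    (tendsto_div_innerSize hβ0)).congr_eventually ?_ fun ε => ?_
  · filter_upwards [self_mem_nhdsWithin] with ε hε
    have hε : 0 < ε := hε
    have hK : (0 : ℝ) < innerSize β ε := by exact_mod_cast innerSize_pos β hε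
    have h2 : (ε ^ (-(1 / β)) / (innerSize β ε : ℝ)) ^ β * (innerSize β ε : ℝ) ^ β = ε⁻¹ := by
      rw [← Real.mul_rpow (by positivity) hK.le, div_mul_cancel₀ _ hK.ne', ← Real.rpow_mul hε.le,
        neg_mul, one_div_mul_cancel hβ0.ne', Real.rpow_neg_one]
    have h3 : ε ^ (-(1 / β)) / (innerSize β ε : ℝ) * (innerSize β ε : ℝ) = ε ^ (-(1 / β)) :=
      div_mul_cancel₀ _ hK.ne'
    funext ω
    simp only [numIter_biasParam]
    rw [← h2, ← h3, mul_assoc, mul_assoc]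
    simp only [h3]
    rfl
  · have h3 := measurable_nsa (hξ₀ (biasParam β ε)) (hX (biasParam β ε)) α γ₁ β
      (numIter (biasParam β ε))
    refine Measurable.aemeasurable ?_
    refine (PiLp.continuous_toLp 2 _).measurable.comp (measurable_pi_lambda _ fun i => ?_)
    fin_cases i
    · exact (h3.fst.sub_const _).const_mul _
    · exact (h3.snd.sub_const _).const_mul _

end NestedSA

open NestedSA

theorem theorem1p6 {Ω : Type*} [MeasurableSpace Ω] (P : Measure Ω) [IsProbabilityMeasure P]
    {d q : ℕ} (Y : Ω → Fin d → ℝ) (Z : Ω → Fin q → ℝ) (φ : (Fin d → ℝ) × (Fin q → ℝ) → ℝ)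
    (hY : Measurable Y) (hZ : Measurable Z) (hYZ : IndepFun Y Z P) (hφ : Measurable φ)
    (δ : ℝ) (hδ : 0 < δ) (hmoment : Integrable (fun ω => |φ (Y ω, Z ω)| ^ (2 + δ)) P)
    (α : ℝ) (hα : α ∈ Ioo (0 : ℝ) 1)
    -- densities and first order expansion of the laws of the losses
    (f : ℝ → ℝ → ℝ) (v : ℝ → ℝ) (w : ℝ → ℝ → ℝ)
    (hloss : LossAssumptions α (lossLaw P Y Z φ) f v w)
    -- initial values and innovations of the scheme, for every bias parameter `h`
    (ξ₀ : ℝ → Ω → ℝ) (X : ℝ → ℕ → Ω → ℝ)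
    (hξ₀ : ∀ h, Measurable (ξ₀ h)) (hX : ∀ h n, Measurable (X h n))
    (hXlaw : ∀ h ∈ biasSet, ∀ n, P.map (X h n) = lossLaw P Y Z φ h)
    (hXindep : ∀ h ∈ biasSet, iIndepFun (X h) P)
    (hξ₀X : ∀ h ∈ biasSet, IndepFun (ξ₀ h) (fun ω n => X h n ω) P)
    (hinit : InitAssumption P α f ξ₀)
    -- learning rate
    (γ₁ β : ℝ) (hγ₁ : 0 < γ₁) (hβ : β ∈ Ioc (1 / 2 : ℝ) 1)
    (hβ1 : β = 1 → 1 < lambdaConst α (lossLaw P Y Z φ) * γ₁)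
    -- costs of the primitive steps
    (c : UnitCosts) :
    -- the parameters `h` and `n`
    ((∀ ε ∈ Ioo (0 : ℝ) 1, biasParam β ε ∈ biasSet ∧
        numIter (biasParam β ε) = innerSize β ε ^ 2) ∧
      (fun ε => biasParam β ε) ~[𝓝[>] 0] (fun ε => ε ^ (1 / β)) ∧
      (fun ε => (numIter (biasParam β ε) : ℝ)) ~[𝓝[>] 0] (fun ε => ε ^ (-(2 / β)))) ∧
    -- convergence in distribution
    TendstoInDistribution
      (fun (ε : ℝ) (ω : Ω) =>
        let h := biasParam β ε
        let s := nsa α γ₁ β (ξ₀ h ω) (fun n => X h n ω) (numIter h)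
        (!₂[ε⁻¹ * (s.1 - valueAtRisk α (lossLaw P Y Z φ 0)),
          ε ^ (-(1 / β)) * (s.2 - expectedShortfall α (lossLaw P Y Z φ 0))] :
            EuclideanSpace ℝ (Fin 2)))
      (𝓝[>] 0) id (fun _ => P)
      (multivariateGaussian (limitMean α β (lossLaw P Y Z φ 0) (f 0) v)
        (limitCov α γ₁ β (lossLaw P Y Z φ 0) (f 0))) ∧
    -- the algorithm computes the scheme, at the claimed cost
    (∃ C > 0, ∀ ε ∈ Ioo (0 : ℝ) 1, ∀ (x₀ : ℝ) (y : ℕ → Fin d → ℝ) (z : ℕ → ℕ → Fin q → ℝ),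
      (runNSA c φ α γ₁ β ε x₀ y z).val =
          nsa α γ₁ β x₀ (fun n => innerMean φ (innerSize β ε) (y n) (fun k => z n k))
            (numIter (biasParam β ε)) ∧
        ((runNSA c φ α γ₁ β ε x₀ y z).time : ℝ) ≤ C * ε ^ (-(3 / β))) ∧
    -- the optimal cost is the one at `β = 1`
    (β = 1 → ∃ C > 0, ∀ ε ∈ Ioo (0 : ℝ) 1,
      ∀ (x₀ : ℝ) (y : ℕ → Fin d → ℝ) (z : ℕ → ℕ → Fin q → ℝ),
        ((runNSA c φ α γ₁ β ε x₀ y z).time : ℝ) ≤ C * ε ^ (-3 : ℝ) ∧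
        ∀ β' ∈ Ioc (1 / 2 : ℝ) 1,
          (runNSA c φ α γ₁ β ε x₀ y z).time ≤ (runNSA c φ α γ₁ β' ε x₀ y z).time) := by
  have hβ0 : 0 < β := by linarith [hβ.1]
  refine ⟨⟨fun ε hε => ⟨biasParam_mem β hε.1, numIter_biasParam β ε⟩,
    biasParam_isEquivalent hβ0, numIter_isEquivalent hβ0⟩, ?_, ?_, ?_⟩
  · exact tendstoInDistribution_nsa_innerSize hY hZ hYZ hφ hδ hmoment hα hloss hξ₀ hX hXlaw hXindep
      hξ₀X hinit hγ₁ hβ hβ1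
  · exact ⟨_, by positivity, fun ε hε x₀ y z =>
      ⟨runNSA_val c φ α γ₁ β x₀ y z ε, runNSA_time_le c φ α γ₁ x₀ y z hβ0 hε⟩⟩
  · rintro rfl
    refine ⟨8 * (c.drawInit + c.drawY + c.drawZ + c.evalφ + 31 * c.op) + 1, by positivity,
      fun ε hε x₀ y z => ⟨?_, fun β' hβ' => ?_⟩⟩
    · have := runNSA_time_le c φ α γ₁ x₀ y z one_pos hε
      rwa [div_one] at this
    · exact runNSA_time_mono c φ α γ₁ 1 x₀ y z γ₁ β' (innerSize_one_le hβ' hε)
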